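/- Let $c\in\{0,1,-1\}$ and let $\tilde M^2(4c)$ be the complex space form of complex dimension two and constant holomorphic sectional curvature $4c$: $\mathbb C^2$ for $c=0$, and for $c=\pm1$ the quotient $\mathbb{CP}^2=S^5/S^1$, respectively $\mathbb{CH}^2=\mathbb H^5_1/S^1$, of the quadric $\{Z\in\mathbb C^3:(Z,Z)=c\}$, where $(Z,W)=c\,z_0\bar w_0+z_1\bar w_1+z_2\bar w_2$, with the metric that makes the projection from the quadric a Riemannian submersion. Let $\Sigma$ be a (connected) Riemann surface; everything is smooth ($C^\infty$). For a conformal Lagrangian immersion $f:\Sigma\to\tilde M^2(4c)$ with induced metric $g=2e^u\,dz\,d\bar z$ in a local complex coordinate $z$, let $F$ be a horizontal local lift of $f$ to the quadric, i.e. $\langle dF,JF\rangle=0$ (for $c=0$ let $F=f$), let $\langle\cdot,\cdot\rangle=\operatorname{Re}(\cdot,\cdot)$ and $J$ (multiplication by $i$) be extended complex linearly to the complexification of the underlying real vector space, and put $$\phi=e^{-u}\langle F_{z\bar z},JF_z\rangle,\qquad \psi=\langle F_{zz},JF_z\rangle .$$ The one-form $\Phi=\phi\,dz$ (mean curvature form)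 and the cubic differential $\Psi=\psi\,dz^3$ (cubic Hopf differential) are globally defined on $\Sigma$. **Theorem.** (1) For every conformal Lagrangian immersion $f:\Sigma\to\tilde M^2(4c)$, the data $g=2e^u\,dz\,d\bar z$, $\Phi=\phi\,dz$, $\Psi=\psi\,dz^3$ satisfy, in every local complex coordinate $z$, $$\phi_{\bar z}-\bar\phi_z=0,\qquad u_{z\bar z}+|\phi|^2+c\,e^u-e^{-2u}|\psi|^2=0,\qquad e^{-2u}\psi_{\bar z}=(e^{-u}\phi)_z .$$ (2) Conversely, let a conformal metric $g=2e^u\,dz\,d\bar z$, a one-form $\Phi=\phi\,dz$ and a cubic differential $\Psi=\psi\,dz^3$ on $\Sigma$ satisfying these three equations be given, and let $p:\tilde\Sigma\to\Sigma$ be the universal cover of $\Sigma$. Then there is a conformal Lagrangian immersion $f:\tilde\Sigma\to\tilde M^2(4c)$ whose induced metric, mean curvature form and cubic Hopf differential are $p^*g$, $p^*\Phi$ and $p^*\Psi$. It is unique up to isometries: if $f_1,f_2$ are two such immersions, then $f_2=T\circ f_1$ for some isometry $T$ of $\tilde M^2(4c)$. -/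

import Mathlib

open scoped Manifold ContDiff ComplexConjugate

noncomputable section

namespace LagrangianBonnet

/-! ### Wirtinger calculus in one complex variable -/

/-- `∂/∂z = (∂/∂x - i ∂/∂y) / 2`. -/
def dz (g : ℂ → ℂ) (z : ℂ) : ℂ :=
  (1 / 2) * (fderiv ℝ g z 1 - Complex.I * fderiv ℝ g z Complex.I)

/-- `∂/∂z̄ = (∂/∂x + i ∂/∂y) / 2`. -/
def dzbar (g : ℂ → ℂ) (z : ℂ) : ℂ :=
  (1 / 2) * (fderiv ℝ g z 1 + Complex.I * fderiv ℝ g z Complex.I)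

/-- `∂/∂z` of a vector-valued function, component by component. -/
def vdz {κ : Type} (G : ℂ → κ → ℂ) (z : ℂ) : κ → ℂ := fun k => dz (fun w => G w k) z

/-- `∂/∂z̄` of a vector-valued function, component by component. -/
def vdzbar {κ : Type} (G : ℂ → κ → ℂ) (z : ℂ) : κ → ℂ := fun k => dzbar (fun w => G w k) z

/-! ### The complex space forms of complex dimension two

The parameter `c : SignType` takes the values `0`, `1`, `-1`.  The space form of constant
holomorphic sectional curvature `4c` is

* `ℂ²` for `c = 0`,
* the complex projective plane `S⁵ / S¹` for `c = 1`,
* the complex hyperbolic plane `H⁵₁ / S¹`, `H⁵₁ = {-|z₀|² + |z₁|² + |z₂|² = -1}`, for `c = -1`.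

The metric for `c = ±1` is the one which makes the Hopf fibration a Riemannian submersion. -/

/-- Complex dimension of the linear space carrying the model: `2` if `c = 0`, and `3` otherwise. -/
def ambDim (c : SignType) : ℕ := if c = 0 then 2 else 3

/-- The linear space `ℂ²` (for `c = 0`) or `ℂ³` (for `c = ±1`). -/
abbrev Amb (c : SignType) : Type := Fin (ambDim c) → ℂ

/-- The signs `+ … +`, respectively `- + +` for `c = -1`, of the Hermitian form. -/
def sgn (c : SignType) (k : Fin (ambDim c)) : ℝ := if c = -1 ∧ (k : ℕ) = 0 then -1 else 1

/-- The Hermitian form `(Z, W) = ± z₀ w̄₀ + z₁ w̄₁ (+ z₂ w̄₂)`. -/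
def herm (c : SignType) (Z W : Amb c) : ℂ := ∑ k, (sgn c k : ℂ) * Z k * conj (W k)

/-- The real inner product `⟨Z, W⟩ = Re (Z, W)`. -/
def rinner (c : SignType) (Z W : Amb c) : ℝ := (herm c Z W).re

/-- The total space: all of `ℂ²` for `c = 0`; the quadric `(Z, Z) = c`, that is the sphere `S⁵` or
the anti-de Sitter space `H⁵₁`, for `c = ±1`. -/
def total (c : SignType) : Set (Amb c) := {Z | c ≠ 0 → herm c Z Z = ((c : ℝ) : ℂ)}

/-- Two points of the total space are identified if they differ by a unit complex number
(for `c = 0`: if they are equal). -/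
def hopfSetoid (c : SignType) : Setoid (total c) where
  r Z W := ∃ l : ℂ, ‖l‖ = 1 ∧ (c = 0 → l = 1) ∧ (W : Amb c) = l • (Z : Amb c)
  iseqv :=
    { refl := fun Z => ⟨1, by simp, fun _ => rfl, by simp⟩
      symm := by
        rintro Z W ⟨l, hl, h0, h⟩
        have hne : l ≠ 0 := by
          intro h'
          simp [h'] at hl
        refine ⟨l⁻¹, by simp [hl], fun hc => by simp [h0 hc], ?_⟩
        rw [h, smul_smul, inv_mul_cancel₀ hne, one_smul]
      trans := by
        rintro Z W Y ⟨l, hl, h0, h⟩ ⟨m, hm, h0', h'⟩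
        exact ⟨m * l, by simp [hl, hm], fun hc => by simp [h0 hc, h0' hc],
          by rw [h', h, smul_smul]⟩ }

/-- The complex space form of complex dimension two and holomorphic sectional curvature `4c`. -/
def SpaceForm (c : SignType) : Type := Quotient (hopfSetoid c)

/-- The projection of the total space onto the space form. -/
def proj (c : SignType) (Z : total c) : SpaceForm c := Quotient.mk (hopfSetoid c) Z

/-- The horizontal part of a vector `X` tangent to the total space at `Z`: the component
orthogonal to the vertical direction `J Z`, where `⟨J Z, J Z⟩ = c`.  It is `X` itself
for `c = 0`. -/
def hor (c : SignType) (Z X : Amb c) : Amb c :=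
  X - ((c : ℝ) * rinner c X (Complex.I • Z)) • (Complex.I • Z)

/-- `T` is an isometry of the space form: a bijection which is induced locally by smooth maps `G`
between total spaces, and whose differential preserves the Riemannian metric, i.e. the inner
product of horizontal parts of tangent vectors `X`, `Y` of the total space. -/
def IsIsometry (c : SignType) (T : SpaceForm c → SpaceForm c) : Prop :=
  Function.Bijective T ∧
  ∀ Z₀ ∈ total c, ∃ (V : Set (Amb c)) (G : Amb c → Amb c),
    IsOpen V ∧ Z₀ ∈ V ∧ ContDiffOn ℝ ∞ G V ∧
    (∀ Z (hZ : Z ∈ total c), Z ∈ V → ∃ hG : G Z ∈ total c, proj c ⟨G Z, hG⟩ = T (proj c ⟨Z, hZ⟩)) ∧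
    ∀ Z ∈ total c, Z ∈ V → ∀ X Y : Amb c,
      (c ≠ 0 → rinner c X Z = 0 ∧ rinner c Y Z = 0) →
      rinner c (hor c (G Z) (fderiv ℝ G Z X)) (hor c (G Z) (fderiv ℝ G Z Y)) =
        rinner c (hor c Z X) (hor c Z Y)

/-! ### Complexification of the underlying real vector space -/

/-- The vector of real coordinates (real and imaginary parts) of a vector, regarded as an element
of the complexification of the underlying real vector space. -/
def cx {c : SignType} (Z : Amb c) : Fin (ambDim c) × Fin 2 → ℂ :=
  fun k => if k.2 = 0 then ((Z k.1).re : ℂ) else ((Z k.1).im : ℂ)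

/-- The complex linear extension of the complex structure `J` (multiplication by `i`). -/
def cJ {c : SignType} (v : Fin (ambDim c) × Fin 2 → ℂ) : Fin (ambDim c) × Fin 2 → ℂ :=
  fun k => if k.2 = 0 then - v (k.1, 1) else v (k.1, 0)

/-- The complex bilinear extension of the real inner product. -/
def cinner (c : SignType) (v w : Fin (ambDim c) × Fin 2 → ℂ) : ℂ :=
  ∑ k, (sgn c k.1 : ℂ) * v k * w k

/-! ### Riemann surfaces, local coordinates and differentials -/

section Surfaces

variable {S : Type*} [TopologicalSpace S] [ChartedSpace ℂ S]
variable {S' : Type*} [TopologicalSpace S'] [ChartedSpace ℂ S']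

/-- `e` is a local complex coordinate of the Riemann surface `S`. -/
def IsCoord (e : OpenPartialHomeomorph S ℂ) : Prop := e ∈ IsManifold.maximalAtlas 𝓘(ℂ) ω S

variable (S) in
/-- A family of coefficient functions `u`, `φ`, `ψ`, one triple for each local coordinate. -/
structure Coefficients where
  u : OpenPartialHomeomorph S ℂ → ℂ → ℝ
  phi : OpenPartialHomeomorph S ℂ → ℂ → ℂ
  psi : OpenPartialHomeomorph S ℂ → ℂ → ℂ

/-- `D'` is the pullback of `D` under the holomorphic map `p`, i.e. the coefficients
of `2 e^u dz dz̄`, `φ dz`, `ψ dz³` transform by the chain rule. -/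
def IsPullback (p : S' → S) (D : Coefficients S) (D' : Coefficients S') : Prop :=
  ∀ (e : OpenPartialHomeomorph S ℂ) (e' : OpenPartialHomeomorph S' ℂ), IsCoord e → IsCoord e' →
    ∀ z ∈ e'.target, p (e'.symm z) ∈ e.source →
      let t : ℂ → ℂ := fun w => e (p (e'.symm w))
      Real.exp (D'.u e' z) = Real.exp (D.u e (t z)) * ‖deriv t z‖ ^ 2 ∧
      D'.phi e' z = D.phi e (t z) * deriv t z ∧
      D'.psi e' z = D.psi e (t z) * deriv t z ^ 3

variable (S) in
/-- A smooth conformal metric `2 e^u dz dz̄`, a smooth one-form `φ dz` and a smooth cubic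
differential `ψ dz³` on the Riemann surface `S`. -/
structure SurfaceData extends Coefficients S where
  smooth_u : ∀ e, IsCoord e → ContDiffOn ℝ ∞ (u e) e.target
  smooth_phi : ∀ e, IsCoord e → ContDiffOn ℝ ∞ (phi e) e.target
  smooth_psi : ∀ e, IsCoord e → ContDiffOn ℝ ∞ (psi e) e.target
  /-- Independence of the choice of the local coordinate. -/
  change_coord : IsPullback id toCoefficients toCoefficients

/-- The integrability, Gauss and Codazzi equations
`φ_z̄ - φ̄_z = 0`, `u_{zz̄} + |φ|² + c e^u - e^{-2u} |ψ|² = 0`, `e^{-2u} ψ_z̄ = (e^{-u} φ)_z`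
in every local coordinate. -/
def SurfaceData.IsCompatible (c : SignType) (D : SurfaceData S) : Prop :=
  ∀ e : OpenPartialHomeomorph S ℂ, IsCoord e → ∀ z ∈ e.target,
    dzbar (D.phi e) z - dz (fun w => conj (D.phi e w)) z = 0 ∧
    dzbar (dz fun w => (D.u e w : ℂ)) z + (‖D.phi e z‖ : ℂ) ^ 2
      + ((c : ℝ) : ℂ) * (Real.exp (D.u e z) : ℂ)
      - (Real.exp (-2 * D.u e z) : ℂ) * (‖D.psi e z‖ : ℂ) ^ 2 = 0 ∧
    (Real.exp (-2 * D.u e z) : ℂ) * dzbar (D.psi e) z =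
      dz (fun w => (Real.exp (-D.u e w) : ℂ) * D.phi e w) z

/-- `p` exhibits the Riemann surface `S'` as the universal cover of `S`: `S'` is simply connected
and `p` is a covering map and a local biholomorphism. -/
structure IsUniversalCover (p : S' → S) : Prop where
  simplyConnected : SimplyConnectedSpace S'
  covering : IsCoveringMap p
  localBiholomorphism : IsLocalDiffeomorph 𝓘(ℂ) 𝓘(ℂ) ω p

/-! ### Conformal Lagrangian immersions and their invariants -/

/-- `F` is a smooth lift of `f` to the total space over the open set `V` in the coordinate `e`. -/
structure IsLocalLift (c : SignType) (f : S → SpaceForm c) (e : OpenPartialHomeomorph S ℂ)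
    (V : Set ℂ) (F : ℂ → Amb c) : Prop where
  isOpen : IsOpen V
  subset : V ⊆ e.target
  smooth : ContDiffOn ℝ ∞ F V
  lift : ∀ z ∈ V, ∃ h : F z ∈ total c, proj c ⟨F z, h⟩ = f (e.symm z)

/-- The lift `F` is horizontal over `V`: `⟨dF, J F⟩ = 0` (no condition for `c = 0`). -/
def IsHorizontal (c : SignType) (V : Set ℂ) (F : ℂ → Amb c) : Prop :=
  c ≠ 0 → ∀ z ∈ V, ∀ X : ℂ, rinner c (fderiv ℝ F z X) (Complex.I • F z) = 0

/-- The pullback of the metric of the space form, computed from a local lift `F`. -/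
def pullMetric (c : SignType) (F : ℂ → Amb c) (z X Y : ℂ) : ℝ :=
  rinner c (hor c (F z) (fderiv ℝ F z X)) (hor c (F z) (fderiv ℝ F z Y))

/-- The pullback of the Kähler form `ω(X, Y) = h(J X, Y)` of the space form, computed from a local
lift `F`. -/
def pullKaehler (c : SignType) (F : ℂ → Amb c) (z X Y : ℂ) : ℝ :=
  rinner c (Complex.I • hor c (F z) (fderiv ℝ F z X)) (hor c (F z) (fderiv ℝ F z Y))

/-- `f` is a smooth conformal Lagrangian immersion of the Riemann surface `S` into the space form.
Since the projection of the total space is a submersion, a map into the space form is smooth if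
and only if it has smooth local lifts; the pullbacks of the metric and of the Kähler
form do not depend on the lift. -/
structure IsConformalLagrangianImmersion (c : SignType) (f : S → SpaceForm c) : Prop where
  smooth : ∀ e : OpenPartialHomeomorph S ℂ, IsCoord e → ∀ z ∈ e.target,
    ∃ (V : Set ℂ) (F : ℂ → Amb c), z ∈ V ∧ IsLocalLift c f e V F
  conformal : ∀ e : OpenPartialHomeomorph S ℂ, IsCoord e → ∀ V F, IsLocalLift c f e V F →
    ∀ z ∈ V, ∃ r : ℝ, 0 < r ∧ ∀ X Y : ℂ, pullMetric c F z X Y = r * (X * conj Y).re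
  lagrangian : ∀ e : OpenPartialHomeomorph S ℂ, IsCoord e → ∀ V F, IsLocalLift c f e V F →
    ∀ z ∈ V, ∀ X Y : ℂ, pullKaehler c F z X Y = 0

/-- The map `f` has induced metric `2 e^u dz dz̄`, mean curvature form `φ dz` and
cubic Hopf differential `ψ dz³`, where `φ = e^{-u} ⟨F_{zz̄}, J F_z⟩` and `ψ = ⟨F_{zz}, J F_z⟩` for
every horizontal local lift `F` (for `c = 0`: for `F = f`). -/
structure HasData (c : SignType) (f : S → SpaceForm c) (D : SurfaceData S) : Prop where
  metric : ∀ e : OpenPartialHomeomorph S ℂ, IsCoord e → ∀ V F, IsLocalLift c f e V F →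
    ∀ z ∈ V, ∀ X Y : ℂ, pullMetric c F z X Y = 2 * Real.exp (D.u e z) * (X * conj Y).re
  meanCurvature : ∀ e : OpenPartialHomeomorph S ℂ, IsCoord e → ∀ V F, IsLocalLift c f e V F →
    IsHorizontal c V F → ∀ z ∈ V,
      D.phi e z = (Real.exp (-D.u e z) : ℂ) *
        cinner c (vdzbar (vdz fun w => cx (F w)) z) (cJ (vdz (fun w => cx (F w)) z))
  hopf : ∀ e : OpenPartialHomeomorph S ℂ, IsCoord e → ∀ V F, IsLocalLift c f e V F →
    IsHorizontal c V F → ∀ z ∈ V,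
      D.psi e z = cinner c (vdz (vdz fun w => cx (F w)) z) (cJ (vdz (fun w => cx (F w)) z))

end Surfaces

end LagrangianBonnet

end

noncomputable section

namespace LagrangianBonnet

/-! ### Gluing local solutions on a simply connected space -/

section Gluing

open Filter Topology

variable {X Y : Type*} [TopologicalSpace X]

/-! For a horizontal lift F, conformality and the Lagrangian condition together say that F_z and
F_z̄ are Hermitian orthogonal, both of square norm e^u, and orthogonal to F when c ≠ 0 (`IsFrame`).
Hence F_z, F_z̄ and, for c ≠ 0, F form a moving orthogonal basis of the ambient space. The second
derivatives of F expand in this basis with coefficients built from u_z, φ, ψ and e^u; these are the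
structure equations `IsSolution.wz_wz`, `IsSolution.wzb_wz` and `IsSolution.wzb_wzb`.

Necessity: the mixed third derivatives of F commute, and comparing coefficients in the frame gives
the three equations (`IsSolution.isIntegrable`). Horizontal lifts exist locally because the
Lagrangian condition makes the vertical part of dF a closed form (`IsLift.exists_horizontal`). They
are unique up to a locally constant phase (`IsLift.eventuallyEq_smul`), so the data depend only on
the immersion (`IsSolution.data_unique`).

Sufficiency: the structure equations have the form dw = θ w for a linear connection θ, and the same
three equations make θ flat (`structConn_flat`). A flat connection has parallel sections over small
balls with any initial value (`exists_parallel_of_flat`): transport along rays, and flatness gives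
the endpoint the required derivative in every direction. The frame relations propagate from the
initial point (`IsMovingFrame.isFrame`).

A local solution is determined by its frame at one point, so germs of maps into the space form with
the given data continue uniquely over small balls. These germs form a covering of the surface, which
has a global section when the surface is simply connected (`exists_forall_of_germ_continuation`).
Germs of maps are glued rather than germs of lifts, so the phase ambiguity plays no role. For
uniqueness, the ambient motion matching the two frames at one point matches the maps nearby, and
then everywhere by connectedness (`eqOn_of_isSolvedBy`). -/

/-- Two pairs `(x, f)`, `(y, g)` are identified if `x = y` and `f`, `g` have the same germ there. -/
def germSetoid (P : X → (X → Y) → Prop) : Setoid {q : X × (X → Y) // P q.1 q.2} where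
  r a b := a.1.1 = b.1.1 ∧ a.1.2 =ᶠ[𝓝 a.1.1] b.1.2
  iseqv :=
    { refl := fun _ => ⟨rfl, EventuallyEq.refl _ _⟩
      symm := fun h => ⟨h.1.symm, h.1 ▸ h.2.symm⟩
      trans := fun h k => ⟨h.1.trans k.1, h.2.trans (h.1 ▸ k.2)⟩ }

/-- The étalé space of germs of functions satisfying a local predicate. -/
def GermSpace (P : X → (X → Y) → Prop) : Type _ := Quotient (germSetoid P)

namespace GermSpace

variable {P : X → (X → Y) → Prop}

/-- The germ of `f` at `x`. -/
def mk (x : X) (f : X → Y) (h : P x f) : GermSpace P := Quotient.mk (germSetoid P) ⟨(x, f), h⟩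

/-- The base point of a germ. -/
def base (s : GermSpace P) : X :=
  Quotient.lift (s := germSetoid P) (fun q => q.1.1) (fun _ _ h => h.1) s

lemma mk_eq_mk {x y : X} {f g : X → Y} {hf : P x f} {hg : P y g} :
    mk x f hf = mk y g hg ↔ x = y ∧ f =ᶠ[𝓝 x] g := by
  exact Quotient.eq (r := germSetoid P)

lemma exists_rep (s : GermSpace P) : ∃ f, ∃ h : P (base s) f, s = mk (base s) f h := by
  induction s using Quotient.inductionOn with
  | h a => exact ⟨a.1.2, a.2, rfl⟩

/-- This is the finest topology for which every section y ↦ germ of f at y is continuous on the set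
where P y f holds. The inner quantifier over h' makes the condition vacuous at points outside that
set. -/
instance : TopologicalSpace (GermSpace P) where
  IsOpen O := ∀ x f (h : P x f), mk x f h ∈ O → ∀ᶠ y in 𝓝 x, ∀ h' : P y f, mk y f h' ∈ O
  isOpen_univ := fun _ _ _ _ => Eventually.of_forall fun _ _ => trivial
  isOpen_inter := fun s t hs ht x f h hm => by
    filter_upwards [hs x f h hm.1, ht x f h hm.2] with y h1 h2 h'
    exact ⟨h1 h', h2 h'⟩
  isOpen_sUnion := fun S hS x f h hm => by
    obtain ⟨t, ht, hmt⟩ := hm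
    filter_upwards [hS t ht x f h hmt] with y h1 h'
    exact ⟨t, ht, h1 h'⟩

lemma isOpen_iff {O : Set (GermSpace P)} : IsOpen O ↔
    ∀ x f (h : P x f), mk x f h ∈ O → ∀ᶠ y in 𝓝 x, ∀ h' : P y f, mk y f h' ∈ O := Iff.rfl

lemma isOpen_preimage_base {U : Set X} (hU : IsOpen U) :
    IsOpen ((base : GermSpace P → X) ⁻¹' U) := by
  rw [isOpen_iff]
  intro x f h hx
  filter_upwards [hU.mem_nhds hx] with y hy h'
  exact hy

/-- The sheets over U are the solutions on U. Continuation of germs to all of U makes the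
trivialization surjective, and unique continuation makes it injective. -/
lemma isEvenlyCovered_base {x : X} {U : Set X} (hU : IsOpen U) (hxU : x ∈ U)
    (hext : ∀ y ∈ U, ∀ f, P y f → ∃ g, (∀ w ∈ U, P w g) ∧ f =ᶠ[𝓝 y] g)
    (huniq : ∀ f g, (∀ w ∈ U, P w f) → (∀ w ∈ U, P w g) → ∀ y ∈ U, f =ᶠ[𝓝 y] g → Set.EqOn f g U) :
    IsEvenlyCovered (base : GermSpace P → X) x ((base : GermSpace P → X) ⁻¹' {x}) := by
  -- The functions live on all of X, but only their values on U matter for the sheet they define.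
  let st : Setoid {g : X → Y // ∀ w ∈ U, P w g} :=
    { r := fun f g => Set.EqOn f.1 g.1 U
      iseqv :=
        { refl := fun f => Set.eqOn_refl _ _
          symm := fun h => h.symm
          trans := fun h k => h.trans k } }
  let _ : TopologicalSpace (Quotient st) := ⊥
  have hd : DiscreteTopology (Quotient st) := ⟨rfl⟩
  refine IsEvenlyCovered.to_isEvenlyCovered_preimage (I := Quotient st) ⟨hd, U, hxU, hU, isOpen_preimage_base hU, ?_⟩
  let Φ : U × Quotient st → (base : GermSpace P → X) ⁻¹' U := fun q =>
    ⟨Quotient.lift (fun g : {g : X → Y // ∀ w ∈ U, P w g} => mk q.1.1 g.1 (g.2 _ q.1.2))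
      (fun f g hfg => mk_eq_mk.2 ⟨rfl, by
        filter_upwards [hU.mem_nhds q.1.2] with w hw
        exact hfg hw⟩) q.2, by
      obtain ⟨y, s⟩ := q
      induction s using Quotient.inductionOn with
      | h a => exact y.2⟩
  have hΦ : ∀ (y : U) (g : {g : X → Y // ∀ w ∈ U, P w g}),
      (Φ (y, Quotient.mk st g)).1 = mk y.1 g.1 (g.2 _ y.2) := fun y g => rfl
  have hinj : Function.Injective Φ := by
    rintro ⟨y, s⟩ ⟨y', s'⟩ h
    induction s using Quotient.inductionOn with
    | h a =>
    induction s' using Quotient.inductionOn with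
    | h a' =>
    have h1 := congrArg Subtype.val h
    rw [hΦ, hΦ, mk_eq_mk] at h1
    refine Prod.ext (Subtype.ext h1.1) ?_
    exact Quotient.sound (huniq _ _ a.2 a'.2 y.1 y.2 h1.2)
  have hsurj : Function.Surjective Φ := by
    rintro ⟨s, hs⟩
    obtain ⟨f, hf, hsf⟩ := exists_rep s
    obtain ⟨g, hg, hfg⟩ := hext (base s) hs f hf
    refine ⟨(⟨base s, hs⟩, Quotient.mk st ⟨g, hg⟩), Subtype.ext ?_⟩
    exact (hΦ _ _).trans ((mk_eq_mk.2 ⟨rfl, hfg.symm⟩).trans hsf.symm)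
  have hcont : Continuous Φ := by
    refine continuous_induced_rng.2 (continuous_prod_of_discrete_right.2 fun s => ?_)
    induction s using Quotient.inductionOn with
    | h a =>
    rw [continuous_def]
    intro O hO
    rw [isOpen_iff_mem_nhds]
    intro y hy
    have h1 := isOpen_iff.1 hO y.1 a.1 (a.2 _ y.2) hy
    have h2 : ∀ᶠ y' : U in 𝓝 y, ∀ h' : P y'.1 a.1, mk y'.1 a.1 h' ∈ O :=
      continuous_subtype_val.continuousAt.eventually h1
    filter_upwards [h2] with y' hy'
    exact hy' (a.2 _ y'.2)
  -- A representative f of a germ in the image agrees near its base point with the solution a of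
  -- that sheet, so the germs of f at nearby points lie in the image as well.
  have hop : IsOpenMap Φ := by
    intro W hW
    refine isOpen_induced_iff.2 ⟨Subtype.val '' (Φ '' W), ?_, ?_⟩
    · rw [isOpen_iff]
      rintro z f hf ⟨-, ⟨⟨y, s⟩, hW', rfl⟩, hz⟩
      induction s using Quotient.inductionOn with
      | h a =>
      rw [hΦ, mk_eq_mk] at hz
      obtain ⟨rfl, hag⟩ := hz
      have h1 : ∀ᶠ y' : U in 𝓝 y, (y', Quotient.mk st a) ∈ W :=
        (Continuous.prodMk_left (Quotient.mk st a)).continuousAt.eventually (hW.mem_nhds hW')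
      rw [nhds_subtype_eq_comap, eventually_comap] at h1
      filter_upwards [h1, hU.mem_nhds y.2, hag.eventuallyEq_nhds] with y' h2 h3 h4 h'
      exact ⟨_, ⟨_, h2 ⟨y', h3⟩ rfl, rfl⟩, (hΦ _ _).trans (mk_eq_mk.2 ⟨rfl, h4⟩)⟩
    · exact Set.preimage_image_eq _ Subtype.val_injective
  let H : U × Quotient st ≃ₜ (base : GermSpace P → X) ⁻¹' U :=
    (Equiv.ofBijective Φ ⟨hinj, hsurj⟩).toHomeomorphOfContinuousOpen hcont hop
  refine ⟨H.symm, fun s => ?_⟩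
  obtain ⟨⟨y, t⟩, rfl⟩ := H.surjective s
  rw [H.symm_apply_apply]
  induction t using Quotient.inductionOn with
  | h a => rfl

end GermSpace

/-- On a simply connected space, germs which can be continued uniquely over small open sets extend
to a global function. -/
theorem exists_forall_of_germ_continuation [SimplyConnectedSpace X] [LocallyPathConnectedSpace X]
    (P : X → (X → Y) → Prop) (hcongr : ∀ x f g, f =ᶠ[𝓝 x] g → P x f → P x g)
    (hopen : ∀ x f, P x f → ∀ᶠ y in 𝓝 x, P y f)
    (hcont : ∀ x, ∃ U, IsOpen U ∧ x ∈ U ∧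
      (∀ y ∈ U, ∀ f, P y f → ∃ g, (∀ w ∈ U, P w g) ∧ f =ᶠ[𝓝 y] g) ∧
      ∀ f g, (∀ w ∈ U, P w f) → (∀ w ∈ U, P w g) → ∀ y ∈ U, f =ᶠ[𝓝 y] g → Set.EqOn f g U)
    (hne : ∃ x f, P x f) : ∃ f, ∀ x, P x f := by
  have hcov : IsCoveringMap (GermSpace.base : GermSpace P → X) := by
    intro x
    obtain ⟨U, hU, hxU, h1, h2⟩ := hcont x
    exact GermSpace.isEvenlyCovered_base hU hxU h1 h2
  obtain ⟨x₀, f₀, h₀⟩ := hne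
  -- Simple connectedness enters here: the identity map lifts through the covering, which gives a
  -- global section s.
  obtain ⟨s, ⟨-, hs⟩, -⟩ := hcov.existsUnique_continuousMap_lifts (ContinuousMap.id X) x₀
    (GermSpace.mk x₀ f₀ h₀) rfl
  have hb : ∀ x, GermSpace.base (s x) = x := fun x => congrFun hs x
  have hrep : ∀ x, ∃ f, ∃ h : P x f, s x = GermSpace.mk x f h := by
    intro x
    obtain ⟨f, h, hf⟩ := GermSpace.exists_rep (s x)
    have h' : P x f := hb x ▸ h
    refine ⟨f, h', hf.trans (GermSpace.mk_eq_mk.2 ⟨hb x, EventuallyEq.refl _ _⟩)⟩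
  choose F hF hsF using hrep
  -- The glued function takes at x the value of a representative of the germ s x. By continuity s y
  -- is the germ of the fixed F x for all y near x, so the diagonal agrees with F x near x.
  refine ⟨fun x => F x x, fun x => ?_⟩
  refine hcongr x (F x) _ ?_ (hF x)
  have hO : IsOpen {t : GermSpace P | ∃ (y : X) (h : P y (F x)), t = GermSpace.mk y (F x) h} := by
    rw [GermSpace.isOpen_iff]
    rintro z f hf ⟨y, h, hy⟩
    obtain ⟨rfl, hfx⟩ := GermSpace.mk_eq_mk.1 hy
    filter_upwards [hfx.eventuallyEq_nhds, hopen _ _ h] with w hw hw' h'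
    exact ⟨w, hw', GermSpace.mk_eq_mk.2 ⟨rfl, hw⟩⟩
  have h1 := s.continuous.continuousAt.eventually (hO.mem_nhds ⟨x, hF x, hsF x⟩)
  filter_upwards [h1] with y hy
  obtain ⟨z, hz, hyz⟩ := hy
  rw [hsF y, GermSpace.mk_eq_mk] at hyz
  exact hyz.2.symm.self_of_nhds

end Gluing

/-! ### Flat linear connections -/

section Frobenius

set_option maxSynthPendingDepth 3

open Set Filter Topology
open scoped NNReal

variable {E W : Type*} [NormedAddCommGroup E] [NormedSpace ℝ E] [NormedAddCommGroup W]
  [NormedSpace ℝ W]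

lemma hasDerivAt_segment (y v : E) (t : ℝ) : HasDerivAt (fun s : ℝ => y + s • v) v t := by
  simpa using ((hasDerivAt_id t).smul_const v).const_add y

lemma Convex.segment_mem {U : Set E} (hU : Convex ℝ U) {y z : E} (hy : y ∈ U) (hz : z ∈ U)
    {t : ℝ} (ht : t ∈ Icc (0 : ℝ) 1) : y + t • (z - y) ∈ U :=
  hU.add_smul_sub_mem hy hz ht

/-- Grönwall uniqueness on convex sets. -/
theorem eq_zero_of_norm_fderiv_le_mul_norm {U : Set E} (hU : Convex ℝ U) {G : E → W}
    {G' : E → E →L[ℝ] W} {K : E → ℝ} (hG : ∀ z ∈ U, HasFDerivAt G (G' z) z)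
    (hK : ContinuousOn K U) (hGK : ∀ z ∈ U, ‖G' z‖ ≤ K z * ‖G z‖) {y : E} (hy : y ∈ U)
    (h0 : G y = 0) : ∀ z ∈ U, G z = 0 := by
  intro z hz
  have hseg : ∀ t ∈ Icc (0 : ℝ) 1, y + t • (z - y) ∈ U := fun t ht => Convex.segment_mem hU hy hz ht
  have hcont : ContinuousOn (fun t : ℝ => K (y + t • (z - y))) (Icc 0 1) :=
    hK.comp (by fun_prop) hseg
  -- K need only be continuous; on the compact segment it has a bound M, and Grönwall is applied
  -- along the segment.
  obtain ⟨M, hM⟩ := (isCompact_Icc.image_of_continuousOn hcont).bddAbove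
  have hd : ∀ t ∈ Icc (0 : ℝ) 1, HasDerivAt (fun s : ℝ => G (y + s • (z - y)))
      (G' (y + t • (z - y)) (z - y)) t := fun t ht =>
    (hG _ (hseg t ht)).comp_hasDerivAt t (hasDerivAt_segment y (z - y) t)
  have h1 := eq_zero_of_abs_deriv_le_mul_abs_self_of_eq_zero_right
    (f := fun s : ℝ => G (y + s • (z - y))) (K := M * ‖z - y‖) (a := 0) (b := 1)
    (fun t ht => (hd t ht).continuousAt.continuousWithinAt)
    (fun t ht => (hd t ⟨ht.1, ht.2.le⟩).hasDerivWithinAt) (by simpa using h0)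
    (fun t ht => by
      have ht' : t ∈ Icc (0 : ℝ) 1 := ⟨ht.1, ht.2.le⟩
      have h2 : K (y + t • (z - y)) ≤ M := hM ⟨t, ht', rfl⟩
      calc _ ≤ ‖G' (y + t • (z - y))‖ * ‖z - y‖ := ContinuousLinearMap.le_opNorm _ _
        _ ≤ (M * ‖G (y + t • (z - y))‖) * ‖z - y‖ := by
          gcongr
          exact (hGK _ (hseg t ht')).trans (by gcongr)
        _ = _ := by ring)
    1 (by simp)
  simpa using h1

/-- Two solutions of `dw = θ w` on a convex set which agree at a point are equal. -/
theorem eqOn_of_hasFDerivAt_flip {U : Set E} (hU : Convex ℝ U) {θ : E → E →L[ℝ] W →L[ℝ] W}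
    (hθ : ContinuousOn θ U) {w₁ w₂ : E → W} (h₁ : ∀ z ∈ U, HasFDerivAt w₁ ((θ z).flip (w₁ z)) z)
    (h₂ : ∀ z ∈ U, HasFDerivAt w₂ ((θ z).flip (w₂ z)) z) {y : E} (hy : y ∈ U) (h : w₁ y = w₂ y) :
    EqOn w₁ w₂ U := by
  intro z hz
  refine sub_eq_zero.1 (eq_zero_of_norm_fderiv_le_mul_norm hU (G := fun z => w₁ z - w₂ z)
    (K := fun z => ‖θ z‖) (fun z hz => (h₁ z hz).sub (h₂ z hz)) hθ.norm (fun z _ => ?_) hy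
    (sub_eq_zero.2 h) z hz)
  rw [← map_sub]
  exact ((θ z).flip.le_opNorm _).trans (by rw [ContinuousLinearMap.opNorm_flip])

variable [CompleteSpace W]

/-- Parallel transport along a segment, for a small connection form. -/
lemma exists_parallel_segment {θ : E → E →L[ℝ] W →L[ℝ] W} {y v : E}
    (hθ : ContinuousOn (fun t : ℝ => θ (y + t • v)) (Icc 0 1))
    (hsmall : ∀ t ∈ Icc (0 : ℝ) 1, ‖θ (y + t • v)‖ * ‖v‖ ≤ 1 / 2) (w₀ : W) :
    ∃ α : ℝ → W, α 0 = w₀ ∧ ∀ t ∈ Icc (0 : ℝ) 1,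
      HasDerivWithinAt α (θ (y + t • v) v (α t)) (Icc 0 1) t := by
  have hn : ∀ t ∈ Icc (0 : ℝ) 1, ‖θ (y + t • v) v‖ ≤ 1 / 2 := fun t ht =>
    (ContinuousLinearMap.le_opNorm _ _).trans (hsmall t ht)
  -- On the ball of radius ‖w₀‖ about w₀ vectors have norm at most 2‖w₀‖, so the field is bounded by
  -- ‖w₀‖ and the solution stays in the ball for the whole unit time.
  have hP : IsPicardLindelof (fun t w => θ (y + t • v) v w) (tmin := 0) (tmax := 1)
      ⟨0, by simp⟩ w₀ ‖w₀‖₊ 0 ‖w₀‖₊ (1 / 2) :=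
    { lipschitzOnWith := fun t ht => by
        refine ((θ (y + t • v) v).lipschitz.weaken ?_).lipschitzOnWith
        rw [← NNReal.coe_le_coe]
        simpa using hn t ht
      continuousOn := fun w _ => by
        exact (hθ.clm_apply continuousOn_const).clm_apply continuousOn_const
      norm_le := fun t ht w hw => by
        have h1 : ‖w‖ ≤ 2 * ‖w₀‖ := by
          have h2 : ‖w - w₀‖ ≤ ‖w₀‖ := by simpa [dist_eq_norm] using hw
          have h3 := norm_le_norm_add_norm_sub' w w₀
          linarith
        calc _ ≤ ‖θ (y + t • v) v‖ * ‖w‖ := ContinuousLinearMap.le_opNorm _ _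
          _ ≤ (1 / 2) * (2 * ‖w₀‖) := by gcongr; exact hn t ht
          _ = _ := by simp
      mul_max_le := by simp }
  exact hP.exists_eq_forall_mem_Icc_hasDerivWithinAt₀

omit [CompleteSpace W] in
/-- The variation of the parallel transport along rays under a flat connection. -/
lemma norm_parallel_sub_le {U : Set E} (hU : Convex ℝ U) {θ : E → E →L[ℝ] W →L[ℝ] W}
    {θ' : E → E →L[ℝ] E →L[ℝ] W →L[ℝ] W} (hθ : ∀ z ∈ U, HasFDerivAt θ (θ' z) z)
    (hflat : ∀ z ∈ U, ∀ X Y, θ' z X Y + θ z Y ∘L θ z X = θ' z Y X + θ z X ∘L θ z Y)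
    {K : ℝ} (hK : 0 < K) (hθK : ∀ z ∈ U, ‖θ z‖ ≤ K) (hθ'K : ∀ z ∈ U, ‖θ' z‖ ≤ K)
    (hθ'L : ∀ z ∈ U, ∀ z' ∈ U, ‖θ' z - θ' z'‖ ≤ K * ‖z - z'‖) {y v h : E} (hy : y ∈ U)
    (hv : y + v ∈ U) (hvh : y + (v + h) ∈ U) (hv1 : ‖v + h‖ ≤ 1) {α β : ℝ → W}
    (hαβ : α 0 = β 0)
    (hα : ∀ t ∈ Icc (0 : ℝ) 1, HasDerivWithinAt α (θ (y + t • v) v (α t)) (Icc 0 1) t)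
    (hβ : ∀ t ∈ Icc (0 : ℝ) 1,
      HasDerivWithinAt β (θ (y + t • (v + h)) (v + h) (β t)) (Icc 0 1) t)
    {A : ℝ} (hA : ∀ t ∈ Icc (0 : ℝ) 1, ‖α t‖ ≤ A) :
    ‖β 1 - α 1 - θ (y + v) h (α 1)‖ ≤ (2 * K * (1 + K) * A * ‖h‖ ^ 2) / K * (Real.exp K - 1) := by
  have hA0 : 0 ≤ A := (norm_nonneg _).trans (hA 0 (by simp))
  have hseg : ∀ t ∈ Icc (0 : ℝ) 1, y + t • v ∈ U := fun t ht => by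
    simpa using Convex.segment_mem hU hy hv ht
  have hseg' : ∀ t ∈ Icc (0 : ℝ) 1, y + t • (v + h) ∈ U := fun t ht => by
    simpa using Convex.segment_mem hU hy hvh ht
  -- The error of the expected first variation: if w is parallel with w(y + tv) = α t, then moving
  -- the endpoint by t h changes w to first order by t θ(y + tv) h (α t).
  set D : ℝ → W := fun t => β t - α t - t • θ (y + t • v) h (α t) with hD
  -- A term linear in D plus remainders that are quadratic in h; this is the shape needed for
  -- Grönwall.
  set D' : ℝ → W := fun t => θ (y + t • (v + h)) (v + h) (D t) +
    (((θ (y + t • (v + h)) - θ (y + t • v) - θ' (y + t • v) (t • h)) (v + h)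
      + t • θ' (y + t • v) h h) (α t)
      + ((θ (y + t • (v + h)) - θ (y + t • v)) (v + h) + θ (y + t • v) h)
        (t • θ (y + t • v) h (α t))) with hD'
  have hder : ∀ t ∈ Icc (0 : ℝ) 1, HasDerivWithinAt D (D' t) (Icc 0 1) t := by
    intro t ht
    have h1 : HasDerivWithinAt (fun s : ℝ => θ (y + s • v)) (θ' (y + t • v) v) (Icc 0 1) t :=
      ((hθ _ (hseg t ht)).comp_hasDerivAt t (hasDerivAt_segment y v t)).hasDerivWithinAt
    have h2 : HasDerivWithinAt (fun s : ℝ => θ (y + s • v) h) (θ' (y + t • v) v h) (Icc 0 1) t := by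
      simpa using h1.clm_apply (hasDerivWithinAt_const t _ h)
    have h3 := (hasDerivAt_id t).hasDerivWithinAt.smul (h2.clm_apply (hα t ht))
    have h4 := ((hβ t ht).sub (hα t ht)).sub h3
    refine h4.congr_deriv ?_
    -- Flatness trades the derivative of θ in direction v, applied to h, for the derivative in
    -- direction h, applied to v, which is the one occurring in the Taylor expansion of θ. The
    -- quadratic terms in θ cancel at the same time.
    have hf := congrArg (fun L : W →L[ℝ] W => L (α t)) (hflat _ (hseg t ht) v h)
    simp only [add_apply, ContinuousLinearMap.comp_apply] at hf
    simp only [hD', hD, id, add_apply, sub_apply, smul_apply, map_sub, map_add, map_smul, one_smul]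
    linear_combination (norm := module) (-t) • hf
  have hmv : ∀ t ∈ Icc (0 : ℝ) 1, ‖θ (y + t • (v + h)) - θ (y + t • v)‖ ≤ K * ‖h‖ ∧
      ‖θ (y + t • (v + h)) - θ (y + t • v) - θ' (y + t • v) (t • h)‖ ≤ K * ‖h‖ ^ 2 := by
    intro t ht
    have hsub : y + t • (v + h) - (y + t • v) = t • h := by module
    have hth : ‖t • h‖ ≤ ‖h‖ := by
      rw [norm_smul, Real.norm_of_nonneg ht.1]
      exact mul_le_of_le_one_left (norm_nonneg _) ht.2
    have hsU : segment ℝ (y + t • v) (y + t • (v + h)) ⊆ U :=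
      hU.segment_subset (hseg t ht) (hseg' t ht)
    constructor
    · have := Convex.norm_image_sub_le_of_norm_hasFDerivWithin_le
        (fun z hz => (hθ z hz).hasFDerivWithinAt) hθ'K hU (hseg t ht) (hseg' t ht)
      rw [hsub] at this
      exact this.trans (by gcongr)
    · have := Convex.norm_image_sub_le_of_norm_hasFDerivWithin_le' (C := K * ‖h‖)
        (φ := θ' (y + t • v)) (fun z hz => (hθ z (hsU hz)).hasFDerivWithinAt)
        (fun z hz => (hθ'L z (hsU hz) _ (hseg t ht)).trans (by
          gcongr
          refine (norm_sub_le_of_mem_segment hz).trans ?_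
          rw [hsub]
          exact hth)) (convex_segment _ _) (left_mem_segment ℝ _ _) (right_mem_segment ℝ _ _)
      rw [hsub] at this
      refine this.trans ?_
      rw [pow_two, ← mul_assoc]
      gcongr
  have hbound : ∀ t ∈ Icc (0 : ℝ) 1, ‖D' t‖ ≤ K * ‖D t‖ + 2 * K * (1 + K) * A * ‖h‖ ^ 2 := by
    intro t ht
    obtain ⟨hm1, hm2⟩ := hmv t ht
    have e1 : ‖θ (y + t • (v + h)) (v + h) (D t)‖ ≤ K * ‖D t‖ := by
      refine ContinuousLinearMap.le_of_opNorm_le _ ?_ _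
      refine (ContinuousLinearMap.le_opNorm _ _).trans ?_
      calc _ ≤ K * 1 := by gcongr; exact hθK _ (hseg' t ht)
        _ = K := mul_one K
    have e2 : ‖(θ (y + t • (v + h)) - θ (y + t • v) - θ' (y + t • v) (t • h)) (v + h)
        + t • θ' (y + t • v) h h‖ ≤ 2 * K * ‖h‖ ^ 2 := by
      refine (norm_add_le _ _).trans ?_
      have a1 : ‖(θ (y + t • (v + h)) - θ (y + t • v) - θ' (y + t • v) (t • h)) (v + h)‖ ≤
          K * ‖h‖ ^ 2 * 1 := (ContinuousLinearMap.le_opNorm _ _).trans (by gcongr)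
      have a2 : ‖t • θ' (y + t • v) h h‖ ≤ 1 * (K * ‖h‖ * ‖h‖) := by
        rw [norm_smul, Real.norm_of_nonneg ht.1]
        gcongr
        · exact ht.2
        · exact (ContinuousLinearMap.le_opNorm₂ _ _ _).trans (by gcongr; exact hθ'K _ (hseg t ht))
      linarith
    have e3 : ‖(θ (y + t • (v + h)) - θ (y + t • v)) (v + h) + θ (y + t • v) h‖ ≤ 2 * K * ‖h‖ := by
      refine (norm_add_le _ _).trans ?_
      have a1 : ‖(θ (y + t • (v + h)) - θ (y + t • v)) (v + h)‖ ≤ K * ‖h‖ * 1 :=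
        (ContinuousLinearMap.le_opNorm _ _).trans (by gcongr)
      have a2 : ‖θ (y + t • v) h‖ ≤ K * ‖h‖ :=
        (ContinuousLinearMap.le_opNorm _ _).trans (by gcongr; exact hθK _ (hseg t ht))
      linarith
    have e4 : ‖t • θ (y + t • v) h (α t)‖ ≤ 1 * (K * ‖h‖ * A) := by
      rw [norm_smul, Real.norm_of_nonneg ht.1]
      gcongr
      · exact ht.2
      · exact (ContinuousLinearMap.le_opNorm₂ _ _ _).trans
          (by gcongr; exacts [hθK _ (hseg t ht), hA t ht])
    refine (norm_add_le _ _).trans (add_le_add e1 ((norm_add_le _ _).trans ?_))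
    calc _ ≤ 2 * K * ‖h‖ ^ 2 * A + 2 * K * ‖h‖ * (1 * (K * ‖h‖ * A)) := by
          refine add_le_add ((ContinuousLinearMap.le_opNorm _ _).trans ?_)
            ((ContinuousLinearMap.le_opNorm _ _).trans ?_)
          · gcongr
            exact hA t ht
          · gcongr
      _ = _ := by ring
  have hfin := norm_le_gronwallBound_of_norm_deriv_right_le (f := D) (f' := D') (δ := 0) (a := 0)
    (b := 1) (fun t ht => (hder t ht).continuousWithinAt)
    (fun t ht => (hder t ⟨ht.1, ht.2.le⟩).mono_of_mem_nhdsWithin (Icc_mem_nhdsGE_of_mem ht))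
    (by simp [hD, hαβ]) (fun t ht => hbound t ⟨ht.1, ht.2.le⟩) 1 (by simp)
  rw [gronwallBound_of_K_ne_0 hK.ne'] at hfin
  simpa [hD] using hfin

/-- A flat connection on a small convex open set has parallel sections with arbitrary values
at a given point. -/
theorem exists_parallel_of_flat {U : Set E} (hU : Convex ℝ U) (hUo : IsOpen U)
    {θ : E → E →L[ℝ] W →L[ℝ] W} {θ' : E → E →L[ℝ] E →L[ℝ] W →L[ℝ] W}
    (hθ : ∀ z ∈ U, HasFDerivAt θ (θ' z) z)
    (hflat : ∀ z ∈ U, ∀ X Y, θ' z X Y + θ z Y ∘L θ z X = θ' z Y X + θ z X ∘L θ z Y)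
    {K : ℝ} (hK : 0 < K) (hθK : ∀ z ∈ U, ‖θ z‖ ≤ K) (hθ'K : ∀ z ∈ U, ‖θ' z‖ ≤ K)
    (hθ'L : ∀ z ∈ U, ∀ z' ∈ U, ‖θ' z - θ' z'‖ ≤ K * ‖z - z'‖)
    (hsmall : ∀ z ∈ U, ∀ z' ∈ U, ‖z - z'‖ ≤ 1 ∧ K * ‖z - z'‖ ≤ 1 / 2) {y : E} (hy : y ∈ U)
    (w₀ : W) : ∃ w : E → W, w y = w₀ ∧ ∀ z ∈ U, HasFDerivAt w ((θ z).flip (w z)) z := by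
  have hseg : ∀ z ∈ U, ∀ t ∈ Icc (0 : ℝ) 1, y + t • (z - y) ∈ U :=
    fun z hz t ht => Convex.segment_mem hU hy hz ht
  have hex : ∀ z, ∃ α : ℝ → W, z ∈ U → α 0 = w₀ ∧ ∀ t ∈ Icc (0 : ℝ) 1,
      HasDerivWithinAt α (θ (y + t • (z - y)) (z - y) (α t)) (Icc 0 1) t := by
    intro z
    by_cases hz : z ∈ U
    · have hc : ContinuousOn θ U := fun p hp => (hθ p hp).continuousAt.continuousWithinAt
      obtain ⟨α, h1, h2⟩ := exists_parallel_segment (θ := θ) (y := y) (v := z - y)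
        (hc.comp (by fun_prop) (hseg z hz)) (fun t ht =>
          (mul_le_mul_of_nonneg_right (hθK _ (hseg z hz t ht)) (norm_nonneg _)).trans
            (hsmall z hz y hy).2) w₀
      exact ⟨α, fun _ => ⟨h1, h2⟩⟩
    · exact ⟨0, fun h => absurd h hz⟩
  choose α hα using hex
  -- The section at z is the endpoint of the parallel transport along the segment from y to z.
  refine ⟨fun z => α z 1, ?_, fun z hz => ?_⟩
  · have h1 := eq_zero_of_abs_deriv_le_mul_abs_self_of_eq_zero_right (f := fun t => α y t - w₀)
      (f' := fun _ => 0) (K := 0) (a := 0) (b := 1)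
      (fun t ht => (((hα y hy).2 t ht).sub_const w₀).continuousWithinAt)
      (fun t ht => by
        have := ((hα y hy).2 t ⟨ht.1, ht.2.le⟩).sub_const w₀
        simp only [sub_self, map_zero, zero_apply] at this
        exact this.mono_of_mem_nhdsWithin (Icc_mem_nhdsGE_of_mem ht))
      (by simp [(hα y hy).1]) (by simp) 1 (by simp)
    exact sub_eq_zero.1 h1
  · obtain ⟨A, hA⟩ := (isCompact_Icc.image_of_continuousOn
      (fun t ht => ((hα z hz).2 t ht).continuousWithinAt.norm :
        ContinuousOn (fun t => ‖α z t‖) (Icc 0 1))).bddAbove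
    have hA' : ∀ t ∈ Icc (0 : ℝ) 1, ‖α z t‖ ≤ A := fun t ht => hA ⟨t, ht, rfl⟩
    set C := (2 * K * (1 + K) * A) / K * (Real.exp K - 1) with hC
    rw [hasFDerivAt_iff_isLittleO_nhds_zero]
    -- The transport estimate is quadratic in h, so the endpoint is differentiable at z with
    -- derivative X ↦ θ z X (α z 1).
    have hO : (fun h : E => α (z + h) 1 - α z 1 - ((θ z).flip (α z 1)) h) =O[𝓝 0]
        fun h => ‖h‖ ^ 2 := by
      refine Asymptotics.IsBigO.of_bound C ?_
      have hnear : ∀ᶠ h : E in 𝓝 0, z + h ∈ U := by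
        have : Tendsto (fun h : E => z + h) (𝓝 0) (𝓝 z) := by
          simpa using (continuous_const.add continuous_id).tendsto (0 : E) (f := fun h : E => z + h)
        exact this.eventually (hUo.mem_nhds hz)
      filter_upwards [hnear] with h hh
      have e1 : z - y + h = z + h - y := by abel
      have h1 := norm_parallel_sub_le hU hθ hflat hK hθK hθ'K hθ'L (y := y) (v := z - y) (h := h)
        hy (by simpa using hz) (by simpa [e1] using hh) (by rw [e1]; exact (hsmall _ hh _ hy).1)
        (α := α z) (β := α (z + h)) (by rw [(hα z hz).1, (hα _ hh).1]) (hα z hz).2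
        (by rw [e1]; exact (hα _ hh).2) hA'
      rw [add_sub_cancel] at h1
      rw [ContinuousLinearMap.flip_apply]
      refine h1.trans (le_of_eq ?_)
      rw [hC, norm_pow, norm_norm]
      ring
    refine hO.trans_isLittleO ?_
    have h2 : (fun h : E => ‖h‖ ^ 2) =o[𝓝 0] fun h => ‖h‖ ^ 1 :=
      Asymptotics.IsLittleO.comp_tendsto (Asymptotics.isLittleO_pow_pow one_lt_two)
        tendsto_norm_zero
    exact Asymptotics.IsLittleO.of_norm_right (by simpa using h2)

omit [CompleteSpace W] in
/-- Parallel sections of a smooth connection are smooth. -/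
lemma contDiffOn_of_hasFDerivAt_flip {U : Set E} (hU : IsOpen U) {θ : E → E →L[ℝ] W →L[ℝ] W}
    (hθ : ContDiffOn ℝ ∞ θ U) {w : E → W} (h : ∀ z ∈ U, HasFDerivAt w ((θ z).flip (w z)) z) :
    ContDiffOn ℝ ∞ w U := by
  -- Bootstrapping: the equation expresses dw through θ and w, so w has one derivative more than
  -- already known.
  refine contDiffOn_infty.2 fun n => ?_
  induction n with
  | zero => exact contDiffOn_zero.2 fun z hz => (h z hz).continuousAt.continuousWithinAt
  | succ n ih =>
    push_cast
    refine (contDiffOn_succ_iff_fderiv_of_isOpen hU).2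
      ⟨fun z hz => (h z hz).differentiableAt.differentiableWithinAt, by simp, ?_⟩
    refine ContDiffOn.congr ?_ fun z hz => (h z hz).fderiv
    have h1 : ContDiffOn ℝ n (fun z => (θ z).flip) U :=
      (ContinuousLinearMap.flipₗᵢ ℝ E W W).contDiff.comp_contDiffOn
        (hθ.of_le (by exact_mod_cast le_top))
    exact h1.clm_apply ih

/-- Local form of the Frobenius theorem for linear connections. -/
theorem exists_ball_parallel {O : Set E} (hO : IsOpen O) {θ : E → E →L[ℝ] W →L[ℝ] W}
    (hθ : ContDiffOn ℝ ∞ θ O)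
    (hflat : ∀ z ∈ O, ∀ X Y, fderiv ℝ θ z X Y + θ z Y ∘L θ z X
      = fderiv ℝ θ z Y X + θ z X ∘L θ z Y) {x : E} (hx : x ∈ O) :
    ∃ r > 0, Metric.ball x r ⊆ O ∧ ∀ y ∈ Metric.ball x r, ∀ w₀ : W, ∃ w : E → W, w y = w₀ ∧
      ContDiffOn ℝ ∞ w (Metric.ball x r) ∧
      ∀ z ∈ Metric.ball x r, HasFDerivAt w ((θ z).flip (w z)) z := by
  have hθx : ContDiffAt ℝ ∞ θ x := hθ.contDiffAt (hO.mem_nhds hx)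
  have hθ'x : ContDiffAt ℝ 1 (fderiv ℝ θ) x := hθx.fderiv_right (m := 1) (by norm_cast)
  obtain ⟨L, N, hN, hL⟩ := hθ'x.exists_lipschitzOnWith
  set K : ℝ := L + ‖θ x‖ + ‖fderiv ℝ θ x‖ + 1 with hK
  have hLn : (0 : ℝ) ≤ L := L.2
  have hK0 : 0 < K := by positivity
  have hb1 : ∀ᶠ z in 𝓝 x, ‖θ z‖ ≤ K := by
    refine (hθx.continuousAt.norm.eventually_lt_const ?_).mono fun z hz => hz.le
    have := norm_nonneg (fderiv ℝ θ x)
    linarith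
  have hb2 : ∀ᶠ z in 𝓝 x, ‖fderiv ℝ θ z‖ ≤ K := by
    refine (hθ'x.continuousAt.norm.eventually_lt_const ?_).mono fun z hz => hz.le
    have := norm_nonneg (θ x)
    linarith
  obtain ⟨r, hr, hrN⟩ := Metric.mem_nhds_iff.1
    (Filter.inter_mem (Filter.inter_mem hb1 hb2) (Filter.inter_mem hN (hO.mem_nhds hx)))
  -- Two points of the ball are at distance at most 2s, which is at most 1 and at most 1 / (2K);
  -- these are the smallness conditions for transport along segments.
  set s := min r (min (1 / 2) (1 / (4 * K))) with hs
  have hs0 : 0 < s := by positivity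
  have hsr : Metric.ball x s ⊆ Metric.ball x r := Metric.ball_subset_ball (min_le_left _ _)
  have hsO : Metric.ball x s ⊆ O := fun z hz => (hrN (hsr hz)).2.2
  refine ⟨s, hs0, hsO, fun y hy w₀ => ?_⟩
  obtain ⟨w, hw, hw'⟩ := exists_parallel_of_flat (convex_ball x s) Metric.isOpen_ball
    (θ := θ) (θ' := fderiv ℝ θ)
    (fun z hz => ((hθ.contDiffAt (hO.mem_nhds (hsO hz))).differentiableAt (by simp)).hasFDerivAt)
    (fun z hz => hflat z (hsO hz)) hK0 (fun z hz => (hrN (hsr hz)).1.1)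
    (fun z hz => (hrN (hsr hz)).1.2)
    (fun z hz z' hz' => by
      refine (hL.norm_sub_le (hrN (hsr hz)).2.1 (hrN (hsr hz')).2.1).trans ?_
      gcongr
      have := norm_nonneg (θ x)
      have := norm_nonneg (fderiv ℝ θ x)
      linarith)
    (fun z hz z' hz' => by
      have h1 : ‖z - z'‖ ≤ s + s := by
        rw [← dist_eq_norm]
        exact (dist_triangle_right z z' x).trans
          (add_le_add (Metric.mem_ball.1 hz).le (Metric.mem_ball.1 hz').le)
      have h2 : s ≤ 1 / 2 := (min_le_right _ _).trans (min_le_left _ _)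
      have h3 : s ≤ 1 / (4 * K) := (min_le_right _ _).trans (min_le_right _ _)
      refine ⟨by linarith, ?_⟩
      calc K * ‖z - z'‖ ≤ K * (1 / (4 * K) + 1 / (4 * K)) := by gcongr; linarith
        _ = 1 / 2 := by field_simp; norm_num) hy w₀
  exact ⟨w, hw, contDiffOn_of_hasFDerivAt_flip Metric.isOpen_ball (hθ.mono hsO) hw', hw'⟩

end Frobenius

/-! ### Vector-valued Wirtinger derivatives -/

section Wirtinger

open Set Filter Topology Complex

set_option maxSynthPendingDepth 3
set_option linter.unnecessarySeqFocus false

variable {E : Type*} [NormedAddCommGroup E] [NormedSpace ℝ E] [NormedSpace ℂ E]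
  [IsScalarTower ℝ ℂ E]

/-- The real linear map `X ↦ X P + X̄ Q`, depending linearly on `(P, Q)`. -/
def wirCLM (E : Type*) [NormedAddCommGroup E] [NormedSpace ℝ E] [NormedSpace ℂ E]
    [IsScalarTower ℝ ℂ E] : E × E →L[ℝ] (ℂ →L[ℝ] E) :=
  (ContinuousLinearMap.smulRightL ℝ ℂ E reCLM) ∘L
      (ContinuousLinearMap.fst ℝ E E + ContinuousLinearMap.snd ℝ E E) +
    (ContinuousLinearMap.smulRightL ℝ ℂ E imCLM) ∘L
      ((I • ContinuousLinearMap.id ℂ E).restrictScalars ℝ ∘L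
        (ContinuousLinearMap.fst ℝ E E - ContinuousLinearMap.snd ℝ E E))

/-- The real linear map `X ↦ X P + X̄ Q`. -/
def wir (P Q : E) : ℂ →L[ℝ] E := wirCLM E (P, Q)

lemma wir_apply_re_im (P Q : E) (X : ℂ) :
    wir P Q X = X.re • (P + Q) + X.im • (I • (P - Q)) := rfl

lemma wir_apply (P Q : E) (X : ℂ) : wir P Q X = X • P + conj X • Q := by
  have e : ∀ (r : ℝ) (v : E), r • v = (r : ℂ) • v := fun r v => (algebraMap_smul ℂ r v).symm
  rw [wir_apply_re_im]
  conv_rhs => rw [← re_add_im X]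
  simp only [map_add, map_mul, conj_I, conj_ofReal, e]
  module

/-- `∂/∂z` of a vector-valued function. -/
def wz (F : ℂ → E) (z : ℂ) : E := (1 / 2 : ℂ) • (fderiv ℝ F z 1 - I • fderiv ℝ F z I)

/-- `∂/∂z̄` of a vector-valued function. -/
def wzb (F : ℂ → E) (z : ℂ) : E := (1 / 2 : ℂ) • (fderiv ℝ F z 1 + I • fderiv ℝ F z I)

/-- `F` is real differentiable at `z` with Wirtinger derivatives `P` and `Q`. -/
def HasWir (F : ℂ → E) (P Q : E) (z : ℂ) : Prop := HasFDerivAt F (wir P Q) z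

lemma dz_eq_wz (f : ℂ → ℂ) : dz f = wz f := rfl

lemma dzbar_eq_wzb (f : ℂ → ℂ) : dzbar f = wzb f := rfl

/-- A real linear map on ℂ is determined by its values at 1 and I, and these two values can be
solved for P and Q. -/
lemma eq_wir (L : ℂ →L[ℝ] E) :
    L = wir ((1 / 2 : ℂ) • (L 1 - I • L I)) ((1 / 2 : ℂ) • (L 1 + I • L I)) := by
  have e1 : (1 / 2 : ℂ) • (L 1 - I • L I) + (1 / 2 : ℂ) • (L 1 + I • L I) = L 1 := by module
  have e2 : I • ((1 / 2 : ℂ) • (L 1 - I • L I) - (1 / 2 : ℂ) • (L 1 + I • L I)) = L I := by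
    trans (-(I * I)) • L I
    · module
    · simp
  refine ContinuousLinearMap.ext fun X => ?_
  have hX : X = X.re • (1 : ℂ) + X.im • I := by simp
  rw [wir_apply_re_im, e1, e2]
  conv_lhs => rw [hX, map_add, map_smul, map_smul]

lemma hasWir_of_differentiableAt {F : ℂ → E} {z : ℂ} (h : DifferentiableAt ℝ F z) :
    HasWir F (wz F z) (wzb F z) z := by
  unfold HasWir wz wzb
  rw [← eq_wir]
  exact h.hasFDerivAt

namespace HasWir

variable {F G : ℂ → E} {P Q P' Q' : E} {z : ℂ}

lemma wz (h : HasWir F P Q z) : wz F z = P := by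
  rw [LagrangianBonnet.wz, h.fderiv, wir_apply, wir_apply]
  simp only [one_smul, map_one, conj_I, smul_add, smul_smul, neg_smul, smul_neg, I_mul_I]
  module

lemma wzb (h : HasWir F P Q z) : wzb F z = Q := by
  rw [LagrangianBonnet.wzb, h.fderiv, wir_apply, wir_apply]
  simp only [one_smul, map_one, conj_I, smul_add, smul_smul, neg_smul, smul_neg, I_mul_I]
  module

lemma fderiv_apply (h : HasWir F P Q z) (X : ℂ) : fderiv ℝ F z X = X • P + conj X • Q := by
  rw [h.fderiv, wir_apply]

lemma congr_deriv (h : HasWir F P Q z) (h1 : P = P') (h2 : Q = Q') : HasWir F P' Q' z := by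
  rwa [← h1, ← h2]

lemma unique (h : HasWir F P Q z) (h' : HasWir F P' Q' z) : P = P' ∧ Q = Q' :=
  ⟨h.wz.symm.trans h'.wz, h.wzb.symm.trans h'.wzb⟩

lemma congr_of_eventuallyEq (h : HasWir F P Q z) (hG : G =ᶠ[𝓝 z] F) : HasWir G P Q z :=
  HasFDerivAt.congr_of_eventuallyEq h hG

lemma const (a : E) (z : ℂ) : HasWir (fun _ => a) 0 0 z := by
  have : wir (0 : E) 0 = 0 := map_zero (wirCLM E)
  rw [HasWir, this]
  exact hasFDerivAt_const a z

lemma add (h : HasWir F P Q z) (h' : HasWir G P' Q' z) :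
    HasWir (fun w => F w + G w) (P + P') (Q + Q') z := by
  have : wir (P + P') (Q + Q') = wir P Q + wir P' Q' := map_add (wirCLM E) (P, Q) (P', Q')
  rw [HasWir, this]
  exact HasFDerivAt.add h h'

lemma sub (h : HasWir F P Q z) (h' : HasWir G P' Q' z) :
    HasWir (fun w => F w - G w) (P - P') (Q - Q') z := by
  have : wir (P - P') (Q - Q') = wir P Q - wir P' Q' := map_sub (wirCLM E) (P, Q) (P', Q')
  rw [HasWir, this]
  exact HasFDerivAt.sub h h'

lemma clm_comp {E' : Type*} [NormedAddCommGroup E'] [NormedSpace ℝ E'] [NormedSpace ℂ E']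
    [IsScalarTower ℝ ℂ E'] (L : E →L[ℂ] E') (h : HasWir F P Q z) :
    HasWir (fun w => L (F w)) (L P) (L Q) z := by
  have h1 : HasFDerivAt (fun w => L (F w)) ((L.restrictScalars ℝ) ∘L wir P Q) z :=
    (L.restrictScalars ℝ).hasFDerivAt.comp z h
  refine h1.congr_fderiv ?_
  ext <;> simp [wir_apply]

lemma neg (h : HasWir F P Q z) : HasWir (fun w => -F w) (-P) (-Q) z := by
  simpa using h.clm_comp (-ContinuousLinearMap.id ℂ E)

lemma const_smul (a : ℂ) (h : HasWir F P Q z) : HasWir (fun w => a • F w) (a • P) (a • Q) z := by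
  simpa using h.clm_comp (a • ContinuousLinearMap.id ℂ E)

lemma smul {f : ℂ → ℂ} {p q : ℂ} (hf : HasWir f p q z) (h : HasWir F P Q z) :
    HasWir (fun w => f w • F w) (p • F z + f z • P) (q • F z + f z • Q) z := by
  have h1 : HasFDerivAt (fun w => f w • F w) _ z := HasFDerivAt.smul hf h
  refine h1.congr_fderiv ?_
  ext <;> simp [wir_apply] <;> module

lemma mul {f g : ℂ → ℂ} {p q p' q' : ℂ} (hf : HasWir f p q z) (hg : HasWir g p' q' z) :
    HasWir (fun w => f w * g w) (p * g z + f z * p') (q * g z + f z * q') z :=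
  hf.smul hg

lemma star {f : ℂ → ℂ} {p q : ℂ} (hf : HasWir f p q z) :
    HasWir (fun w => conj (f w)) (conj q) (conj p) z := by
  have h1 : HasFDerivAt (fun w => conj (f w)) ((conjCLE : ℂ →L[ℝ] ℂ) ∘L wir p q) z :=
    (conjCLE : ℂ →L[ℝ] ℂ).hasFDerivAt.comp z hf
  refine h1.congr_fderiv ?_
  ext <;> simp [wir_apply] <;> ring

/-- The derivative of a holomorphic t is multiplication by t', so the two types do not mix: dz is
multiplied by t' and dz̄ by its conjugate. -/
lemma comp_holomorphic {t : ℂ → ℂ} {t' : ℂ} (h : HasWir F P Q (t z)) (ht : HasDerivAt t t' z) :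
    HasWir (fun w => F (t w)) (t' • P) (starRingEnd ℂ t' • Q) z := by
  have h1 : HasFDerivAt (fun w => F (t w)) _ z := HasFDerivAt.comp z h ht.complexToReal_fderiv
  refine h1.congr_fderiv ?_
  ext <;> simp [wir_apply, smul_smul] <;> ring_nf

lemma of_hasDerivAt {t : ℂ → ℂ} {t' : ℂ} (ht : HasDerivAt t t' z) : HasWir t t' 0 z := by
  refine ht.complexToReal_fderiv.congr_fderiv ?_
  ext <;> simp [wir_apply, mul_comm]

lemma comp_hasDerivAt {g : ℂ → ℂ} {g' p q : ℂ} {f : ℂ → ℂ} (hf : HasWir f p q z)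
    (hg : HasDerivAt g g' (f z)) : HasWir (fun w => g (f w)) (g' * p) (g' * q) z := by
  have h1 : HasFDerivAt (fun w => g (f w)) _ z := hg.complexToReal_fderiv.comp z hf
  refine h1.congr_fderiv ?_
  ext <;> simp [wir_apply] <;> ring

lemma exp {f : ℂ → ℂ} {p q : ℂ} (hf : HasWir f p q z) :
    HasWir (fun w => Complex.exp (f w)) (Complex.exp (f z) * p) (Complex.exp (f z) * q) z :=
  hf.comp_hasDerivAt (Complex.hasDerivAt_exp _)

lemma sum {ι : Type*} (s : Finset ι) {F : ι → ℂ → E} {P Q : ι → E}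
    (h : ∀ i ∈ s, HasWir (F i) (P i) (Q i) z) :
    HasWir (fun w => ∑ i ∈ s, F i w) (∑ i ∈ s, P i) (∑ i ∈ s, Q i) z := by
  classical
  induction s using Finset.induction_on with
  | empty => simpa using const (0 : E) z
  | insert i s hi ih =>
    simp only [Finset.sum_insert hi]
    exact (h i (by simp)).add (ih fun j hj => h j (by simp [hj]))

lemma apply {ι : Type*} [Fintype ι] {F : ℂ → ι → ℂ} {P Q : ι → ℂ} (h : HasWir F P Q z) (i : ι) :
    HasWir (fun w => F w i) (P i) (Q i) z :=
  h.clm_comp (ContinuousLinearMap.proj (R := ℂ) (φ := fun _ : ι => ℂ) i)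

/-- Symmetry of the second derivative. -/
lemma symm {P Q : ℂ → E} {P₁ P₂ Q₁ Q₂ : E} (h : ∀ᶠ w in 𝓝 z, HasWir F (P w) (Q w) w)
    (hP : HasWir P P₁ P₂ z) (hQ : HasWir Q Q₁ Q₂ z) : P₂ = Q₁ := by
  have h1 : HasFDerivAt (fun w => wir (P w) (Q w)) _ z :=
    (wirCLM E).hasFDerivAt.comp z (HasFDerivAt.prodMk hP hQ)
  -- Symmetry on the single pair (1, I) suffices: the terms in P₁ and Q₂ cancel and 2i times the
  -- mixed terms remain.
  have h2 := second_derivative_symmetric_of_eventually_of_real h h1 1 I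
  have h3 : wir (wir P₁ P₂ 1) (wir Q₁ Q₂ 1) I = wir (wir P₁ P₂ I) (wir Q₁ Q₂ I) 1 := h2
  simp only [wir_apply, one_smul, map_one, conj_I, smul_add, neg_smul] at h3
  have h4 : (2 * I) • P₂ = (2 * I) • Q₁ := by
    linear_combination (norm := module) h3
  exact smul_right_injective E (mul_ne_zero two_ne_zero I_ne_zero) h4

end HasWir

omit [IsScalarTower ℝ ℂ E] in
lemma contDiffOn_wz {F : ℂ → E} {V : Set ℂ} (hV : IsOpen V) (h : ContDiffOn ℝ ∞ F V) :
    ContDiffOn ℝ ∞ (wz F) V := by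
  have h1 : ContDiffOn ℝ ∞ (fderiv ℝ F) V := h.fderiv_of_isOpen hV (by simp)
  exact ContDiffOn.const_smul _ ((h1.clm_apply contDiffOn_const).sub
    ((h1.clm_apply contDiffOn_const).const_smul _))

omit [IsScalarTower ℝ ℂ E] in
lemma contDiffOn_wzb {F : ℂ → E} {V : Set ℂ} (hV : IsOpen V) (h : ContDiffOn ℝ ∞ F V) :
    ContDiffOn ℝ ∞ (wzb F) V := by
  have h1 : ContDiffOn ℝ ∞ (fderiv ℝ F) V := h.fderiv_of_isOpen hV (by simp)
  exact ContDiffOn.const_smul _ ((h1.clm_apply contDiffOn_const).add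
    ((h1.clm_apply contDiffOn_const).const_smul _))

lemma ContDiffOn.hasWir {F : ℂ → E} {V : Set ℂ} (hV : IsOpen V) (h : ContDiffOn ℝ ∞ F V) {z : ℂ}
    (hz : z ∈ V) : HasWir F (wz F z) (wzb F z) z :=
  hasWir_of_differentiableAt
    ((h.contDiffAt (hV.mem_nhds hz)).differentiableAt (by simp))

omit [IsScalarTower ℝ ℂ E] in
lemma wz_congr {F G : ℂ → E} {z : ℂ} (h : F =ᶠ[𝓝 z] G) : wz F z = wz G z := by
  unfold wz; rw [h.fderiv_eq]

omit [IsScalarTower ℝ ℂ E] in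
lemma wzb_congr {F G : ℂ → E} {z : ℂ} (h : F =ᶠ[𝓝 z] G) : wzb F z = wzb G z := by
  unfold wzb; rw [h.fderiv_eq]

end Wirtinger

/-! ### The Hermitian form -/

section Hermitian

open Complex

variable {c : SignType}

lemma herm_add_left (X Y Z : Amb c) : herm c (X + Y) Z = herm c X Z + herm c Y Z := by
  simp only [herm, ← Finset.sum_add_distrib, Pi.add_apply]
  exact Finset.sum_congr rfl fun k _ => by ring

lemma herm_smul_left (a : ℂ) (X Z : Amb c) : herm c (a • X) Z = a * herm c X Z := by
  simp only [herm, Finset.mul_sum, Pi.smul_apply, smul_eq_mul]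
  exact Finset.sum_congr rfl fun k _ => by ring

lemma conj_herm (X Y : Amb c) : conj (herm c X Y) = herm c Y X := by
  simp only [herm, map_sum, map_mul, conj_conj, conj_ofReal]
  exact Finset.sum_congr rfl fun k _ => by ring

lemma herm_add_right (X Y Z : Amb c) : herm c X (Y + Z) = herm c X Y + herm c X Z := by
  rw [← conj_herm, herm_add_left, map_add, conj_herm, conj_herm]

lemma herm_smul_right (a : ℂ) (X Z : Amb c) : herm c X (a • Z) = conj a * herm c X Z := by
  rw [← conj_herm, herm_smul_left, map_mul, conj_herm]

@[simp] lemma herm_zero_left (X : Amb c) : herm c 0 X = 0 := by simp [herm]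

@[simp] lemma herm_zero_right (X : Amb c) : herm c X 0 = 0 := by simp [herm]

lemma herm_neg_left (X Y : Amb c) : herm c (-X) Y = -herm c X Y := by
  simpa using herm_smul_left (-1) X Y

lemma herm_neg_right (X Y : Amb c) : herm c X (-Y) = -herm c X Y := by
  simpa using herm_smul_right (-1) X Y

lemma herm_sub_left (X Y Z : Amb c) : herm c (X - Y) Z = herm c X Z - herm c Y Z := by
  rw [sub_eq_add_neg, herm_add_left, herm_neg_left, sub_eq_add_neg]

lemma herm_sub_right (X Y Z : Amb c) : herm c X (Y - Z) = herm c X Y - herm c X Z := by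
  rw [sub_eq_add_neg, herm_add_right, herm_neg_right, sub_eq_add_neg]

lemma real_smul_eq {E : Type*} [AddCommGroup E] [Module ℝ E] [Module ℂ E] [IsScalarTower ℝ ℂ E]
    (r : ℝ) (v : E) : r • v = (r : ℂ) • v := (algebraMap_smul ℂ r v).symm

lemma herm_eq_zero_symm {X Y : Amb c} (h : herm c X Y = 0) : herm c Y X = 0 := by
  rw [← conj_herm, h, map_zero]

lemma HasWir.herm {F G : ℂ → Amb c} {P Q P' Q' : Amb c} {z : ℂ} (hF : HasWir F P Q z)
    (hG : HasWir G P' Q' z) :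
    HasWir (fun w => herm c (F w) (G w)) (herm c P (G z) + herm c (F z) Q')
      (herm c Q (G z) + herm c (F z) P') z := by
  have h := HasWir.sum Finset.univ fun k _ =>
    (((HasWir.const (sgn c k : ℂ) z).mul (hF.apply k)).mul (hG.apply k).star)
  refine h.congr_deriv ?_ ?_ <;>
  · simp only [LagrangianBonnet.herm, ← Finset.sum_add_distrib]
    exact Finset.sum_congr rfl fun k _ => by ring

lemma contDiffOn_herm {F G : ℂ → Amb c} {V : Set ℂ} (hF : ContDiffOn ℝ ∞ F V)
    (hG : ContDiffOn ℝ ∞ G V) : ContDiffOn ℝ ∞ (fun w => herm c (F w) (G w)) V := by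
  refine ContDiffOn.sum fun k _ => ?_
  have h1 : ContDiffOn ℝ ∞ (fun w => F w k) V := contDiffOn_pi.1 hF k
  have h2 : ContDiffOn ℝ ∞ (fun w => G w k) V := contDiffOn_pi.1 hG k
  exact (contDiffOn_const.mul h1).mul
    ((conjCLE : ℂ →L[ℝ] ℂ).contDiff.comp_contDiffOn h2)

/-- Nondegeneracy, tested on the coordinate vectors: all signs of the form are nonzero. -/
lemma eq_zero_of_herm_eq_zero {Y : Amb c} (h : ∀ Z, herm c Y Z = 0) : Y = 0 := by
  funext k
  have h1 := h (Pi.single k 1)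
  rw [herm, Finset.sum_eq_single k] at h1
  · have h2 : (sgn c k : ℂ) ≠ 0 := by
      unfold sgn
      split_ifs <;> simp
    simpa [h2] using h1
  · intro j _ hj
    simp [hj]
  · simp

/-- The form may be indefinite, so orthogonality alone is not enough. Orthogonal vectors of nonzero
square are still independent, hence span for dimension reasons, and nondegeneracy applies. -/
lemma eq_zero_of_orthogonal {ι : Type*} [Fintype ι] (hι : Fintype.card ι = ambDim c)
    {v : ι → Amb c} (hv : ∀ i j, i ≠ j → herm c (v i) (v j) = 0) (hv' : ∀ i, herm c (v i) (v i) ≠ 0)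
    {Y : Amb c} (hY : ∀ i, herm c Y (v i) = 0) : Y = 0 := by
  classical
  have hsum : ∀ (g : ι → ℂ) (j : ι), herm c (∑ i, g i • v i) (v j) = g j * herm c (v j) (v j) := by
    intro g j
    have h1 : herm c (∑ i, g i • v i) (v j) = ∑ i, g i * herm c (v i) (v j) := by
      have : ∀ s : Finset ι, herm c (∑ i ∈ s, g i • v i) (v j) =
          ∑ i ∈ s, g i * herm c (v i) (v j) := by
        intro s
        induction s using Finset.induction_on with
        | empty => simp
        | insert i s hi ih =>
          rw [Finset.sum_insert hi, Finset.sum_insert hi, herm_add_left, herm_smul_left, ih]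
      exact this _
    rw [h1, Finset.sum_eq_single j (fun i _ hi => by rw [hv i j hi, mul_zero]) (by simp)]
  have hli : LinearIndependent ℂ v := by
    rw [Fintype.linearIndependent_iff]
    intro g hg j
    have h1 := hsum g j
    rw [hg, herm_zero_left] at h1
    exact (mul_eq_zero.1 h1.symm).resolve_right (hv' j)
  have hspan := hli.span_eq_top_of_card_eq_finrank' (by simp [hι])
  refine eq_zero_of_herm_eq_zero fun Z => ?_
  have hZ : Z ∈ Submodule.span ℂ (Set.range v) := hspan ▸ Submodule.mem_top
  induction hZ using Submodule.span_induction with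
  | mem x hx => obtain ⟨i, rfl⟩ := hx; exact hY i
  | zero => exact herm_zero_right _
  | add x y _ _ hx hy => rw [herm_add_right, hx, hy, add_zero]
  | smul a x _ hx => rw [herm_smul_right, hx, mul_zero]

lemma sign_sq_eq_one (hc : c ≠ 0) : ((c : ℝ) : ℂ) * ((c : ℝ) : ℂ) = 1 := by
  cases c <;> simp at hc ⊢

/-- `P`, `Q` have square norm `e` and are orthogonal; for `c ≠ 0` they are tangent to the quadric at
`F` and horizontal. -/
structure IsFrame (c : SignType) (e : ℝ) (F P Q : Amb c) : Prop where
  pos : 0 < e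
  mem : F ∈ total c
  PP : herm c P P = e
  QQ : herm c Q Q = e
  PQ : herm c P Q = 0
  PF : c ≠ 0 → herm c P F = 0
  QF : c ≠ 0 → herm c Q F = 0

namespace IsFrame

variable {e : ℝ} {F P Q F' P' Q' : Amb c}

lemma ne_zero (h : IsFrame c e F P Q) : (e : ℂ) ≠ 0 := ofReal_ne_zero.2 h.pos.ne'

lemma FF (h : IsFrame c e F P Q) (hc : c ≠ 0) : herm c F F = ((c : ℝ) : ℂ) := h.mem hc

lemma QP (h : IsFrame c e F P Q) : herm c Q P = 0 := herm_eq_zero_symm h.PQ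

/-- Weighted with c, the horizontality relations hold for all three curvatures. This lets the flat
and the curved case be computed together. -/
lemma sign_PF (h : IsFrame c e F P Q) : ((c : ℝ) : ℂ) * herm c P F = 0 := by
  by_cases hc : c = 0
  · simp [hc]
  · simp [h.PF hc]

lemma sign_QF (h : IsFrame c e F P Q) : ((c : ℝ) : ℂ) * herm c Q F = 0 := by
  by_cases hc : c = 0
  · simp [hc]
  · simp [h.QF hc]

lemma sign_FP (h : IsFrame c e F P Q) : ((c : ℝ) : ℂ) * herm c F P = 0 := by
  by_cases hc : c = 0
  · simp [hc]
  · simp [herm_eq_zero_symm (h.PF hc)]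

lemma sign_FQ (h : IsFrame c e F P Q) : ((c : ℝ) : ℂ) * herm c F Q = 0 := by
  by_cases hc : c = 0
  · simp [hc]
  · simp [herm_eq_zero_symm (h.QF hc)]

/-- The orthogonal basis is P, Q in the plane (c = 0) and P, Q, F in three dimensions (c ≠ 0); F has
square c, which is nonzero in the second case. -/
lemma eq_zero (h : IsFrame c e F P Q) {Y : Amb c} (hP : herm c Y P = 0) (hQ : herm c Y Q = 0)
    (hF : c ≠ 0 → herm c Y F = 0) : Y = 0 := by
  by_cases hc : c = 0
  · refine eq_zero_of_orthogonal (ι := Fin 2) (v := ![P, Q]) (by simp [ambDim, hc]) ?_ ?_ ?_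
    · intro i j hij
      fin_cases i <;> fin_cases j <;> simp at hij ⊢ <;> first | exact h.PQ | exact h.QP
    · intro i
      fin_cases i
      · simpa [h.PP] using h.pos.ne'
      · simpa [h.QQ] using h.pos.ne'
    · intro i
      fin_cases i
      · exact hP
      · exact hQ
  · refine eq_zero_of_orthogonal (ι := Fin 3) (v := ![P, Q, F]) (by simp [ambDim, hc]) ?_ ?_ ?_
    · intro i j hij
      fin_cases i <;> fin_cases j <;> simp at hij ⊢ <;>
        first
        | exact h.PQ
        | exact h.QP
        | exact h.PF hc
        | exact h.QF hc
        | exact herm_eq_zero_symm (h.PF hc)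
        | exact herm_eq_zero_symm (h.QF hc)
    · intro i
      fin_cases i
      · simpa [h.PP] using h.pos.ne'
      · simpa [h.QQ] using h.pos.ne'
      · have := left_ne_zero_of_mul_eq_one (sign_sq_eq_one hc)
        simpa [h.FF hc] using this
    · intro i
      fin_cases i
      · exact hP
      · exact hQ
      · exact hF hc

/-- The coefficient of F is written c · d: for c = 0 the term disappears, and for c ≠ 0 the identity
c² = 1 makes d the product with F. -/
lemma herm_coord_P (h : IsFrame c e F P Q) (a b d : ℂ) :
    herm c (a • P + b • Q + (((c : ℝ) : ℂ) * d) • F) P = a * e := by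
  rw [herm_add_left, herm_add_left, herm_smul_left, herm_smul_left, herm_smul_left, h.PP, h.QP]
  linear_combination d * h.sign_FP

lemma herm_coord_Q (h : IsFrame c e F P Q) (a b d : ℂ) :
    herm c (a • P + b • Q + (((c : ℝ) : ℂ) * d) • F) Q = b * e := by
  rw [herm_add_left, herm_add_left, herm_smul_left, herm_smul_left, herm_smul_left, h.PQ, h.QQ]
  linear_combination d * h.sign_FQ

lemma herm_coord_F (h : IsFrame c e F P Q) (hc : c ≠ 0) (a b d : ℂ) :
    herm c (a • P + b • Q + (((c : ℝ) : ℂ) * d) • F) F = d := by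
  rw [herm_add_left, herm_add_left, herm_smul_left, herm_smul_left, herm_smul_left, h.PF hc,
    h.QF hc, h.FF hc]
  linear_combination d * sign_sq_eq_one hc

/-- Expansion of a vector in the frame. -/
lemma expansion (h : IsFrame c e F P Q) (X : Amb c) :
    X = (herm c X P / e) • P + (herm c X Q / e) • Q + (((c : ℝ) : ℂ) * herm c X F) • F := by
  have he := h.ne_zero
  refine sub_eq_zero.1 (h.eq_zero ?_ ?_ fun hc => ?_)
  · rw [herm_sub_left, h.herm_coord_P]
    field_simp
    ring
  · rw [herm_sub_left, h.herm_coord_Q]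
    field_simp
    ring
  · rw [herm_sub_left, h.herm_coord_F hc]
    ring

/-- Coefficients in the frame are unique. -/
lemma coord_eq (h : IsFrame c e F P Q) {a b d a' b' d' : ℂ}
    (hab : a • P + b • Q + (((c : ℝ) : ℂ) * d) • F =
      a' • P + b' • Q + (((c : ℝ) : ℂ) * d') • F) : a = a' ∧ b = b' := by
  have h1 := h.herm_coord_P a b d
  have h2 := h.herm_coord_Q a b d
  rw [hab, h.herm_coord_P] at h1
  rw [hab, h.herm_coord_Q] at h2
  exact ⟨(mul_right_cancel₀ h.ne_zero h1).symm, (mul_right_cancel₀ h.ne_zero h2).symm⟩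

/-- A frame with given square norm exists. -/
lemma exists_frame (c : SignType) {e : ℝ} (he : 0 < e) : ∃ F P Q : Amb c, IsFrame c e F P Q := by
  have hs : (Real.sqrt e : ℂ) * (Real.sqrt e : ℂ) = e := by
    rw [← ofReal_mul, Real.mul_self_sqrt he.le]
  cases c with
  | zero =>
    -- In the flat case the base point is arbitrary; the origin is taken.
    refine ⟨0, ![(Real.sqrt e : ℂ), 0], ![0, (Real.sqrt e : ℂ)], he, fun h => absurd rfl h, ?_, ?_,
      ?_, fun h => absurd rfl h, fun h => absurd rfl h⟩
    all_goals
      unfold herm sgn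
      erw [Fin.sum_univ_two]
      simp [hs]
  | neg =>
    refine ⟨![1, 0, 0], ![0, (Real.sqrt e : ℂ), 0], ![0, 0, (Real.sqrt e : ℂ)], he, fun h => ?_,
      ?_, ?_, ?_, fun h => ?_, fun h => ?_⟩
    all_goals
      unfold herm sgn
      erw [Fin.sum_univ_three]
      simp [hs]
  | pos =>
    refine ⟨![1, 0, 0], ![0, (Real.sqrt e : ℂ), 0], ![0, 0, (Real.sqrt e : ℂ)], he, fun h => ?_,
      ?_, ?_, ?_, fun h => ?_, fun h => ?_⟩
    all_goals
      unfold herm sgn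
      erw [Fin.sum_univ_three]
      simp [hs]

/-- The linear map taking the frame `P`, `Q`, `F` to `P'`, `Q'`, `F'`. -/
def transition (c : SignType) (e : ℝ) (F P Q F' P' Q' : Amb c) : Amb c →ₗ[ℂ] Amb c where
  toFun X := (herm c X P / e) • P' + (herm c X Q / e) • Q' + (((c : ℝ) : ℂ) * herm c X F) • F'
  map_add' X Y := by
    simp only [herm_add_left]
    module
  map_smul' a X := by
    simp only [herm_smul_left, RingHom.id_apply]
    module

lemma transition_apply (X : Amb c) : transition c e F P Q F' P' Q' X =
    (herm c X P / e) • P' + (herm c X Q / e) • Q' + (((c : ℝ) : ℂ) * herm c X F) • F' := rfl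

/-- Parseval: the form is computed from the frame coordinates by the same formula in both frames,
since the frames have equal Gram matrices. -/
lemma herm_transition (h : IsFrame c e F P Q) (h' : IsFrame c e F' P' Q') (X Y : Amb c) :
    herm c (transition c e F P Q F' P' Q' X) (transition c e F P Q F' P' Q' Y) = herm c X Y := by
  have he := h.ne_zero
  conv_rhs => rw [h.expansion Y, herm_add_right, herm_add_right, herm_smul_right, herm_smul_right,
    herm_smul_right]
  rw [transition_apply Y, herm_add_right, herm_add_right, herm_smul_right, herm_smul_right,
    herm_smul_right, transition_apply, h'.herm_coord_P, h'.herm_coord_Q]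
  have h1 : conj (((c : ℝ) : ℂ) * herm c Y F) * herm c ((herm c X P / e) • P' +
      (herm c X Q / e) • Q' + (((c : ℝ) : ℂ) * herm c X F) • F') F' =
      conj (((c : ℝ) : ℂ) * herm c Y F) * herm c X F := by
    by_cases hc : c = 0
    · simp [hc]
    · rw [h'.herm_coord_F hc]
  rw [h1]
  field_simp

lemma transition_P (h : IsFrame c e F P Q) : transition c e F P Q F' P' Q' P = P' := by
  rw [transition_apply, h.PP, h.PQ, h.sign_PF, div_self h.ne_zero]
  simp

lemma transition_Q (h : IsFrame c e F P Q) : transition c e F P Q F' P' Q' Q = Q' := by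
  rw [transition_apply, h.QP, h.QQ, h.sign_QF, div_self h.ne_zero]
  simp

lemma transition_F (h : IsFrame c e F P Q) (hc : c ≠ 0) :
    transition c e F P Q F' P' Q' F = F' := by
  rw [transition_apply, h.FF hc, herm_eq_zero_symm (h.PF hc), herm_eq_zero_symm (h.QF hc),
    sign_sq_eq_one hc]
  simp

lemma transition_transition (h : IsFrame c e F P Q) (h' : IsFrame c e F' P' Q') (X : Amb c) :
    transition c e F' P' Q' F P Q (transition c e F P Q F' P' Q' X) = X := by
  have he := h.ne_zero
  conv_rhs => rw [h.expansion X]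
  rw [transition_apply, transition_apply X, h'.herm_coord_P, h'.herm_coord_Q]
  have h1 : ((c : ℝ) : ℂ) * herm c ((herm c X P / e) • P' + (herm c X Q / e) • Q' +
      (((c : ℝ) : ℂ) * herm c X F) • F') F' = ((c : ℝ) : ℂ) * herm c X F := by
    by_cases hc : c = 0
    · simp [hc]
    · rw [h'.herm_coord_F hc]
  rw [h1]
  field_simp

end IsFrame

end Hermitian

/-! ### Isometries of the space form -/

section Isometries

open Complex

variable {c : SignType}

lemma proj_eq_iff {Z W : total c} : proj c Z = proj c W ↔
    ∃ l : ℂ, ‖l‖ = 1 ∧ (c = 0 → l = 1) ∧ (W : Amb c) = l • (Z : Amb c) :=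
  Quotient.eq (r := hopfSetoid c)

lemma proj_surjective (x : SpaceForm c) : ∃ Z, proj c Z = x := Quotient.exists_rep x

lemma hor_zero (hc : c = 0) (Z X : Amb c) : hor c Z X = X := by simp [hor, hc]

lemma hor_of_herm_eq_zero {Z X : Amb c} (h : c ≠ 0 → herm c X Z = 0) : hor c Z X = X := by
  by_cases hc : c = 0
  · exact hor_zero hc Z X
  · simp [hor, rinner, herm_smul_right, h hc]

namespace IsFrame

variable {e : ℝ} {F P Q F' P' Q' : Amb c}

/-- The affine map taking the frame at `F` to the frame at `F'`. -/
def motion (c : SignType) (e : ℝ) (F P Q F' P' Q' X : Amb c) : Amb c :=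
  transition c e F P Q F' P' Q' (X - F) + F'

lemma motion_eq (h : IsFrame c e F P Q) (hc : c ≠ 0) (X : Amb c) :
    motion c e F P Q F' P' Q' X = transition c e F P Q F' P' Q' X := by
  rw [motion, map_sub, h.transition_F hc, sub_add_cancel]

lemma motion_mem (h : IsFrame c e F P Q) (h' : IsFrame c e F' P' Q') {X : Amb c}
    (hX : X ∈ total c) : motion c e F P Q F' P' Q' X ∈ total c := fun hc => by
  rw [h.motion_eq hc, h.herm_transition h', hX hc]

lemma motion_self : motion c e F P Q F' P' Q' F = F' := by simp [motion]

lemma motion_motion (h : IsFrame c e F P Q) (h' : IsFrame c e F' P' Q') (X : Amb c) :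
    motion c e F' P' Q' F P Q (motion c e F P Q F' P' Q' X) = X := by
  rw [motion, motion, add_sub_cancel_right, h.transition_transition h', sub_add_cancel]

/-- The isometry of the space form taking the frame at `F` to the frame at `F'`. -/
def isometry (h : IsFrame c e F P Q) (h' : IsFrame c e F' P' Q') : SpaceForm c → SpaceForm c :=
  Quotient.map (sa := hopfSetoid c) (sb := hopfSetoid c)
    (fun Z => ⟨motion c e F P Q F' P' Q' Z, h.motion_mem h' Z.2⟩) (by
      rintro Z W ⟨l, hl, hl0, hW⟩
      refine ⟨l, hl, hl0, ?_⟩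
      change motion c e F P Q F' P' Q' W = l • motion c e F P Q F' P' Q' Z
      by_cases hc : c = 0
      · rw [hW, hl0 hc, one_smul, one_smul]
      · rw [hW, h.motion_eq hc, h.motion_eq hc, map_smul])

lemma isometry_proj (h : IsFrame c e F P Q) (h' : IsFrame c e F' P' Q') {Z : Amb c}
    (hZ : Z ∈ total c) : h.isometry h' (proj c ⟨Z, hZ⟩) =
      proj c ⟨motion c e F P Q F' P' Q' Z, h.motion_mem h' hZ⟩ := rfl

lemma isometry_isometry (h : IsFrame c e F P Q) (h' : IsFrame c e F' P' Q') (x : SpaceForm c) :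
    h'.isometry h (h.isometry h' x) = x := by
  obtain ⟨Z, rfl⟩ := proj_surjective x
  rw [← Subtype.coe_eta Z Z.2, isometry_proj, isometry_proj]
  congr 2
  exact h.motion_motion h' _

/-- The linear part of the motion as a continuous linear map. -/
def transitionCLM (c : SignType) (e : ℝ) (F P Q F' P' Q' : Amb c) : Amb c →L[ℂ] Amb c :=
  LinearMap.toContinuousLinearMap (transition c e F P Q F' P' Q')

lemma hasFDerivAt_motion (X : Amb c) : HasFDerivAt (motion c e F P Q F' P' Q')
    ((transitionCLM c e F P Q F' P' Q').restrictScalars ℝ) X := by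
  have h := ((transitionCLM c e F P Q F' P' Q').restrictScalars ℝ).hasFDerivAt (x := X - F)
  exact ((h.comp X ((hasFDerivAt_id X).sub_const F)).add_const F').congr_fderiv (by ext; rfl)

lemma contDiff_motion : ContDiff ℝ ∞ (motion c e F P Q F' P' Q') :=
  (((transitionCLM c e F P Q F' P' Q').restrictScalars ℝ).contDiff.comp
    (contDiff_id.sub contDiff_const)).add contDiff_const

/-- The motion is globally smooth and its linear part preserves the Hermitian form. For c ≠ 0 it is
complex linear, so it maps the vertical direction at Z to the one at the image and commutes with
`hor`. Exchanging the frames gives the inverse. -/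
lemma isIsometry (h : IsFrame c e F P Q) (h' : IsFrame c e F' P' Q') :
    IsIsometry c (h.isometry h') := by
  refine ⟨⟨fun x y hxy => ?_, fun x => ⟨h'.isometry h x, h'.isometry_isometry h x⟩⟩, fun Z₀ _ => ?_⟩
  · rw [← h.isometry_isometry h' x, hxy, h.isometry_isometry]
  refine ⟨Set.univ, motion c e F P Q F' P' Q', isOpen_univ, trivial, contDiff_motion.contDiffOn,
    fun Z hZ _ => ⟨h.motion_mem h' hZ, rfl⟩, fun Z _ _ X Y _ => ?_⟩
  have hd : ∀ X, fderiv ℝ (motion c e F P Q F' P' Q') Z X = transition c e F P Q F' P' Q' X :=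
    fun X => by rw [(hasFDerivAt_motion Z).fderiv]; rfl
  have hh : ∀ X, hor c (motion c e F P Q F' P' Q' Z) (transition c e F P Q F' P' Q' X) =
      transition c e F P Q F' P' Q' (hor c Z X) := by
    intro X
    by_cases hc : c = 0
    · rw [hor_zero hc, hor_zero hc]
    · rw [h.motion_eq hc, hor, hor, ← map_smul, rinner, h.herm_transition h', real_smul_eq,
        real_smul_eq, ← map_smul, ← map_sub]
      rfl
  rw [hd, hd, hh, hh, rinner, h.herm_transition h']
  rfl

end IsFrame

end Isometries

/-! ### Local lifts -/

section Lifts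

open Complex Set Filter Topology

variable {c : SignType}

/-- Smooth lifts of the same map differ by a smooth unit factor. -/
lemma exists_factor {V : Set ℂ} {F G : ℂ → Amb c} (hF : ContDiffOn ℝ ∞ F V)
    (hG : ContDiffOn ℝ ∞ G V) (hFt : ∀ w ∈ V, F w ∈ total c)
    (h : ∀ w ∈ V, ∃ l : ℂ, ‖l‖ = 1 ∧ (c = 0 → l = 1) ∧ G w = l • F w) :
    ∃ l : ℂ → ℂ, ContDiffOn ℝ ∞ l V ∧ ∀ w ∈ V, ‖l w‖ = 1 ∧ (c = 0 → l w = 1) ∧ G w = l w • F w := by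
  by_cases hc : c = 0
  · refine ⟨fun _ => 1, contDiffOn_const, fun w hw => ⟨by simp, fun _ => rfl, ?_⟩⟩
    obtain ⟨l, _, hl1, hl⟩ := h w hw
    rw [hl, hl1 hc]
  -- If G = l F and (F, F) = c, then c (G, F) = c² l = l. This formula shows that the factor is
  -- smooth.
  · refine ⟨fun w => ((c : ℝ) : ℂ) * herm c (G w) (F w), contDiffOn_const.mul (contDiffOn_herm hG hF),
      fun w hw => ?_⟩
    obtain ⟨l, hl1, hl0, hl⟩ := h w hw
    have : ((c : ℝ) : ℂ) * herm c (G w) (F w) = l := by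
      rw [hl, herm_smul_left, hFt w hw hc]
      linear_combination l * sign_sq_eq_one hc
    beta_reduce
    rw [this]
    exact ⟨hl1, hl0, hl⟩

lemma mul_conj_eq_one {l : ℂ} (hl : ‖l‖ = 1) : l * conj l = 1 := by
  rw [mul_conj, normSq_eq_norm_sq, hl]
  simp

lemma rinner_smul_smul {l : ℂ} (hl : ‖l‖ = 1) (X Y : Amb c) :
    rinner c (l • X) (l • Y) = rinner c X Y := by
  rw [rinner, herm_smul_left, herm_smul_right, ← mul_assoc, mul_conj_eq_one hl, one_mul]
  rfl

/-- Differentiating l F produces the extra term dl · F. Since |l| = 1, dl is an imaginary multiple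
of l, so this term is vertical and is removed by `hor`. -/
lemma hor_fderiv_smul {V : Set ℂ} (hV : IsOpen V) {F G : ℂ → Amb c} {l : ℂ → ℂ}
    (hF : ContDiffOn ℝ ∞ F V) (hl : ContDiffOn ℝ ∞ l V) (hFt : ∀ w ∈ V, F w ∈ total c)
    (h : ∀ w ∈ V, ‖l w‖ = 1 ∧ (c = 0 → l w = 1) ∧ G w = l w • F w) {z : ℂ} (hz : z ∈ V) (X : ℂ) :
    hor c (G z) (fderiv ℝ G z X) = l z • hor c (F z) (fderiv ℝ F z X) := by
  have hVz := hV.mem_nhds hz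
  have hdF := ((hF.contDiffAt hVz).differentiableAt (by simp)).hasFDerivAt
  have hdl := ((hl.contDiffAt hVz).differentiableAt (by simp)).hasFDerivAt
  have hGeq : G =ᶠ[𝓝 z] fun w => l w • F w := by
    filter_upwards [hVz] with w hw
    exact (h w hw).2.2
  have hdG : fderiv ℝ G z X = (fderiv ℝ l z X) • F z + l z • fderiv ℝ F z X := by
    have hm : HasFDerivAt (fun w => l w • F w) _ z := HasFDerivAt.smul hdl hdF
    rw [hGeq.fderiv_eq, hm.fderiv]
    simp [add_comm]
  by_cases hc : c = 0
  · have h1 : l =ᶠ[𝓝 z] fun _ => 1 := by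
      filter_upwards [hVz] with w hw
      exact (h w hw).2.1 hc
    rw [hor_zero hc, hor_zero hc, hdG, h1.fderiv_eq]
    simp
  · set d := fderiv ℝ l z X with hd
    have hll := mul_conj_eq_one (h z hz).1
    -- The derivative of l l̄ = 1.
    have h2 : d * conj (l z) + l z * conj d = 0 := by
      have h3 : HasWir (fun w => l w * conj (l w)) _ _ z :=
        (hasWir_of_differentiableAt hdl.differentiableAt).mul
          (hasWir_of_differentiableAt hdl.differentiableAt).star
      have h4 : (fun w => l w * conj (l w)) =ᶠ[𝓝 z] fun _ => 1 := by
        filter_upwards [hVz] with w hw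
        exact mul_conj_eq_one (h w hw).1
      have h5 := h3.fderiv_apply X
      rw [h4.fderiv_eq] at h5
      have h6 := (hasWir_of_differentiableAt hdl.differentiableAt).fderiv_apply X
      rw [hd, h6]
      simp only [fderiv_fun_const, smul_eq_mul] at h5
      simp only [smul_eq_mul, map_add, map_mul, conj_conj]
      simp at h5
      linear_combination -h5
    obtain ⟨s, hs⟩ : ∃ s : ℝ, d = s * I * l z := by
      refine ⟨(d * conj (l z)).im, ?_⟩
      have h3 : (d * conj (l z)).re = 0 := by
        have := congrArg re h2
        simp at this ⊢
        linarith
      have h4 : d * conj (l z) = (d * conj (l z)).im * I := by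
        conv_lhs => rw [← re_add_im (d * conj (l z)), h3]
        simp
      rw [← h4]
      linear_combination -d * hll
    have hFF := hFt z hz hc
    have h7 : rinner c (fderiv ℝ G z X) (I • G z) = (c : ℝ) * s + rinner c (fderiv ℝ F z X) (I • F z) := by
      rw [hdG, (h z hz).2.2, smul_comm I (l z) (F z), hs]
      have : ((s : ℂ) * I * l z) • F z + l z • fderiv ℝ F z X =
          l z • (((s : ℂ) * I) • F z + fderiv ℝ F z X) := by module
      rw [this, rinner_smul_smul (h z hz).1, rinner, herm_add_left, herm_smul_left,
        herm_smul_right, hFF]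
      simp [rinner]
      ring
    have hcc : (c : ℝ) * (c : ℝ) = 1 := by exact_mod_cast sign_sq_eq_one hc
    rw [hor, h7, hor, mul_add, ← mul_assoc, hcc, one_mul, hdG, (h z hz).2.2, hs, real_smul_eq,
      real_smul_eq]
    push_cast
    module

/-- A smooth map into the total space. -/
structure IsLift (c : SignType) (V : Set ℂ) (F : ℂ → Amb c) : Prop where
  isOpen : IsOpen V
  smooth : ContDiffOn ℝ ∞ F V
  mem : ∀ z ∈ V, F z ∈ total c

namespace IsLift

variable {V : Set ℂ} {F G : ℂ → Amb c} {z : ℂ}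

lemma mono (h : IsLift c V F) {U : Set ℂ} (hU : IsOpen U) (hUV : U ⊆ V) : IsLift c U F :=
  ⟨hU, h.smooth.mono hUV, fun z hz => h.mem z (hUV hz)⟩

lemma hasWir (h : IsLift c V F) (hz : z ∈ V) : HasWir F (wz F z) (wzb F z) z :=
  ContDiffOn.hasWir h.isOpen h.smooth hz

lemma hasWir_wz (h : IsLift c V F) (hz : z ∈ V) :
    HasWir (wz F) (wz (wz F) z) (wzb (wz F) z) z :=
  ContDiffOn.hasWir h.isOpen (contDiffOn_wz h.isOpen h.smooth) hz

lemma hasWir_wzb (h : IsLift c V F) (hz : z ∈ V) :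
    HasWir (wzb F) (wz (wzb F) z) (wzb (wzb F) z) z :=
  ContDiffOn.hasWir h.isOpen (contDiffOn_wzb h.isOpen h.smooth) hz

lemma wz_wzb (h : IsLift c V F) (hz : z ∈ V) : wz (wzb F) z = wzb (wz F) z :=
  (HasWir.symm (by filter_upwards [h.isOpen.mem_nhds hz] with w hw using h.hasWir hw)
    (h.hasWir_wz hz) (h.hasWir_wzb hz)).symm

lemma wz_herm_add (h : IsLift c V F) (hc : c ≠ 0) (hz : z ∈ V) :
    herm c (wz F z) (F z) + herm c (F z) (wzb F z) = 0 := by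
  have h1 := (h.hasWir hz).herm (h.hasWir hz)
  have h2 : HasWir (fun w => herm c (F w) (F w)) 0 0 z :=
    (HasWir.const (((c : ℝ) : ℂ)) z).congr_of_eventuallyEq (by
      filter_upwards [h.isOpen.mem_nhds hz] with w hw using h.mem w hw hc)
  exact (h1.unique h2).1

lemma re_herm_fderiv (h : IsLift c V F) (hc : c ≠ 0) (hz : z ∈ V) (X : ℂ) :
    (herm c (fderiv ℝ F z X) (F z)).re = 0 := by
  have h1 := h.wz_herm_add hc hz
  rw [← conj_herm (wzb F z)] at h1
  have h2 := congrArg re h1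
  have h3 := congrArg im h1
  rw [(h.hasWir hz).fderiv_apply, herm_add_left, herm_smul_left, herm_smul_left]
  simp at h2 h3 ⊢
  linear_combination X.re * h2 - X.im * h3

/-- Since (F, F) is constant, (dF, F) is purely imaginary, so the real condition of horizontality
already gives Hermitian orthogonality. -/
lemma herm_fderiv_eq_zero_iff (h : IsLift c V F) (hc : c ≠ 0) (hz : z ∈ V) (X : ℂ) :
    herm c (fderiv ℝ F z X) (F z) = 0 ↔ rinner c (fderiv ℝ F z X) (I • F z) = 0 := by
  have h1 := h.re_herm_fderiv hc hz X
  rw [rinner, herm_smul_right, Complex.ext_iff, h1]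
  simp

end IsLift

end Lifts

/-! ### Horizontal conformal Lagrangian lifts with prescribed data -/

section Solutions

open Complex Set Filter Topology

set_option maxSynthPendingDepth 3

variable {c : SignType} {V : Set ℂ} {u : ℂ → ℝ} {φ ψ : ℂ → ℂ} {F : ℂ → Amb c} {z : ℂ}

lemma HasWir.ofReal_exp {f : ℂ → ℝ} {p q : ℂ} (hf : HasWir (fun w => (f w : ℂ)) p q z) :
    HasWir (fun w => ((Real.exp (f w) : ℝ) : ℂ)) (Real.exp (f z) * p) (Real.exp (f z) * q) z := by
  have h := hf.exp
  simp only [← Complex.ofReal_exp] at h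
  exact h

/-- The derivative `u_z` of a real function. -/
def duz (u : ℂ → ℝ) (z : ℂ) : ℂ := wz (fun w => (u w : ℂ)) z

lemma contDiffOn_ofReal (hu : ContDiffOn ℝ ∞ u V) : ContDiffOn ℝ ∞ (fun w => (u w : ℂ)) V :=
  ofRealCLM.contDiff.comp_contDiffOn hu

lemma contDiffOn_conj {f : ℂ → ℂ} (hf : ContDiffOn ℝ ∞ f V) :
    ContDiffOn ℝ ∞ (fun w => conj (f w)) V :=
  (conjCLE : ℂ →L[ℝ] ℂ).contDiff.comp_contDiffOn hf

lemma hasWir_ofReal (hV : IsOpen V) (hu : ContDiffOn ℝ ∞ u V) (hz : z ∈ V) :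
    HasWir (fun w => (u w : ℂ)) (duz u z) (conj (duz u z)) z := by
  have h1 := ContDiffOn.hasWir hV (contDiffOn_ofReal hu) hz
  have h2 := h1.star
  simp only [conj_ofReal] at h2
  exact h1.congr_deriv rfl (h1.unique h2).2

lemma contDiffOn_duz (hV : IsOpen V) (hu : ContDiffOn ℝ ∞ u V) : ContDiffOn ℝ ∞ (duz u) V :=
  contDiffOn_wz hV (contDiffOn_ofReal hu)

lemma hasWir_duz (hV : IsOpen V) (hu : ContDiffOn ℝ ∞ u V) (hz : z ∈ V) :
    HasWir (duz u) (wz (duz u) z) (wzb (duz u) z) z :=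
  ContDiffOn.hasWir hV (contDiffOn_duz hV hu) hz

/-- For real u the z̄-derivative of u is the conjugate of u_z, so commuting the two derivatives
shows that u_{zz̄} is real. -/
lemma conj_wzb_duz (hV : IsOpen V) (hu : ContDiffOn ℝ ∞ u V) (hz : z ∈ V) :
    conj (wzb (duz u) z) = wzb (duz u) z :=
  (HasWir.symm (by filter_upwards [hV.mem_nhds hz] with w hw using hasWir_ofReal hV hu hw)
    (hasWir_duz hV hu hz) (hasWir_duz hV hu hz).star).symm

/-- `F` is a lift over `V` of a conformal Lagrangian immersion, horizontal for `c ≠ 0`, with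
induced metric `2 e^u dz dz̄`, mean curvature form `φ dz` and cubic Hopf differential `ψ dz³`. -/
structure IsSolution (c : SignType) (V : Set ℂ) (u : ℂ → ℝ) (φ ψ : ℂ → ℂ) (F : ℂ → Amb c) : Prop
    extends IsLift c V F where
  frame : ∀ z ∈ V, IsFrame c (Real.exp (u z)) (F z) (wz F z) (wzb F z)
  hopf : ∀ z ∈ V, herm c (wz (wz F) z) (wzb F z) = I * ψ z
  mean : ∀ z ∈ V, herm c (wzb (wz F) z) (wzb F z) = I * φ z * Real.exp (u z)

namespace IsSolution

lemma mono (h : IsSolution c V u φ ψ F) {U : Set ℂ} (hU : IsOpen U) (hUV : U ⊆ V) :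
    IsSolution c U u φ ψ F :=
  ⟨h.toIsLift.mono hU hUV, fun z hz => h.frame z (hUV hz), fun z hz => h.hopf z (hUV hz),
    fun z hz => h.mean z (hUV hz)⟩

/-- The data can be read off from F: here u is the logarithm of (F_z, F_z). A solution therefore
needs no separate smoothness hypothesis on u, φ or ψ. -/
lemma smooth_u (h : IsSolution c V u φ ψ F) : ContDiffOn ℝ ∞ u V := by
  have h1 := contDiffOn_wz h.isOpen h.smooth
  have h2 : ContDiffOn ℝ ∞ (fun z => Real.log (herm c (wz F z) (wz F z)).re) V := by
    refine (reCLM.contDiff.comp_contDiffOn (contDiffOn_herm h1 h1)).log fun z hz => ?_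
    change (herm c (wz F z) (wz F z)).re ≠ 0
    rw [(h.frame z hz).PP, ofReal_re]
    exact Real.exp_ne_zero _
  refine h2.congr fun z hz => ?_
  rw [(h.frame z hz).PP, ofReal_re, Real.log_exp]

lemma smooth_phi (h : IsSolution c V u φ ψ F) : ContDiffOn ℝ ∞ φ V := by
  have h1 := contDiffOn_wz h.isOpen h.smooth
  have h2 := contDiffOn_wzb h.isOpen h.smooth
  have h3 := contDiffOn_herm (contDiffOn_wzb h.isOpen h1) h2
  have h4 := contDiffOn_ofReal (Real.contDiff_exp.comp_contDiffOn h.smooth_u.neg)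
  refine ((contDiffOn_const (c := -I)).mul (h3.mul h4)).congr fun z hz => ?_
  rw [h.mean z hz]
  have : (Real.exp (u z) : ℂ) * ((Real.exp ∘ fun z => -u z) z : ℝ) = 1 := by
    rw [← ofReal_mul, Function.comp_apply, ← Real.exp_add, add_neg_cancel, Real.exp_zero, ofReal_one]
  linear_combination (-φ z) * this + (φ z * (Real.exp (u z) : ℂ) *
    ((Real.exp ∘ fun z => -u z) z : ℝ)) * I_mul_I

lemma smooth_psi (h : IsSolution c V u φ ψ F) : ContDiffOn ℝ ∞ ψ V := by
  have h1 := contDiffOn_wz h.isOpen h.smooth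
  have h2 := contDiffOn_wzb h.isOpen h.smooth
  refine ((contDiffOn_const (c := -I)).mul (contDiffOn_herm (contDiffOn_wz h.isOpen h1) h2)).congr
    fun z hz => ?_
  rw [h.hopf z hz]
  linear_combination (ψ z) * I_mul_I

lemma exp_neg_mul (x : ℝ) : ((Real.exp (-x) : ℝ) : ℂ) * (Real.exp x : ℝ) = 1 := by
  rw [← ofReal_mul, ← Real.exp_add, neg_add_cancel, Real.exp_zero, ofReal_one]

lemma exp_ne_zero (x : ℝ) : ((Real.exp x : ℝ) : ℂ) ≠ 0 := ofReal_ne_zero.2 (Real.exp_ne_zero x)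

lemma exp_neg_eq (x : ℝ) : ((Real.exp (-x) : ℝ) : ℂ) = ((Real.exp x : ℝ) : ℂ)⁻¹ :=
  eq_inv_of_mul_eq_one_left (exp_neg_mul x)

/-! The derivatives of the orthogonality relations. -/

lemma hasWir_exp (h : IsSolution c V u φ ψ F) (hz : z ∈ V) :
    HasWir (fun w => ((Real.exp (u w) : ℝ) : ℂ)) (Real.exp (u z) * duz u z)
      (Real.exp (u z) * conj (duz u z)) z :=
  (hasWir_ofReal h.isOpen h.smooth_u hz).ofReal_exp

lemma deriv_PP (h : IsSolution c V u φ ψ F) (hz : z ∈ V) :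
    herm c (wz (wz F) z) (wz F z) + herm c (wz F z) (wzb (wz F) z)
      = Real.exp (u z) * duz u z := by
  have h1 := (h.hasWir_wz hz).herm (h.hasWir_wz hz)
  refine (h1.unique ((h.hasWir_exp hz).congr_of_eventuallyEq ?_)).1
  filter_upwards [h.isOpen.mem_nhds hz] with w hw using (h.frame w hw).PP

lemma deriv_QQ (h : IsSolution c V u φ ψ F) (hz : z ∈ V) :
    herm c (wzb (wz F) z) (wzb F z) + herm c (wzb F z) (wzb (wzb F) z)
      = Real.exp (u z) * duz u z := by
  have h1 := (h.hasWir_wzb hz).herm (h.hasWir_wzb hz)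
  rw [h.wz_wzb hz] at h1
  refine (h1.unique ((h.hasWir_exp hz).congr_of_eventuallyEq ?_)).1
  filter_upwards [h.isOpen.mem_nhds hz] with w hw using (h.frame w hw).QQ

lemma deriv_PQ (h : IsSolution c V u φ ψ F) (hz : z ∈ V) :
    herm c (wz (wz F) z) (wzb F z) + herm c (wz F z) (wzb (wzb F) z) = 0 ∧
    herm c (wzb (wz F) z) (wzb F z) + herm c (wz F z) (wzb (wz F) z) = 0 := by
  have h1 := (h.hasWir_wz hz).herm (h.hasWir_wzb hz)
  rw [h.wz_wzb hz] at h1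
  refine h1.unique ((HasWir.const (0 : ℂ) z).congr_of_eventuallyEq ?_)
  filter_upwards [h.isOpen.mem_nhds hz] with w hw using (h.frame w hw).PQ

lemma deriv_PF (h : IsSolution c V u φ ψ F) (hc : c ≠ 0) (hz : z ∈ V) :
    herm c (wz (wz F) z) (F z) = 0 ∧ herm c (wzb (wz F) z) (F z) = -Real.exp (u z) := by
  have h1 := (h.hasWir_wz hz).herm (h.hasWir hz)
  have h2 := h1.unique ((HasWir.const (0 : ℂ) z).congr_of_eventuallyEq (by
    filter_upwards [h.isOpen.mem_nhds hz] with w hw using (h.frame w hw).PF hc))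
  rw [(h.frame z hz).PQ, (h.frame z hz).PP] at h2
  exact ⟨by linear_combination h2.1, by linear_combination h2.2⟩

lemma deriv_QF (h : IsSolution c V u φ ψ F) (hc : c ≠ 0) (hz : z ∈ V) :
    herm c (wzb (wzb F) z) (F z) = 0 := by
  have h1 := (h.hasWir_wzb hz).herm (h.hasWir hz)
  have h2 := h1.unique ((HasWir.const (0 : ℂ) z).congr_of_eventuallyEq (by
    filter_upwards [h.isOpen.mem_nhds hz] with w hw using (h.frame w hw).QF hc))
  rw [(h.frame z hz).QP] at h2
  linear_combination h2.2

/-! The structure equations. -/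

/-- The frame is orthogonal, so a second derivative is known from its products with F_z, F_z̄ and F.
The fields `hopf` and `mean` prescribe two products; the rest follow from the differentiated frame
relations. The next two lemmas work the same way. -/
lemma wz_wz (h : IsSolution c V u φ ψ F) (hz : z ∈ V) :
    wz (wz F) z = (duz u z + I * φ z) • wz F z + (I * ψ z * (Real.exp (-u z) : ℝ)) • wzb F z := by
  have he := exp_ne_zero (u z)
  have h1 : herm c (wz (wz F) z) (wz F z) = Real.exp (u z) * (duz u z + I * φ z) := by
    linear_combination h.deriv_PP hz - (h.deriv_PQ hz).2 + h.mean z hz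
  have h2 : ((c : ℝ) : ℂ) * herm c (wz (wz F) z) (F z) = 0 := by
    by_cases hc : c = 0
    · simp [hc]
    · rw [(h.deriv_PF hc hz).1, mul_zero]
  rw [(h.frame z hz).expansion (wz (wz F) z), h1, h.hopf z hz, h2, exp_neg_eq, zero_smul, add_zero,
    mul_div_cancel_left₀ _ he, div_eq_mul_inv]

lemma wzb_wz (h : IsSolution c V u φ ψ F) (hz : z ∈ V) :
    wzb (wz F) z = (I * conj (φ z)) • wz F z + (I * φ z) • wzb F z +
      (-(((c : ℝ) : ℂ) * (Real.exp (u z) : ℝ))) • F z := by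
  have he := exp_ne_zero (u z)
  have h1 : herm c (wzb (wz F) z) (wz F z) = Real.exp (u z) * (I * conj (φ z)) := by
    have h2 : herm c (wz F z) (wzb (wz F) z) = -(I * φ z * Real.exp (u z)) := by
      linear_combination (h.deriv_PQ hz).2 - h.mean z hz
    rw [← conj_herm, h2]
    simp only [map_neg, map_mul, conj_I, conj_ofReal]
    ring
  have h2 : ((c : ℝ) : ℂ) * herm c (wzb (wz F) z) (F z) =
      -(((c : ℝ) : ℂ) * (Real.exp (u z) : ℝ)) := by
    by_cases hc : c = 0
    · simp [hc]
    · rw [(h.deriv_PF hc hz).2]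
      ring
  rw [(h.frame z hz).expansion (wzb (wz F) z), h1, h.mean z hz, h2, mul_div_cancel_left₀ _ he,
    mul_div_cancel_right₀ _ he]

lemma wzb_wzb (h : IsSolution c V u φ ψ F) (hz : z ∈ V) :
    wzb (wzb F) z = (I * conj (ψ z) * (Real.exp (-u z) : ℝ)) • wz F z +
      (conj (duz u z) + I * conj (φ z)) • wzb F z := by
  have he := exp_ne_zero (u z)
  have h1 : herm c (wzb (wzb F) z) (wz F z) = I * conj (ψ z) := by
    have h2 : herm c (wz F z) (wzb (wzb F) z) = -(I * ψ z) := by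
      linear_combination (h.deriv_PQ hz).1 - h.hopf z hz
    rw [← conj_herm, h2]
    simp only [map_neg, map_mul, conj_I]
    ring
  have h3 : herm c (wzb (wzb F) z) (wzb F z) =
      Real.exp (u z) * (conj (duz u z) + I * conj (φ z)) := by
    have h2 : herm c (wzb F z) (wzb (wzb F) z) = Real.exp (u z) * (duz u z - I * φ z) := by
      linear_combination h.deriv_QQ hz - h.mean z hz
    rw [← conj_herm, h2]
    simp only [map_sub, map_mul, conj_I, conj_ofReal]
    ring
  have h2 : ((c : ℝ) : ℂ) * herm c (wzb (wzb F) z) (F z) = 0 := by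
    by_cases hc : c = 0
    · simp [hc]
    · rw [h.deriv_QF hc hz, mul_zero]
  rw [(h.frame z hz).expansion (wzb (wzb F) z), h1, h3, h2, exp_neg_eq, zero_smul, add_zero,
    mul_div_cancel_left₀ _ he, div_eq_mul_inv]

end IsSolution

/-- The integrability conditions of the structure equations at a point, in terms of the values and
the derivatives of the data. -/
structure IsIntegrable (c : SignType) (u : ℂ → ℝ) (φ ψ : ℂ → ℂ) (z : ℂ) : Prop where
  closed : wzb φ z = conj (wzb φ z)
  gauss : wzb (duz u) z + φ z * conj (φ z) + ((c : ℝ) : ℂ) * (Real.exp (u z) : ℝ)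
    - ψ z * conj (ψ z) * (Real.exp (-u z) : ℝ) ^ 2 = 0
  codazzi : wzb ψ z * (Real.exp (-u z) : ℝ) = wz φ z - duz u z * φ z

/-- The conditions are the compatibility equations. -/
lemma isIntegrable_iff (hV : IsOpen V) (hu : ContDiffOn ℝ ∞ u V) (hφ : ContDiffOn ℝ ∞ φ V)
    (hz : z ∈ V) : IsIntegrable c u φ ψ z ↔
      dzbar φ z - dz (fun w => conj (φ w)) z = 0 ∧
      dzbar (dz fun w => (u w : ℂ)) z + (‖φ z‖ : ℂ) ^ 2 + ((c : ℝ) : ℂ) * (Real.exp (u z) : ℂ)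
        - (Real.exp (-2 * u z) : ℂ) * (‖ψ z‖ : ℂ) ^ 2 = 0 ∧
      (Real.exp (-2 * u z) : ℂ) * dzbar ψ z = dz (fun w => (Real.exp (-u w) : ℂ) * φ w) z := by
  have h2 : ((Real.exp (-2 * u z) : ℝ) : ℂ) = ((Real.exp (-u z) : ℝ) : ℂ) ^ 2 := by
    rw [← ofReal_pow, ← Real.exp_nat_mul]
    congr 2
    push_cast
    ring
  have hφz := ContDiffOn.hasWir hV hφ hz
  have h3 : dz (fun w => conj (φ w)) z = conj (wzb φ z) := hφz.star.wz
  -- Expanding (e^{-u} φ)_z shows that the stated Codazzi equation is `codazzi` multiplied by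
  -- e^{-u}.
  have h4 : dz (fun w => (Real.exp (-u w) : ℂ) * φ w) z =
      (Real.exp (-u z) : ℝ) * (wz φ z - duz u z * φ z) := by
    have h5 : HasWir (fun w => ((-u w : ℝ) : ℂ)) (-duz u z) (-conj (duz u z)) z := by
      simpa only [ofReal_neg] using (hasWir_ofReal hV hu hz).neg
    rw [dz_eq_wz, (h5.ofReal_exp.mul hφz).wz]
    ring
  have hne := IsSolution.exp_ne_zero (-u z)
  have h6 : ∀ a : ℂ, (‖a‖ : ℂ) ^ 2 = a * conj a := fun a => by
    rw [mul_conj, normSq_eq_norm_sq, ofReal_pow]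
  have h7 : dzbar (dz fun w => (u w : ℂ)) z = wzb (duz u) z := rfl
  rw [h2, h3, h4, h6, h6, h7, dzbar_eq_wzb, dzbar_eq_wzb]
  constructor
  · rintro ⟨e1, e2, e3⟩
    refine ⟨sub_eq_zero.2 e1, by linear_combination e2, ?_⟩
    linear_combination (Real.exp (-u z) : ℂ) * e3
  · rintro ⟨e1, e2, e3⟩
    refine ⟨sub_eq_zero.1 e1, by linear_combination e2, mul_left_cancel₀ hne ?_⟩
    linear_combination e3

section Coefficients

variable (hV : IsOpen V) (hu : ContDiffOn ℝ ∞ u V) (hφ : ContDiffOn ℝ ∞ φ V)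
  (hψ : ContDiffOn ℝ ∞ ψ V) (hz : z ∈ V)
include hV hu hz

lemma hasWir_exp_neg : HasWir (fun w => ((Real.exp (-u w) : ℝ) : ℂ))
    (-(Real.exp (-u z) * duz u z)) (-(Real.exp (-u z) * conj (duz u z))) z := by
  have h5 : HasWir (fun w => ((-u w : ℝ) : ℂ)) (-duz u z) (-conj (duz u z)) z := by
    simpa only [ofReal_neg] using (hasWir_ofReal hV hu hz).neg
  exact h5.ofReal_exp.congr_deriv (by ring) (by ring)

include hφ in
lemma hasWir_a₁ : HasWir (fun w => duz u w + I * φ w) (wz (duz u) z + I * wz φ z)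
    (wzb (duz u) z + I * wzb φ z) z :=
  (hasWir_duz hV hu hz).add ((ContDiffOn.hasWir hV hφ hz).const_smul I)

include hφ in
lemma hasWir_d₂ : HasWir (fun w => conj (duz u w) + I * conj (φ w))
    (wzb (duz u) z + I * conj (wzb φ z)) (conj (wz (duz u) z) + I * conj (wz φ z)) z :=
  ((hasWir_duz hV hu hz).star.add ((ContDiffOn.hasWir hV hφ hz).star.const_smul I)).congr_deriv
    (by rw [conj_wzb_duz hV hu hz]; rfl) rfl

include hψ in
lemma hasWir_a₂ : HasWir (fun w => I * ψ w * (Real.exp (-u w) : ℝ))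
    (I * (wz ψ z - ψ z * duz u z) * (Real.exp (-u z) : ℝ))
    (I * (wzb ψ z - ψ z * conj (duz u z)) * (Real.exp (-u z) : ℝ)) z :=
  (((ContDiffOn.hasWir hV hψ hz).const_smul I).mul (hasWir_exp_neg hV hu hz)).congr_deriv
    (by simp only [smul_eq_mul]; ring) (by simp only [smul_eq_mul]; ring)

include hψ in
lemma hasWir_d₁ : HasWir (fun w => I * conj (ψ w) * (Real.exp (-u w) : ℝ))
    (I * (conj (wzb ψ z) - conj (ψ z) * duz u z) * (Real.exp (-u z) : ℝ))
    (I * (conj (wz ψ z) - conj (ψ z) * conj (duz u z)) * (Real.exp (-u z) : ℝ)) z :=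
  (((ContDiffOn.hasWir hV hψ hz).star.const_smul I).mul (hasWir_exp_neg hV hu hz)).congr_deriv
    (by simp only [smul_eq_mul]; ring) (by simp only [smul_eq_mul]; ring)

omit hu in
include hφ in
lemma hasWir_b₂ : HasWir (fun w => I * φ w) (I * wz φ z) (I * wzb φ z) z :=
  (ContDiffOn.hasWir hV hφ hz).const_smul I

omit hu in
include hφ in
lemma hasWir_b₁ : HasWir (fun w => I * conj (φ w)) (I * conj (wzb φ z)) (I * conj (wz φ z)) z :=
  (ContDiffOn.hasWir hV hφ hz).star.const_smul I

lemma hasWir_b₃ : HasWir (fun w => -(((c : ℝ) : ℂ) * (Real.exp (u w) : ℝ)))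
    (-(((c : ℝ) : ℂ) * (Real.exp (u z) * duz u z)))
    (-(((c : ℝ) : ℂ) * (Real.exp (u z) * conj (duz u z)))) z :=
  ((hasWir_ofReal hV hu hz).ofReal_exp.const_smul _).neg

end Coefficients

/-- The data of a conformal Lagrangian immersion satisfy the compatibility equations. -/
theorem IsSolution.isIntegrable (h : IsSolution c V u φ ψ F) (hz : z ∈ V) :
    IsIntegrable c u φ ψ z := by
  have hV := h.isOpen
  have hVz := hV.mem_nhds hz
  have hu := h.smooth_u
  have hφ := h.smooth_phi
  have hψ := h.smooth_psi
  have hF := h.hasWir hz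
  have hP := h.hasWir_wz hz
  have hQ := h.hasWir_wzb hz
  have e1 := ((hasWir_a₁ hV hu hφ hz).smul hP).add ((hasWir_a₂ hV hu hψ hz).smul hQ)
  have e2 := (((hasWir_b₁ hV hφ hz).smul hP).add ((hasWir_b₂ hV hφ hz).smul hQ)).add
    ((hasWir_b₃ (c := c) hV hu hz).smul hF)
  have e3 := ((hasWir_d₁ hV hu hψ hz).smul hP).add ((hasWir_d₂ hV hu hφ hz).smul hQ)
  have f1 := e1.congr_of_eventuallyEq (G := wz (wz F)) (by
    filter_upwards [hVz] with w hw using h.wz_wz hw)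
  have f2 := e2.congr_of_eventuallyEq (G := wzb (wz F)) (by
    filter_upwards [hVz] with w hw using h.wzb_wz hw)
  have f3 := e3.congr_of_eventuallyEq (G := wzb (wzb F)) (by
    filter_upwards [hVz] with w hw using h.wzb_wzb hw)
  -- The two integrability conditions of the structure equations: (F_zz)_z̄ = (F_zz̄)_z here, and
  -- (F_zz̄)_z̄ = (F_z̄z̄)_z in `s2`.
  have s1 := HasWir.symm (by filter_upwards [hVz] with w hw using h.hasWir_wz hw) f1 f2
  have s2 := HasWir.symm (F := wzb F) (P := wzb (wz F)) (Q := wzb (wzb F))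
    (by
      filter_upwards [hVz] with w hw
      exact (h.hasWir_wzb hw).congr_deriv (h.wz_wzb hw) rfl) f2 f3
  rw [h.wz_wzb hz, h.wz_wz hz, h.wzb_wz hz, h.wzb_wzb hz] at s1
  rw [h.wz_wzb hz, h.wz_wz hz, h.wzb_wz hz, h.wzb_wzb hz] at s2
  set P := wz F z
  set Q := wzb F z
  set E := ((Real.exp (u z) : ℝ) : ℂ) with hE
  set E' := ((Real.exp (-u z) : ℝ) : ℂ) with hE'
  have hfr := h.frame z hz
  -- Every F term carries a factor c, so both sides have the shape required by `coord_eq`; only the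
  -- coefficients of F_z and F_z̄ are needed.
  have t1 := hfr.coord_eq
    (a := wzb (duz u) z + I * wzb φ z + (duz u z + I * φ z) * (I * conj (φ z)) +
      I * ψ z * E' * (I * conj (ψ z) * E'))
    (b := I * (wzb ψ z - ψ z * conj (duz u z)) * E' + (duz u z + I * φ z) * (I * φ z)
      + I * ψ z * E' * (conj (duz u z) + I * conj (φ z)))
    (d := -((duz u z + I * φ z) * E))
    (a' := I * conj (wzb φ z) + I * conj (φ z) * (duz u z + I * φ z) + I * φ z * (I * conj (φ z))
      - ((c : ℝ) : ℂ) * E)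
    (b' := I * wz φ z + I * conj (φ z) * (I * ψ z * E') + I * φ z * (I * φ z))
    (d' := -(E * duz u z + I * φ z * E)) (by linear_combination (norm := module) s1)
  have t2 := hfr.coord_eq
    (a := I * conj (wz φ z) + I * conj (φ z) * (I * conj (φ z)) + I * φ z * (I * conj (ψ z) * E'))
    (b := I * wzb φ z + I * conj (φ z) * (I * φ z) + I * φ z * (conj (duz u z) + I * conj (φ z))
      - ((c : ℝ) : ℂ) * E)
    (d := -(E * conj (duz u z) + I * conj (φ z) * E))
    (a' := I * (conj (wzb ψ z) - conj (ψ z) * duz u z) * E' +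
      I * conj (ψ z) * E' * (duz u z + I * φ z) +
      (conj (duz u z) + I * conj (φ z)) * (I * conj (φ z)))
    (b' := wzb (duz u) z + I * conj (wzb φ z) + I * conj (ψ z) * E' * (I * ψ z * E') +
      (conj (duz u z) + I * conj (φ z)) * (I * φ z))
    (d' := -((conj (duz u z) + I * conj (φ z)) * E)) (by linear_combination (norm := module) s2)
  have hI := I_mul_I
  constructor
  -- The F_z coefficient of the first condition and the F_z̄ coefficient of the second each mix the
  -- Gauss equation with dΦ = 0. Their sum isolates closedness and their difference the Gauss
  -- equation; the remaining coefficient of the first condition is Codazzi.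
  · refine mul_left_cancel₀ (mul_ne_zero two_ne_zero I_ne_zero) ?_
    linear_combination t1.1 + t2.2
  · linear_combination (1 / 2) * t1.1 - (1 / 2) * t2.2 + (φ z * conj (φ z)
      - ψ z * conj (ψ z) * E' ^ 2) * hI
  · refine mul_left_cancel₀ I_ne_zero ?_
    linear_combination t1.2

end Solutions

/-! ### The structure equations as a linear connection -/

section Connection

open Complex Set Filter Topology

set_option maxSynthPendingDepth 3

variable {c : SignType} {V : Set ℂ} {u : ℂ → ℝ} {φ ψ : ℂ → ℂ} {F : ℂ → Amb c} {z : ℂ}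

/-- Curvature is a 2-form in one complex variable, hence a multiple of dz ∧ dz̄; the single
hypothesis h is its coefficient. The endomorphisms are typed as real linear, so complex linearity of
A and B at z enters through `hAl` and `hBl`. -/
lemma wir_flat {W : Type*} [NormedAddCommGroup W] [NormedSpace ℝ W] [NormedSpace ℂ W]
    [IsScalarTower ℝ ℂ W] [SMulCommClass ℝ ℂ W] {A B : ℂ → W →L[ℝ] W} {A₁ A₂ B₁ B₂ : W →L[ℝ] W}
    (hA : HasWir A A₁ A₂ z) (hB : HasWir B B₁ B₂ z)
    (hAl : ∀ (a : ℂ) w, A z (a • w) = a • A z w) (hBl : ∀ (a : ℂ) w, B z (a • w) = a • B z w)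
    (h : ∀ w, A₂ w + A z (B z w) = B₁ w + B z (A z w)) (X Y : ℂ) :
    fderiv ℝ (fun w => wir (A w) (B w)) z X Y + wir (A z) (B z) Y ∘L wir (A z) (B z) X =
      fderiv ℝ (fun w => wir (A w) (B w)) z Y X + wir (A z) (B z) X ∘L wir (A z) (B z) Y := by
  have h1 : HasFDerivAt (fun w => wir (A w) (B w)) _ z :=
    (wirCLM (W →L[ℝ] W)).hasFDerivAt.comp z (HasFDerivAt.prodMk hA hB)
  have h2 : ∀ X Y, fderiv ℝ (fun w => wir (A w) (B w)) z X Y =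
      wir (wir A₁ A₂ X) (wir B₁ B₂ X) Y := fun X Y => by rw [h1.fderiv]; rfl
  rw [h2, h2]
  ext1 w
  have h3 := h w
  simp only [wir_apply, add_apply, smul_apply, ContinuousLinearMap.comp_apply, map_add, hAl, hBl]
  linear_combination (norm := module) (conj X * Y - X * conj Y) • h3

/-- The endomorphism of triples with the `j`-th component in place `i`. -/
def unitCLM (c : SignType) (i j : Fin 3) : (Fin 3 → Amb c) →L[ℝ] (Fin 3 → Amb c) :=
  (ContinuousLinearMap.single ℝ (fun _ : Fin 3 => Amb c) i) ∘L
    (ContinuousLinearMap.proj (R := ℝ) (φ := fun _ : Fin 3 => Amb c) j)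

lemma unitCLM_apply (i j k : Fin 3) (w : Fin 3 → Amb c) :
    unitCLM c i j w k = if k = i then w j else 0 := by
  simp [unitCLM, Pi.single_apply]

/-- The endomorphism of triples giving the `dz`-part of a connection. -/
def connZ (c : SignType) (k a₁ a₂ b₁ b₂ b₃ : ℂ) : (Fin 3 → Amb c) →L[ℝ] (Fin 3 → Amb c) :=
  k • unitCLM c 0 1 + (a₁ • unitCLM c 1 1 + a₂ • unitCLM c 1 2) +
    (b₁ • unitCLM c 2 1 + b₂ • unitCLM c 2 2 + b₃ • unitCLM c 2 0)

/-- The endomorphism of triples giving the `dz̄`-part of a connection. -/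
def connZbar (c : SignType) (k b₁ b₂ b₃ d₁ d₂ : ℂ) : (Fin 3 → Amb c) →L[ℝ] (Fin 3 → Amb c) :=
  k • unitCLM c 0 2 + (b₁ • unitCLM c 1 1 + b₂ • unitCLM c 1 2 + b₃ • unitCLM c 1 0) +
    (d₁ • unitCLM c 2 1 + d₂ • unitCLM c 2 2)

lemma connZ_apply (k a₁ a₂ b₁ b₂ b₃ : ℂ) (w : Fin 3 → Amb c) : connZ c k a₁ a₂ b₁ b₂ b₃ w =
    ![k • w 1, a₁ • w 1 + a₂ • w 2, b₁ • w 1 + b₂ • w 2 + b₃ • w 0] := by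
  funext i
  fin_cases i <;> simp [connZ, unitCLM_apply]

lemma connZbar_apply (k b₁ b₂ b₃ d₁ d₂ : ℂ) (w : Fin 3 → Amb c) :
    connZbar c k b₁ b₂ b₃ d₁ d₂ w =
      ![k • w 2, b₁ • w 1 + b₂ • w 2 + b₃ • w 0, d₁ • w 1 + d₂ • w 2] := by
  funext i
  fin_cases i <;> simp [connZbar, unitCLM_apply]

lemma HasWir.smul_const {E : Type*} [NormedAddCommGroup E] [NormedSpace ℝ E] [NormedSpace ℂ E]
    [IsScalarTower ℝ ℂ E] {f : ℂ → ℂ} {p q : ℂ} (hf : HasWir f p q z) (a : E) :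
    HasWir (fun w => f w • a) (p • a) (q • a) z :=
  (hf.smul (HasWir.const a z)).congr_deriv (by simp) (by simp)

lemma HasWir.connZ {a₁ a₂ b₁ b₂ b₃ : ℂ → ℂ} {a₁' a₂' b₁' b₂' b₃' a₁'' a₂'' b₁'' b₂'' b₃'' : ℂ}
    (ha₁ : HasWir a₁ a₁' a₁'' z) (ha₂ : HasWir a₂ a₂' a₂'' z) (hb₁ : HasWir b₁ b₁' b₁'' z)
    (hb₂ : HasWir b₂ b₂' b₂'' z) (hb₃ : HasWir b₃ b₃' b₃'' z) :
    HasWir (fun w => connZ c 1 (a₁ w) (a₂ w) (b₁ w) (b₂ w) (b₃ w))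
      (connZ c 0 a₁' a₂' b₁' b₂' b₃') (connZ c 0 a₁'' a₂'' b₁'' b₂'' b₃'') z :=
  (((HasWir.const (1 : ℂ) z).smul_const _).add ((ha₁.smul_const _).add (ha₂.smul_const _))).add
    (((hb₁.smul_const _).add (hb₂.smul_const _)).add (hb₃.smul_const _))

lemma HasWir.connZbar {b₁ b₂ b₃ d₁ d₂ : ℂ → ℂ} {b₁' b₂' b₃' d₁' d₂' b₁'' b₂'' b₃'' d₁'' d₂'' : ℂ}
    (hb₁ : HasWir b₁ b₁' b₁'' z) (hb₂ : HasWir b₂ b₂' b₂'' z) (hb₃ : HasWir b₃ b₃' b₃'' z)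
    (hd₁ : HasWir d₁ d₁' d₁'' z) (hd₂ : HasWir d₂ d₂' d₂'' z) :
    HasWir (fun w => connZbar c 1 (b₁ w) (b₂ w) (b₃ w) (d₁ w) (d₂ w))
      (connZbar c 0 b₁' b₂' b₃' d₁' d₂') (connZbar c 0 b₁'' b₂'' b₃'' d₁'' d₂'') z :=
  (((HasWir.const (1 : ℂ) z).smul_const _).add
    (((hb₁.smul_const _).add (hb₂.smul_const _)).add (hb₃.smul_const _))).add
      ((hd₁.smul_const _).add (hd₂.smul_const _))

/-- The hypotheses compare the coefficients of w 1, w 2 and w 0 in the rows of F_z and F_z̄. The row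
of F holds automatically, because both parts of the connection use the same b₁, b₂, b₃ for F_{zz̄}.
-/
lemma conn_curvature {a₁ a₂ b₁ b₂ b₃ d₁ d₂ a₁' a₂' b₁' b₂' b₃' b₁'' b₂'' b₃'' d₁'' d₂'' : ℂ}
    (h₁ : a₁' + a₁ * b₁ + a₂ * d₁ = b₁'' + b₁ * a₁ + b₂ * b₁ + b₃)
    (h₂ : a₂' + a₁ * b₂ + a₂ * d₂ = b₂'' + b₁ * a₂ + b₂ * b₂)
    (h₃ : a₁ * b₃ = b₃'' + b₂ * b₃)
    (h₄ : b₁' + b₁ * b₁ + b₂ * d₁ = d₁'' + d₁ * a₁ + d₂ * b₁)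
    (h₅ : b₂' + b₁ * b₂ + b₂ * d₂ + b₃ = d₂'' + d₁ * a₂ + d₂ * b₂)
    (h₆ : b₃' + b₁ * b₃ = d₂ * b₃) (w : Fin 3 → Amb c) :
    connZ c 0 a₁' a₂' b₁' b₂' b₃' w + connZ c 1 a₁ a₂ b₁ b₂ b₃ (connZbar c 1 b₁ b₂ b₃ d₁ d₂ w) =
      connZbar c 0 b₁'' b₂'' b₃'' d₁'' d₂'' w +
        connZbar c 1 b₁ b₂ b₃ d₁ d₂ (connZ c 1 a₁ a₂ b₁ b₂ b₃ w) := by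
  rw [connZ_apply, connZ_apply, connZbar_apply, connZbar_apply, connZ_apply, connZbar_apply]
  simp only [Matrix.cons_val, Matrix.cons_add_cons, Matrix.empty_add_empty]
  congr 1
  · module
  congr 1
  · linear_combination (norm := module) h₁ • w 1 + h₂ • w 2 + h₃ • w 0
  congr 1
  linear_combination (norm := module) h₄ • w 1 + h₅ • w 2 + h₆ • w 0

/-- The `dz`-part of the connection of the structure equations. -/
def structZ (c : SignType) (u : ℂ → ℝ) (φ ψ : ℂ → ℂ) (z : ℂ) :
    (Fin 3 → Amb c) →L[ℝ] (Fin 3 → Amb c) :=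
  connZ c 1 (duz u z + I * φ z) (I * ψ z * (Real.exp (-u z) : ℝ)) (I * conj (φ z)) (I * φ z)
    (-(((c : ℝ) : ℂ) * (Real.exp (u z) : ℝ)))

/-- The `dz̄`-part of the connection of the structure equations. -/
def structZbar (c : SignType) (u : ℂ → ℝ) (φ ψ : ℂ → ℂ) (z : ℂ) :
    (Fin 3 → Amb c) →L[ℝ] (Fin 3 → Amb c) :=
  connZbar c 1 (I * conj (φ z)) (I * φ z) (-(((c : ℝ) : ℂ) * (Real.exp (u z) : ℝ)))
    (I * conj (ψ z) * (Real.exp (-u z) : ℝ)) (conj (duz u z) + I * conj (φ z))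

/-- The connection of the structure equations. -/
def structConn (c : SignType) (u : ℂ → ℝ) (φ ψ : ℂ → ℂ) (z : ℂ) :
    ℂ →L[ℝ] (Fin 3 → Amb c) →L[ℝ] (Fin 3 → Amb c) :=
  wir (structZ c u φ ψ z) (structZbar c u φ ψ z)

section Smoothness

variable (hV : IsOpen V) (hu : ContDiffOn ℝ ∞ u V) (hφ : ContDiffOn ℝ ∞ φ V)
  (hψ : ContDiffOn ℝ ∞ ψ V)
include hV hu hφ hψ

lemma contDiffOn_structConn : ContDiffOn ℝ ∞ (structConn c u φ ψ) V := by
  have h1 := contDiffOn_duz hV hu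
  have h2 := contDiffOn_conj h1
  have h3 := contDiffOn_conj hφ
  have h4 := contDiffOn_conj hψ
  have h5 := contDiffOn_ofReal (Real.contDiff_exp.comp_contDiffOn hu)
  have h6 := contDiffOn_ofReal (Real.contDiff_exp.comp_contDiffOn hu.neg)
  have k : ∀ a : ℂ, ContDiffOn ℝ ∞ (fun _ : ℂ => a) V := fun a => contDiffOn_const
  have k' : ∀ a : (Fin 3 → Amb c) →L[ℝ] (Fin 3 → Amb c), ContDiffOn ℝ ∞ (fun _ : ℂ => a) V :=
    fun a => contDiffOn_const
  have b1 := (k I).mul h3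
  have b2 := (k I).mul hφ
  have b3 := ((k ((c : ℝ) : ℂ)).mul h5).neg
  refine (wirCLM ((Fin 3 → Amb c) →L[ℝ] (Fin 3 → Amb c))).contDiff.comp_contDiffOn (ContDiffOn.prodMk ?_ ?_)
  · exact (((k 1).smul (k' _)).add (((h1.add b2).smul (k' _)).add ((((k I).mul hψ).mul h6).smul (k' _)))).add
      (((b1.smul (k' _)).add (b2.smul (k' _))).add (b3.smul (k' _)))
  · exact (((k 1).smul (k' _)).add (((b1.smul (k' _)).add (b2.smul (k' _))).add (b3.smul (k' _)))).add
      (((((k I).mul h4).mul h6).smul (k' _)).add ((h2.add b1).smul (k' _)))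

/-- Of the six scalar conditions, two combine the Gauss equation with dΦ = 0, one is Codazzi, one is
the conjugate of Codazzi, and the two for the F coefficients are identities. -/
lemma structConn_flat (hz : z ∈ V) (h : IsIntegrable c u φ ψ z) (X Y : ℂ) :
    fderiv ℝ (structConn c u φ ψ) z X Y + structConn c u φ ψ z Y ∘L structConn c u φ ψ z X =
    fderiv ℝ (structConn c u φ ψ) z Y X + structConn c u φ ψ z X ∘L structConn c u φ ψ z Y := by
  obtain ⟨g1, g2, g3⟩ := h
  have g3' : conj (wzb ψ z) * (Real.exp (-u z) : ℝ) =
      conj (wz φ z) - conj (duz u z) * conj (φ z) := by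
    simpa only [map_mul, map_sub, conj_ofReal] using congrArg conj g3
  have hI := I_mul_I
  refine wir_flat (HasWir.connZ (hasWir_a₁ hV hu hφ hz) (hasWir_a₂ hV hu hψ hz)
    (hasWir_b₁ hV hφ hz) (hasWir_b₂ hV hφ hz) (hasWir_b₃ hV hu hz))
    (HasWir.connZbar (hasWir_b₁ hV hφ hz) (hasWir_b₂ hV hφ hz) (hasWir_b₃ hV hu hz)
    (hasWir_d₁ hV hu hψ hz) (hasWir_d₂ hV hu hφ hz)) ?_ ?_ (conn_curvature ?_ ?_ ?_ ?_ ?_ ?_) X Y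
  · intro a w
    simp only [connZ_apply]
    funext k
    fin_cases k <;> simp [smul_smul, mul_comm]
  · intro a w
    simp only [connZbar_apply]
    funext k
    fin_cases k <;> simp [smul_smul, mul_comm]
  · linear_combination g2 + I * g1 - (φ z * conj (φ z)
      - ψ z * conj (ψ z) * (Real.exp (-u z) : ℂ) ^ 2) * hI
  · linear_combination I * g3
  · ring
  · linear_combination -I * g3'
  · linear_combination -g2 + I * g1 + (φ z * conj (φ z)
      - ψ z * conj (ψ z) * (Real.exp (-u z) : ℂ) ^ 2) * hI
  · ring

end Smoothness

end Connection

/-! ### Solving the structure equations -/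

section Existence

open Complex Set Filter Topology

set_option maxSynthPendingDepth 3

variable {c : SignType} {V : Set ℂ} {u : ℂ → ℝ} {φ ψ : ℂ → ℂ} {F : ℂ → Amb c} {z : ℂ}

lemma structConn_flip_apply (w : Fin 3 → Amb c) :
    (structConn c u φ ψ z).flip w = wir (structZ c u φ ψ z w) (structZbar c u φ ψ z w) := by
  ext1 X
  rw [ContinuousLinearMap.flip_apply, structConn, wir_apply, wir_apply]
  rfl

/-- The structure equations say that the triple (F, F_z, F_z̄) is parallel; this reduces uniqueness
of solutions to uniqueness of parallel sections. -/
lemma IsSolution.hasFDerivAt (h : IsSolution c V u φ ψ F) (hz : z ∈ V) :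
    HasFDerivAt (fun w => ![F w, wz F w, wzb F w])
      ((structConn c u φ ψ z).flip ![F z, wz F z, wzb F z]) z := by
  rw [structConn_flip_apply]
  refine hasFDerivAt_pi'.2 fun i => ?_
  have h0 := h.hasWir hz
  have h1 := h.hasWir_wz hz
  have h2 := h.hasWir_wzb hz
  rw [h.wz_wz hz, h.wzb_wz hz] at h1
  rw [h.wz_wzb hz, h.wzb_wz hz, h.wzb_wzb hz] at h2
  rw [structZ, structZbar, connZ_apply, connZbar_apply]
  fin_cases i
  · refine h0.congr_fderiv ?_
    ext1 X
    simp [wir_apply]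
  · refine h1.congr_fderiv ?_
    ext1 X
    simp [wir_apply]
  · refine h2.congr_fderiv ?_
    ext1 X
    simp [wir_apply]

/-- A solution is determined by the values of `F`, `F_z`, `F_z̄` at one point. -/
theorem IsSolution.eqOn {V₁ V₂ U : Set ℂ} {F₁ F₂ : ℂ → Amb c} (h₁ : IsSolution c V₁ u φ ψ F₁)
    (h₂ : IsSolution c V₂ u φ ψ F₂) (hU : Convex ℝ U) (hU₁ : U ⊆ V₁) (hU₂ : U ⊆ V₂) {y : ℂ}
    (hy : y ∈ U) (hF : F₁ y = F₂ y) (hP : wz F₁ y = wz F₂ y) (hQ : wzb F₁ y = wzb F₂ y) :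
    EqOn F₁ F₂ U := by
  have h3 := eqOn_of_hasFDerivAt_flip hU
    ((contDiffOn_structConn h₁.isOpen h₁.smooth_u h₁.smooth_phi h₁.smooth_psi).continuousOn.mono hU₁)
    (fun z hz => h₁.hasFDerivAt (hU₁ hz)) (fun z hz => h₂.hasFDerivAt (hU₂ hz)) hy
    (by simp only [hF, hP, hQ])
  intro z hz
  exact congrFun (h3 hz) 0

/-- The structure equations. -/
structure IsMovingFrame (c : SignType) (U : Set ℂ) (u : ℂ → ℝ) (φ ψ : ℂ → ℂ)
    (F P Q : ℂ → Amb c) : Prop where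
  F_eq : ∀ z ∈ U, HasWir F (P z) (Q z) z
  P_eq : ∀ z ∈ U, HasWir P
    ((duz u z + I * φ z) • P z + (I * ψ z * (Real.exp (-u z) : ℝ)) • Q z)
    ((I * conj (φ z)) • P z + (I * φ z) • Q z +
      (-(((c : ℝ) : ℂ) * (Real.exp (u z) : ℝ))) • F z) z
  Q_eq : ∀ z ∈ U, HasWir Q
    ((I * conj (φ z)) • P z + (I * φ z) • Q z +
      (-(((c : ℝ) : ℂ) * (Real.exp (u z) : ℝ))) • F z)
    ((I * conj (ψ z) * (Real.exp (-u z) : ℝ)) • P z +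
      (conj (duz u z) + I * conj (φ z)) • Q z) z

lemma IsMovingFrame.of_hasFDerivAt {w : ℂ → Fin 3 → Amb c}
    (h : ∀ z ∈ V, HasFDerivAt w ((structConn c u φ ψ z).flip (w z)) z) :
    IsMovingFrame c V u φ ψ (fun z => w z 0) (fun z => w z 1) (fun z => w z 2) := by
  have h1 : ∀ z ∈ V, ∀ i, HasFDerivAt (fun z => w z i)
      (wir (structZ c u φ ψ z (w z) i) (structZbar c u φ ψ z (w z) i)) z := by
    intro z hz i
    have h2 := h z hz
    rw [structConn_flip_apply] at h2
    refine (hasFDerivAt_pi'.1 h2 i).congr_fderiv ?_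
    ext1 X
    simp [wir_apply]
  simp only [structZ, structZbar, connZ_apply, connZbar_apply] at h1
  refine ⟨fun z hz => ?_, fun z hz => h1 z hz 1, fun z hz => h1 z hz 2⟩
  have := h1 z hz 0
  simp only [one_smul] at this
  exact this

namespace IsMovingFrame

variable {P Q : ℂ → Amb c} {U : Set ℂ}

/-- The completeness relation of the frame is preserved by the structure equations. -/
lemma completeness (h : IsMovingFrame c U u φ ψ F P Q) (hU : Convex ℝ U) (hUo : IsOpen U)
    (hu : ContDiffOn ℝ ∞ u U) {y : ℂ} (hy : y ∈ U)
    (hfr : IsFrame c (Real.exp (u y)) (F y) (P y) (Q y)) (X : Amb c) (hz : z ∈ U) :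
    (herm c X (P z) * (Real.exp (-u z) : ℝ)) • P z + (herm c X (Q z) * (Real.exp (-u z) : ℝ)) • Q z
      + (((c : ℝ) : ℂ) * herm c X (F z)) • F z = X := by
  -- The derivative of the left side vanishes identically by the structure equations alone, without
  -- assuming any frame relation away from y. This is why completeness, rather than orthogonality,
  -- is the quantity propagated.
  refine sub_eq_zero.1 (eq_zero_of_norm_fderiv_le_mul_norm hU (G := fun z =>
    (herm c X (P z) * (Real.exp (-u z) : ℝ)) • P z + (herm c X (Q z) * (Real.exp (-u z) : ℝ)) • Q z
      + (((c : ℝ) : ℂ) * herm c X (F z)) • F z - X) (G' := fun _ => 0) (K := fun _ => 0)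
    (fun z hz => ?_) continuousOn_const (by simp) hy ?_ z hz)
  · have hX := HasWir.const X z
    have he := hasWir_exp_neg hUo hu hz
    have hP := h.P_eq z hz
    have hQ := h.Q_eq z hz
    have hF := h.F_eq z hz
    have h1 := ((((((hX.herm hP).mul he).smul hP).add (((hX.herm hQ).mul he).smul hQ)).add
      (((hX.herm hF).const_smul ((c : ℝ) : ℂ)).smul hF)).sub hX)
    have h0 : (0 : ℂ →L[ℝ] Amb c) = wir 0 0 := (map_zero (wirCLM (Amb c))).symm
    rw [h0]
    have hE := IsSolution.exp_neg_mul (u z)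
    have hI := I_mul_I
    refine h1.congr_deriv ?_ ?_
    · simp only [herm_add_right, herm_smul_right, herm_zero_left, map_add, map_mul, map_neg, conj_I,
        conj_ofReal, conj_conj, smul_eq_mul, zero_add, sub_zero]
      linear_combination (norm := module) hE • (-(((c : ℝ) : ℂ) * herm c X (F z)) • P z
        - (((c : ℝ) : ℂ) * herm c X (Q z)) • F z)
    · simp only [herm_add_right, herm_smul_right, herm_zero_left, map_add, map_mul, map_neg, conj_I,
        conj_ofReal, conj_conj, smul_eq_mul, zero_add, sub_zero]
      linear_combination (norm := module) hE • (-(((c : ℝ) : ℂ) * herm c X (F z)) • Q z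
        - (((c : ℝ) : ℂ) * herm c X (P z)) • F z)
  · rw [sub_eq_zero]
    conv_rhs => rw [hfr.expansion X, div_eq_mul_inv, div_eq_mul_inv, ← IsSolution.exp_neg_eq]

/-- The frame relations are preserved by the structure equations. -/
lemma isFrame (h : IsMovingFrame c U u φ ψ F P Q) (hU : Convex ℝ U) (hUo : IsOpen U)
    (hu : ContDiffOn ℝ ∞ u U) {y : ℂ} (hy : y ∈ U)
    (hfr : IsFrame c (Real.exp (u y)) (F y) (P y) (Q y)) (hz : z ∈ U) :
    IsFrame c (Real.exp (u z)) (F z) (P z) (Q z) := by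
  have hcomp := fun X => h.completeness hU hUo hu hy hfr X hz
  have hE := IsSolution.exp_neg_mul (u z)
  have key : ∀ a : ℂ, a * (Real.exp (-u z) : ℝ) = 1 → a = (Real.exp (u z) : ℝ) := fun a ha => by
    linear_combination (Real.exp (u z) : ℂ) * ha - a * hE
  have key0 : ∀ a : ℂ, a * (Real.exp (-u z) : ℝ) = 0 → a = 0 := fun a ha =>
    (mul_eq_zero.1 ha).resolve_right (IsSolution.exp_ne_zero _)
  by_cases hc : c = 0
  -- Completeness makes the vectors span, so by dimension they are independent. Completeness applied
  -- to the frame vectors themselves then yields all their products by comparing coefficients.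
  · have hspan : ⊤ ≤ Submodule.span ℂ (Set.range ![P z, Q z]) := by
      intro X _
      rw [← hcomp X]
      simp only [hc, SignType.coe_zero, ofReal_zero, zero_mul, zero_smul, add_zero]
      exact add_mem (Submodule.smul_mem _ _ (Submodule.subset_span ⟨0, rfl⟩))
        (Submodule.smul_mem _ _ (Submodule.subset_span ⟨1, rfl⟩))
    have hli := linearIndependent_of_top_le_span_of_card_eq_finrank hspan
      (by simp [ambDim, hc])
    rw [LinearIndependent.pair_iff] at hli
    have hP := hcomp (P z)
    have hQ := hcomp (Q z)
    simp only [hc, SignType.coe_zero, ofReal_zero, zero_mul, zero_smul, add_zero] at hP hQ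
    have hP' := hli (herm c (P z) (P z) * (Real.exp (-u z) : ℝ) - 1)
      (herm c (P z) (Q z) * (Real.exp (-u z) : ℝ)) (by linear_combination (norm := module) hP)
    have hQ' := hli (herm c (Q z) (P z) * (Real.exp (-u z) : ℝ))
      (herm c (Q z) (Q z) * (Real.exp (-u z) : ℝ) - 1) (by linear_combination (norm := module) hQ)
    exact ⟨Real.exp_pos _, fun h => absurd hc h, key _ (sub_eq_zero.1 hP'.1),
      key _ (sub_eq_zero.1 hQ'.2), key0 _ hP'.2, fun h => absurd hc h, fun h => absurd hc h⟩
  · have hspan : ⊤ ≤ Submodule.span ℂ (Set.range ![P z, Q z, F z]) := by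
      intro X _
      rw [← hcomp X]
      exact add_mem (add_mem (Submodule.smul_mem _ _ (Submodule.subset_span ⟨0, rfl⟩))
        (Submodule.smul_mem _ _ (Submodule.subset_span ⟨1, rfl⟩)))
        (Submodule.smul_mem _ _ (Submodule.subset_span ⟨2, rfl⟩))
    have hli := linearIndependent_of_top_le_span_of_card_eq_finrank hspan
      (by simp [ambDim, hc])
    have hli' : ∀ a b d : ℂ, a • P z + b • Q z + d • F z = 0 → a = 0 ∧ b = 0 ∧ d = 0 := by
      intro a b d hab
      have h1 := Fintype.linearIndependent_iff.1 hli ![a, b, d] (by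
        rw [Fin.sum_univ_three]
        exact hab)
      exact ⟨h1 0, h1 1, h1 2⟩
    have hcc := sign_sq_eq_one hc
    have hc0 := left_ne_zero_of_mul_eq_one hcc
    have hP := hcomp (P z)
    have hQ := hcomp (Q z)
    have hF := hcomp (F z)
    obtain ⟨p1, p2, p3⟩ := hli' (herm c (P z) (P z) * (Real.exp (-u z) : ℝ) - 1)
      (herm c (P z) (Q z) * (Real.exp (-u z) : ℝ)) (((c : ℝ) : ℂ) * herm c (P z) (F z))
      (by linear_combination (norm := module) hP)
    obtain ⟨q1, q2, q3⟩ := hli' (herm c (Q z) (P z) * (Real.exp (-u z) : ℝ))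
      (herm c (Q z) (Q z) * (Real.exp (-u z) : ℝ) - 1) (((c : ℝ) : ℂ) * herm c (Q z) (F z))
      (by linear_combination (norm := module) hQ)
    obtain ⟨-, -, f3⟩ := hli' (herm c (F z) (P z) * (Real.exp (-u z) : ℝ))
      (herm c (F z) (Q z) * (Real.exp (-u z) : ℝ)) (((c : ℝ) : ℂ) * herm c (F z) (F z) - 1)
      (by linear_combination (norm := module) hF)
    refine ⟨Real.exp_pos _, fun _ => ?_, key _ (sub_eq_zero.1 p1), key _ (sub_eq_zero.1 q2),
      key0 _ p2, fun _ => (mul_eq_zero.1 p3).resolve_left hc0,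
      fun _ => (mul_eq_zero.1 q3).resolve_left hc0⟩
    -- The coefficient comparison gives c (F, F) = 1, and c² = 1 turns this into (F, F) = c.
    linear_combination ((c : ℝ) : ℂ) * f3 - herm c (F z) (F z) * hcc

lemma isSolution (h : IsMovingFrame c U u φ ψ F P Q) (hU : Convex ℝ U) (hUo : IsOpen U)
    (hF : ContDiffOn ℝ ∞ F U) (hu : ContDiffOn ℝ ∞ u U) {y : ℂ} (hy : y ∈ U)
    (hfr : IsFrame c (Real.exp (u y)) (F y) (P y) (Q y)) : IsSolution c U u φ ψ F := by
  have hfr' : ∀ z ∈ U, IsFrame c (Real.exp (u z)) (F z) (P z) (Q z) :=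
    fun z hz => h.isFrame hU hUo hu hy hfr hz
  have hP : ∀ z ∈ U, wz F z = P z := fun z hz => (h.F_eq z hz).wz
  have hQ : ∀ z ∈ U, wzb F z = Q z := fun z hz => (h.F_eq z hz).wzb
  have hP' : ∀ z ∈ U, wz F =ᶠ[𝓝 z] P := fun z hz => by
    filter_upwards [hUo.mem_nhds hz] with w hw using hP w hw
  refine ⟨⟨hUo, hF, fun z hz => (hfr' z hz).mem⟩, fun z hz => ?_, fun z hz => ?_, fun z hz => ?_⟩
  · rw [hP z hz, hQ z hz]
    exact hfr' z hz
  · rw [wz_congr (hP' z hz), hQ z hz, (h.P_eq z hz).wz, herm_add_left, herm_smul_left,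
      herm_smul_left, (hfr' z hz).PQ, (hfr' z hz).QQ]
    linear_combination I * ψ z * IsSolution.exp_neg_mul (u z)
  · rw [wzb_congr (hP' z hz), hQ z hz, (h.P_eq z hz).wzb, herm_add_left, herm_add_left,
      herm_smul_left, herm_smul_left, herm_smul_left, (hfr' z hz).PQ, (hfr' z hz).QQ]
    linear_combination -(Real.exp (u z) : ℂ) * (hfr' z hz).sign_FQ

end IsMovingFrame

/-- Local existence of solutions with given frame at a point. -/
theorem exists_isSolution {O : Set ℂ} (hO : IsOpen O) (hu : ContDiffOn ℝ ∞ u O)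
    (hφ : ContDiffOn ℝ ∞ φ O) (hψ : ContDiffOn ℝ ∞ ψ O) (hint : ∀ z ∈ O, IsIntegrable c u φ ψ z)
    {x : ℂ} (hx : x ∈ O) : ∃ r > 0, Metric.ball x r ⊆ O ∧ ∀ y ∈ Metric.ball x r, ∀ F₀ P₀ Q₀ : Amb c,
      IsFrame c (Real.exp (u y)) F₀ P₀ Q₀ → ∃ F, IsSolution c (Metric.ball x r) u φ ψ F ∧
        F y = F₀ ∧ wz F y = P₀ ∧ wzb F y = Q₀ := by
  obtain ⟨r, hr, hrO, h⟩ := exists_ball_parallel hO (contDiffOn_structConn (c := c) hO hu hφ hψ)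
    (fun z hz => structConn_flat hO hu hφ hψ hz (hint z hz)) hx
  refine ⟨r, hr, hrO, fun y hy F₀ P₀ Q₀ hfr => ?_⟩
  obtain ⟨w, hwy, hw, hw'⟩ := h y hy ![F₀, P₀, Q₀]
  have hm := IsMovingFrame.of_hasFDerivAt hw'
  refine ⟨fun z => w z 0, hm.isSolution (convex_ball x r) Metric.isOpen_ball
    (contDiffOn_pi.1 hw 0) (hu.mono hrO) hy (by simpa [hwy] using hfr), ?_, ?_, ?_⟩
  · simp [hwy]
  · rw [(hm.F_eq y hy).wz, hwy]
    rfl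
  · rw [(hm.F_eq y hy).wzb, hwy]
    rfl

end Existence

/-! ### Horizontal lifts and the invariants of an immersion -/

section Invariants

open Complex Set Filter Topology

variable {c : SignType} {V : Set ℂ} {u : ℂ → ℝ} {φ ψ : ℂ → ℂ} {F G : ℂ → Amb c} {z : ℂ}

/-- The vector of the complexification with components `(a, b̄)` of type `(1, 0)` and `(0, 1)`. -/
def combine (a b : Amb c) : Fin (ambDim c) × Fin 2 → ℂ :=
  fun k => if k.2 = 0 then (1 / 2) * (a k.1 + conj (b k.1))
    else (-I / 2) * (a k.1 - conj (b k.1))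

lemma cx_eq_combine (Z : Amb c) : cx Z = combine Z Z := by
  ext k
  simp only [cx, combine]
  split_ifs
  · rw [add_conj]; push_cast; ring
  · rw [sub_conj]; push_cast; linear_combination ((Z k.1).im : ℂ) * I_mul_I

/-- The second argument enters conjugated, so its z- and z̄-derivatives change places. -/
lemma hasWir_combine {a a' b b' : Amb c} (hF : HasWir F a b z) (hG : HasWir G a' b' z)
    (k : Fin (ambDim c) × Fin 2) :
    HasWir (fun w => combine (F w) (G w) k) (combine a b' k) (combine b a' k) z := by
  simp only [combine]
  split_ifs
  · exact ((hF.apply k.1).add (hG.apply k.1).star).const_smul _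
  · exact ((hF.apply k.1).sub (hG.apply k.1).star).const_smul _

lemma vdz_combine {a a' b b' : Amb c} (hF : HasWir F a b z) (hG : HasWir G a' b' z) :
    vdz (fun w => combine (F w) (G w)) z = combine a b' :=
  funext fun k => (hasWir_combine hF hG k).wz

lemma vdzbar_combine {a a' b b' : Amb c} (hF : HasWir F a b z) (hG : HasWir G a' b' z) :
    vdzbar (fun w => combine (F w) (G w)) z = combine b a' :=
  funext fun k => (hasWir_combine hF hG k).wzb

/-- J acts as i on the (1, 0) part and as -i on the (0, 1) part, and the bilinear form pairs only
parts of opposite type. This translates the invariants into the Hermitian form. -/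
lemma cinner_combine (a b a' b' : Amb c) : cinner c (combine a b) (cJ (combine a' b')) =
    (I / 2) * (herm c a' b - herm c a b') := by
  simp only [cinner, herm, Fintype.sum_prod_type, Fin.sum_univ_two, combine, cJ,
    ← Finset.sum_sub_distrib, Finset.mul_sum]
  refine Finset.sum_congr rfl fun k _ => ?_
  simp only [Fin.isValue, one_ne_zero, if_true, if_false]
  ring

lemma vdz_congr {κ : Type} {A B : ℂ → κ → ℂ} (h : A =ᶠ[𝓝 z] B) : vdz A z = vdz B z :=
  funext fun k => wz_congr (F := fun w => A w k) (h.fun_comp fun v => v k)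

lemma vdzbar_congr {κ : Type} {A B : ℂ → κ → ℂ} (h : A =ᶠ[𝓝 z] B) : vdzbar A z = vdzbar B z :=
  funext fun k => wzb_congr (F := fun w => A w k) (h.fun_comp fun v => v k)

namespace IsLift

lemma vdz_cx (h : IsLift c V F) (hz : z ∈ V) :
    vdz (fun w => cx (F w)) z = combine (wz F z) (wzb F z) := by
  simp only [cx_eq_combine]
  exact vdz_combine (h.hasWir hz) (h.hasWir hz)

lemma vdz_vdz_cx (h : IsLift c V F) (hz : z ∈ V) :
    vdz (vdz fun w => cx (F w)) z = combine (wz (wz F) z) (wzb (wzb F) z) := by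
  rw [vdz_congr (B := fun w => combine (wz F w) (wzb F w))
    (by filter_upwards [h.isOpen.mem_nhds hz] with w hw using h.vdz_cx hw)]
  exact vdz_combine (h.hasWir_wz hz) (h.hasWir_wzb hz)

lemma vdzbar_vdz_cx (h : IsLift c V F) (hz : z ∈ V) :
    vdzbar (vdz fun w => cx (F w)) z = combine (wzb (wz F) z) (wzb (wz F) z) := by
  rw [vdzbar_congr (B := fun w => combine (wz F w) (wzb F w))
    (by filter_upwards [h.isOpen.mem_nhds hz] with w hw using h.vdz_cx hw),
    vdzbar_combine (h.hasWir_wz hz) (h.hasWir_wzb hz), h.wz_wzb hz]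

/-- The derivatives of `(F_z, F_z̄) = 0`. -/
lemma deriv_herm_wz_wzb (h : IsLift c V F) (hPQ : ∀ w ∈ V, herm c (wz F w) (wzb F w) = 0)
    (hz : z ∈ V) : herm c (wz (wz F) z) (wzb F z) + herm c (wz F z) (wzb (wzb F) z) = 0 ∧
      herm c (wzb (wz F) z) (wzb F z) + herm c (wz F z) (wzb (wz F) z) = 0 := by
  have h1 := (h.hasWir_wz hz).herm (h.hasWir_wzb hz)
  rw [h.wz_wzb hz] at h1
  refine h1.unique ((HasWir.const 0 z).congr_of_eventuallyEq ?_)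
  filter_upwards [h.isOpen.mem_nhds hz] with w hw using hPQ w hw

/-- `cinner_combine` gives (i/2) ((F_z, F_{z̄z̄}) - (F_{zz}, F_z̄)), and differentiating (F_z, F_z̄)
= 0 shows that the two products are opposite. The same argument with F_{zz̄} gives `mean_eq`. -/
lemma hopf_eq (h : IsLift c V F) (hPQ : ∀ w ∈ V, herm c (wz F w) (wzb F w) = 0) (hz : z ∈ V) :
    cinner c (vdz (vdz fun w => cx (F w)) z) (cJ (vdz (fun w => cx (F w)) z)) =
      -I * herm c (wz (wz F) z) (wzb F z) := by
  rw [h.vdz_vdz_cx hz, h.vdz_cx hz, cinner_combine]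
  linear_combination (I / 2) * (h.deriv_herm_wz_wzb hPQ hz).1

lemma mean_eq (h : IsLift c V F) (hPQ : ∀ w ∈ V, herm c (wz F w) (wzb F w) = 0) (hz : z ∈ V) :
    cinner c (vdzbar (vdz fun w => cx (F w)) z) (cJ (vdz (fun w => cx (F w)) z)) =
      -I * herm c (wzb (wz F) z) (wzb F z) := by
  rw [h.vdzbar_vdz_cx hz, h.vdz_cx hz, cinner_combine]
  linear_combination (I / 2) * (h.deriv_herm_wz_wzb hPQ hz).2

lemma hor_fderiv (h : IsLift c V F) (hF : IsHorizontal c V F) (hz : z ∈ V) (X : ℂ) :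
    hor c (F z) (fderiv ℝ F z X) = fderiv ℝ F z X :=
  hor_of_herm_eq_zero fun hc => (h.herm_fderiv_eq_zero_iff hc hz X).2 (hF hc z hz X)

/-- The frame of a horizontal conformal Lagrangian lift. -/
lemma isFrame (h : IsLift c V F) (hF : IsHorizontal c V F) (hz : z ∈ V) {r : ℝ} (hr : 0 < r)
    (hm : ∀ X Y : ℂ, pullMetric c F z X Y = 2 * r * (X * conj Y).re)
    (hk : ∀ X Y : ℂ, pullKaehler c F z X Y = 0) : IsFrame c r (F z) (wz F z) (wzb F z) := by
  -- The metric is the real part and the Kähler form, up to sign, the imaginary part of the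
  -- Hermitian product. Thus the product is real and known, and F_z, F_z̄ are evaluated on the basis
  -- 1, I.
  have key : ∀ X Y : ℂ, herm c (fderiv ℝ F z X) (fderiv ℝ F z Y) =
      ((2 * r * (X * conj Y).re : ℝ) : ℂ) := by
    intro X Y
    have h1 := hm X Y
    have h2 := hk X Y
    rw [pullMetric, h.hor_fderiv hF hz, h.hor_fderiv hF hz, rinner] at h1
    rw [pullKaehler, h.hor_fderiv hF hz, h.hor_fderiv hF hz, rinner, herm_smul_left] at h2
    refine Complex.ext (by rw [h1, ofReal_re]) ?_
    simpa using h2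
  have h11 := key 1 1
  have h12 := key 1 I
  have h21 := key I 1
  have h22 := key I I
  simp at h11 h12 h21 h22
  have h2 : conj (2 : ℂ) = 2 := map_ofNat _ 2
  refine ⟨hr, h.mem z hz, ?_, ?_, ?_, fun hc => ?_, fun hc => ?_⟩
  · simp only [wz, herm_smul_left, herm_smul_right, herm_sub_left, herm_sub_right, h11, h12, h21,
      h22]
    simp [h2]
    linear_combination (-(r : ℂ) / 2) * I_mul_I
  · simp only [wzb, herm_smul_left, herm_smul_right, herm_add_left, herm_add_right, h11, h12, h21,
      h22]
    simp [h2]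
    linear_combination (-(r : ℂ) / 2) * I_mul_I
  · simp only [wz, wzb, herm_smul_left, herm_smul_right, herm_add_right, herm_sub_left, h11, h12,
      h21, h22]
    simp [h2]
    linear_combination (r : ℂ) * I_mul_I
  all_goals
    have h1 := (h.herm_fderiv_eq_zero_iff hc hz 1).2 (hF hc z hz 1)
    have h2 := (h.herm_fderiv_eq_zero_iff hc hz I).2 (hF hc z hz I)
  · rw [wz, herm_smul_left, herm_sub_left, herm_smul_left, h1, h2]
    simp
  · rw [wzb, herm_smul_left, herm_add_left, herm_smul_left, h1, h2]
    simp

end IsLift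

namespace IsSolution

lemma of_horizontal (h : IsLift c V F) (hF : IsHorizontal c V F)
    (hm : ∀ z ∈ V, ∀ X Y : ℂ, pullMetric c F z X Y = 2 * Real.exp (u z) * (X * conj Y).re)
    (hk : ∀ z ∈ V, ∀ X Y : ℂ, pullKaehler c F z X Y = 0)
    (hφ : ∀ z ∈ V, φ z = (Real.exp (-u z) : ℂ) *
      cinner c (vdzbar (vdz fun w => cx (F w)) z) (cJ (vdz (fun w => cx (F w)) z)))
    (hψ : ∀ z ∈ V, ψ z =
      cinner c (vdz (vdz fun w => cx (F w)) z) (cJ (vdz (fun w => cx (F w)) z))) :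
    IsSolution c V u φ ψ F := by
  have hfr : ∀ z ∈ V, IsFrame c (Real.exp (u z)) (F z) (wz F z) (wzb F z) := fun z hz =>
    h.isFrame hF hz (Real.exp_pos _) (hm z hz) (hk z hz)
  have hPQ : ∀ w ∈ V, herm c (wz F w) (wzb F w) = 0 := fun w hw => (hfr w hw).PQ
  refine ⟨h, hfr, fun z hz => ?_, fun z hz => ?_⟩
  · rw [hψ z hz, h.hopf_eq hPQ hz]
    linear_combination (herm c (wz (wz F) z) (wzb F z)) * I_mul_I
  · rw [hφ z hz, h.mean_eq hPQ hz]
    linear_combination (herm c (wzb (wz F) z) (wzb F z)) * I_mul_I *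
      ((Real.exp (-u z) : ℝ) * (Real.exp (u z) : ℝ)) -
      herm c (wzb (wz F) z) (wzb F z) * exp_neg_mul (u z)

variable (h : IsSolution c V u φ ψ F)
include h

lemma isHorizontal : IsHorizontal c V F := fun hc z hz X => by
  rw [← h.herm_fderiv_eq_zero_iff hc hz, (h.hasWir hz).fderiv_apply, herm_add_left,
    herm_smul_left, herm_smul_left, (h.frame z hz).PF hc, (h.frame z hz).QF hc]
  simp

lemma herm_fderiv (hz : z ∈ V) (X Y : ℂ) : herm c (fderiv ℝ F z X) (fderiv ℝ F z Y) =
    ((2 * Real.exp (u z) * (X * conj Y).re : ℝ) : ℂ) := by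
  have hf := h.frame z hz
  have h1 : (((X * conj Y).re : ℝ) : ℂ) = (X * conj Y + conj X * Y) / 2 := by
    rw [re_eq_add_conj, map_mul, conj_conj]
  rw [(h.hasWir hz).fderiv_apply, (h.hasWir hz).fderiv_apply, ofReal_mul, h1]
  simp only [herm_add_left, herm_add_right, herm_smul_left, herm_smul_right, hf.PP, hf.QQ, hf.PQ,
    hf.QP, conj_conj]
  push_cast
  ring

lemma pullMetric_eq (hz : z ∈ V) (X Y : ℂ) :
    pullMetric c F z X Y = 2 * Real.exp (u z) * (X * conj Y).re := by
  rw [pullMetric, h.hor_fderiv h.isHorizontal hz, h.hor_fderiv h.isHorizontal hz, rinner,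
    h.herm_fderiv hz, ofReal_re]

lemma pullKaehler_eq (hz : z ∈ V) (X Y : ℂ) : pullKaehler c F z X Y = 0 := by
  rw [pullKaehler, h.hor_fderiv h.isHorizontal hz, h.hor_fderiv h.isHorizontal hz, rinner,
    herm_smul_left, h.herm_fderiv hz, I_mul_re, ofReal_im, neg_zero]

lemma phi_eq (hz : z ∈ V) : φ z = (Real.exp (-u z) : ℂ) *
    cinner c (vdzbar (vdz fun w => cx (F w)) z) (cJ (vdz (fun w => cx (F w)) z)) := by
  rw [h.mean_eq (fun w hw => (h.frame w hw).PQ) hz, h.mean z hz]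
  linear_combination (-φ z) * exp_neg_mul (u z) +
    (φ z * (Real.exp (u z) : ℂ) * (Real.exp (-u z) : ℝ)) * I_mul_I

lemma psi_eq (hz : z ∈ V) : ψ z =
    cinner c (vdz (vdz fun w => cx (F w)) z) (cJ (vdz (fun w => cx (F w)) z)) := by
  rw [h.hopf_eq (fun w hw => (h.frame w hw).PQ) hz, h.hopf z hz]
  linear_combination (ψ z) * I_mul_I

end IsSolution

end Invariants

/-! ### Existence and uniqueness of horizontal lifts -/

section HorizontalLifts

open Complex Set Filter Topology

set_option maxSynthPendingDepth 3

variable {c : SignType} {V : Set ℂ} {F G : ℂ → Amb c} {z : ℂ}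

/-- A closed form `a dz + b dz̄` on a ball has a primitive. -/
lemma exists_primitive {x : ℂ} {r : ℝ} {a b : ℂ → ℂ} (ha : ContDiffOn ℝ ∞ a (Metric.ball x r))
    (hb : ContDiffOn ℝ ∞ b (Metric.ball x r)) (hab : ∀ w ∈ Metric.ball x r, wzb a w = wz b w) :
    ∃ f : ℂ → ℂ, ContDiffOn ℝ ∞ f (Metric.ball x r) ∧
      ∀ w ∈ Metric.ball x r, HasWir f (a w) (b w) w := by
  have hO : IsOpen (Metric.ball x r) := Metric.isOpen_ball
  have hs : ContDiffOn ℝ ∞ (fun w => wir (a w) (b w)) (Metric.ball x r) :=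
    (wirCLM ℂ).contDiff.comp_contDiffOn (ha.prodMk hb)
  obtain ⟨f, hf⟩ := (convex_ball x r).exists_forall_hasFDerivAt_of_fderiv_symmetric hO
    (hs.differentiableOn (by simp)) (by
      intro w hw X Y
      have h1 : HasFDerivAt (fun w => wir (a w) (b w)) _ w :=
        (wirCLM ℂ).hasFDerivAt.comp w
          (HasFDerivAt.prodMk (ContDiffOn.hasWir hO ha hw) (ContDiffOn.hasWir hO hb hw))
      rw [h1.fderiv]
      change wir (wir _ _ X) (wir _ _ X) Y = wir (wir _ _ Y) (wir _ _ Y) X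
      simp only [wir_apply, smul_eq_mul, hab w hw]
      ring)
  refine ⟨f, (contDiffOn_infty_iff_fderiv_of_isOpen hO).2
    ⟨fun w hw => (hf w hw).differentiableAt.differentiableWithinAt,
      hs.congr fun w hw => (hf w hw).fderiv⟩, hf⟩

namespace IsLift

lemma hor_fderiv_eq (h : IsLift c V F) (hc : c ≠ 0) (hz : z ∈ V) (X : ℂ) :
    hor c (F z) (fderiv ℝ F z X) =
      fderiv ℝ F z X - (((c : ℝ) : ℂ) * herm c (fderiv ℝ F z X) (F z)) • F z := by
  have h1 := h.re_herm_fderiv hc hz X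
  have h2 : herm c (fderiv ℝ F z X) (F z) = (herm c (fderiv ℝ F z X) (F z)).im * I := by
    conv_lhs => rw [← re_add_im (herm c (fderiv ℝ F z X) (F z)), h1]
    simp
  have h3 : rinner c (fderiv ℝ F z X) (I • F z) = (herm c (fderiv ℝ F z X) (F z)).im := by
    rw [rinner, herm_smul_right]
    simp
  rw [hor, h3, real_smul_eq, smul_smul]
  conv_rhs => rw [h2]
  push_cast
  rw [mul_assoc]

/-- The Lagrangian condition says that the `(1, 0)` and `(0, 1)` derivatives have the same norm. -/
lemma herm_wz_eq_herm_wzb (h : IsLift c V F) (hc : c ≠ 0) (hz : z ∈ V)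
    (hk : pullKaehler c F z 1 I = 0) :
    herm c (wz F z) (wz F z) = herm c (wzb F z) (wzb F z) := by
  rw [pullKaehler, h.hor_fderiv_eq hc hz, h.hor_fderiv_eq hc hz, rinner, herm_smul_left, I_mul_re,
    neg_eq_zero] at hk
  have r1 := h.re_herm_fderiv hc hz 1
  have r2 := h.re_herm_fderiv hc hz I
  have hd1 : fderiv ℝ F z 1 = wz F z + wzb F z := by rw [(h.hasWir hz).fderiv_apply]; simp
  have hdI : fderiv ℝ F z I = I • (wz F z - wzb F z) := by
    rw [(h.hasWir hz).fderiv_apply, conj_I]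
    module
  generalize hA : fderiv ℝ F z 1 = A at *
  generalize hB : fderiv ℝ F z I = B at *
  have e1 : herm c (A - (((c : ℝ) : ℂ) * herm c A (F z)) • F z)
      (B - (((c : ℝ) : ℂ) * herm c B (F z)) • F z) =
      herm c A B - ((c : ℝ) : ℂ) * herm c A (F z) * conj (herm c B (F z)) := by
    simp only [herm_sub_left, herm_sub_right, herm_smul_left, herm_smul_right, h.mem z hz hc,
      map_mul, conj_ofReal, ← conj_herm B (F z)]
    linear_combination (((c : ℝ) : ℂ) * herm c A (F z) * conj (herm c B (F z))) *
      sign_sq_eq_one hc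
  -- Both (A, F) and (B, F) are imaginary, so passing to horizontal parts changes (A, B) only by a
  -- real number and leaves the Kähler form unchanged.
  have e2 : (((c : ℝ) : ℂ) * herm c A (F z) * conj (herm c B (F z))).im = 0 := by
    simp [r1, r2]
  rw [e1, sub_im, e2, sub_zero, hd1, hdI, herm_smul_right] at hk
  simp only [herm_add_left, herm_sub_right] at hk
  have e3 : (herm c (wz F z) (wzb F z)).re = (herm c (wzb F z) (wz F z)).re := by
    rw [← conj_herm, conj_re]
  have i1 := conj_eq_iff_im.1 (conj_herm (wz F z) (wz F z))
  have i2 := conj_eq_iff_im.1 (conj_herm (wzb F z) (wzb F z))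
  simp at hk
  exact Complex.ext (by linarith) (by rw [i1, i2])

/-- A lift of a Lagrangian immersion can locally be rotated to a horizontal one. -/
theorem exists_horizontal (h : IsLift c V F)
    (hk : ∀ w ∈ V, ∀ X Y : ℂ, pullKaehler c F w X Y = 0) (hz : z ∈ V) :
    ∃ (U : Set ℂ) (l : ℂ → ℂ), z ∈ U ∧ U ⊆ V ∧ (∀ w ∈ U, ‖l w‖ = 1 ∧ (c = 0 → l w = 1)) ∧
      IsLift c U (fun w => l w • F w) ∧ IsHorizontal c U (fun w => l w • F w) := by
  by_cases hc : c = 0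
  · refine ⟨V, fun _ => 1, hz, subset_rfl, by simp, ?_, fun h' => absurd hc h'⟩
    simpa using h
  obtain ⟨r, hr, hrV⟩ := Metric.isOpen_iff.1 h.isOpen z hz
  have hB := h.mono (Metric.isOpen_ball (x := z) (ε := r)) hrV
  have hP := contDiffOn_wz hB.isOpen hB.smooth
  have hQ := contDiffOn_wzb hB.isOpen hB.smooth
  -- For l = e^m, horizontality of l F means dm = -c (dF, F). The mixed derivatives of this form
  -- differ only by (F_z, F_z) against (F_z̄, F_z̄), so it is closed exactly when these are equal,
  -- as the Lagrangian condition ensures.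
  obtain ⟨f, hfs, hf⟩ := exists_primitive
    (a := fun w => -((c : ℝ) : ℂ) * herm c (wz F w) (F w))
    (b := fun w => -((c : ℝ) : ℂ) * herm c (wzb F w) (F w))
    (contDiffOn_const.mul (contDiffOn_herm hP hB.smooth))
    (contDiffOn_const.mul (contDiffOn_herm hQ hB.smooth)) (fun w hw => by
      have h1 := ((hB.hasWir_wz hw).herm (hB.hasWir hw)).const_smul (-((c : ℝ) : ℂ))
      have h2 := ((hB.hasWir_wzb hw).herm (hB.hasWir hw)).const_smul (-((c : ℝ) : ℂ))
      have h3 := h1.wzb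
      have h4 := h2.wz
      simp only [smul_eq_mul] at h3 h4
      rw [h3, h4, h.wz_wzb (hrV hw),
        h.herm_wz_eq_herm_wzb hc (hrV hw) (hk w (hrV hw) 1 I)])
  -- The imaginary part of the primitive, times i, makes e^m unimodular. The form itself is
  -- imaginary-valued, so m has the same differential as f.
  set m : ℂ → ℂ := fun w => (1 / 2 : ℂ) * (f w - conj (f w)) with hm_def
  have hm : ∀ w ∈ Metric.ball z r, HasWir m (-((c : ℝ) : ℂ) * herm c (wz F w) (F w))
      (-((c : ℝ) : ℂ) * herm c (wzb F w) (F w)) w := fun w hw => by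
    have h1 := ((hf w hw).sub (hf w hw).star).const_smul (1 / 2 : ℂ)
    have h2 := h.wz_herm_add hc (hrV hw)
    have h3 : conj (herm c (wz F w) (F w)) = -herm c (wzb F w) (F w) := by
      rw [eq_neg_of_add_eq_zero_left h2, map_neg, conj_herm]
    have h4 : conj (herm c (wzb F w) (F w)) = -herm c (wz F w) (F w) := by
      rw [← neg_eq_iff_eq_neg.2 h3, map_neg, conj_conj]
    refine h1.congr_deriv ?_ ?_
    · simp only [map_mul, map_neg, conj_ofReal, h4, smul_eq_mul]
      ring
    · simp only [map_mul, map_neg, conj_ofReal, h3, smul_eq_mul]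
      ring
  have hms : ContDiffOn ℝ ∞ m (Metric.ball z r) :=
    contDiffOn_const.mul (hfs.sub (contDiffOn_conj hfs))
  have hnorm : ∀ w, ‖Complex.exp (m w)‖ = 1 := fun w => by
    rw [norm_exp]
    simp [hm_def]
  have hl : IsLift c (Metric.ball z r) (fun w => Complex.exp (m w) • F w) :=
    ⟨hB.isOpen, (hms.cexp).smul hB.smooth, fun w hw hc => by
      rw [herm_smul_left, herm_smul_right, ← mul_assoc, mul_conj_eq_one (hnorm w), one_mul,
        hB.mem w hw hc]⟩
  refine ⟨Metric.ball z r, fun w => Complex.exp (m w), Metric.mem_ball_self hr, hrV,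
    fun w _ => ⟨hnorm w, fun h' => absurd h' hc⟩, hl, fun _ w hw X => ?_⟩
  have hsq := sign_sq_eq_one hc
  rw [← hl.herm_fderiv_eq_zero_iff hc hw, ((hm w hw).exp.smul (hB.hasWir hw)).fderiv_apply]
  simp only [herm_add_left, herm_smul_left, herm_smul_right, hB.mem w hw hc]
  linear_combination (-(X * Complex.exp (m w) * herm c (wz F w) (F w) +
    conj X * Complex.exp (m w) * herm c (wzb F w) (F w)) * conj (Complex.exp (m w))) * hsq

/-- Two lifts of the same map have the same pullbacks of the metric and of the Kähler form. -/
lemma pull_eq {V₁ V₂ : Set ℂ} (h₁ : IsLift c V₁ F) (h₂ : IsLift c V₂ G)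
    (h : ∀ w ∈ V₁ ∩ V₂, ∃ l : ℂ, ‖l‖ = 1 ∧ (c = 0 → l = 1) ∧ G w = l • F w)
    (hz : z ∈ V₁ ∩ V₂) (X Y : ℂ) : pullMetric c G z X Y = pullMetric c F z X Y ∧
      pullKaehler c G z X Y = pullKaehler c F z X Y := by
  have hO := h₁.isOpen.inter h₂.isOpen
  have h₁' := h₁.mono hO inter_subset_left
  obtain ⟨l, hls, hl⟩ := exists_factor h₁'.smooth (h₂.mono hO inter_subset_right).smooth h₁'.mem h
  have e := fun X => hor_fderiv_smul hO h₁'.smooth hls h₁'.mem hl hz X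
  rw [pullMetric, pullKaehler, e, e, smul_comm I, rinner_smul_smul (hl z hz).1,
    rinner_smul_smul (hl z hz).1]
  exact ⟨rfl, rfl⟩

/-- Horizontal lifts of the same map locally differ by a constant factor. -/
theorem eventuallyEq_smul {V₁ V₂ : Set ℂ} (h₁ : IsLift c V₁ F) (h₂ : IsLift c V₂ G)
    (hF : IsHorizontal c V₁ F) (hG : IsHorizontal c V₂ G)
    (h : ∀ w ∈ V₁ ∩ V₂, ∃ l : ℂ, ‖l‖ = 1 ∧ (c = 0 → l = 1) ∧ G w = l • F w)
    (hz : z ∈ V₁ ∩ V₂) : ∃ l : ℂ, ‖l‖ = 1 ∧ (c = 0 → l = 1) ∧ G =ᶠ[𝓝 z] fun w => l • F w := by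
  have hO := h₁.isOpen.inter h₂.isOpen
  have h₁' := h₁.mono hO inter_subset_left
  obtain ⟨l, hls, hl⟩ := exists_factor h₁'.smooth (h₂.mono hO inter_subset_right).smooth h₁'.mem h
  refine ⟨l z, (hl z hz).1, (hl z hz).2.1, ?_⟩
  by_cases hc : c = 0
  · filter_upwards [hO.mem_nhds hz] with w hw
    rw [(hl w hw).2.2, (hl w hw).2.1 hc, (hl z hz).2.1 hc]
  obtain ⟨r, hr, hrV⟩ := Metric.isOpen_iff.1 hO z hz
  -- From dG = dl · F + l dF with both lifts horizontal, the product with F leaves dl · c = 0, and c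
  -- ≠ 0.
  have hd : ∀ w ∈ Metric.ball z r, fderiv ℝ l w = 0 := by
    intro w hw
    have hw' := hrV hw
    have hlw := ContDiffOn.hasWir hO hls hw'
    have h3 := (hlw.smul (h₁'.hasWir hw')).congr_of_eventuallyEq
      (show G =ᶠ[𝓝 w] _ by filter_upwards [hO.mem_nhds hw'] with v hv using (hl v hv).2.2)
    ext1 X
    have h4 := (h₂.herm_fderiv_eq_zero_iff hc hw'.2 X).2 (hG hc w hw'.2 X)
    have h5 := (h₁.herm_fderiv_eq_zero_iff hc hw'.1 X).2 (hF hc w hw'.1 X)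
    have hlne : conj (l w) ≠ 0 := fun h0 => by
      have := mul_conj_eq_one (hl w hw').1
      rw [h0, mul_zero] at this
      exact zero_ne_one this
    have hcne : ((c : ℝ) : ℂ) ≠ 0 := fun h0 => by
      have := sign_sq_eq_one hc
      rw [h0, mul_zero] at this
      exact zero_ne_one this
    have h6 : fderiv ℝ G w X = fderiv ℝ l w X • F w + l w • fderiv ℝ F w X := by
      rw [h3.fderiv_apply, hlw.fderiv_apply, (h₁'.hasWir hw').fderiv_apply]
      simp only [smul_eq_mul]
      module
    rw [h6, (hl w hw').2.2, herm_smul_right, herm_add_left, herm_smul_left, herm_smul_left, h5,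
      h₁.mem w hw'.1 hc, mul_zero, add_zero] at h4
    simpa [hlne, hcne] using h4
  have hconst : ∀ w ∈ Metric.ball z r, l w = l z := fun w hw =>
    (convex_ball z r).is_const_of_fderivWithin_eq_zero
      (fun v hv => ((ContDiffOn.hasWir hO hls (hrV hv)).differentiableAt).differentiableWithinAt)
      (fun v hv => by rw [fderivWithin_of_isOpen Metric.isOpen_ball hv, hd v hv]) hw
      (Metric.mem_ball_self hr)
  filter_upwards [Metric.ball_mem_nhds z hr] with w hw
  rw [(hl w (hrV hw)).2.2, hconst w hw]

end IsLift

end HorizontalLifts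

/-! ### Changes of lift, of ambient frame and of coordinate -/

section Operations

open Complex Set Filter Topology

set_option maxSynthPendingDepth 3

variable {c : SignType} {V : Set ℂ} {u u' : ℂ → ℝ} {φ ψ φ' ψ' : ℂ → ℂ} {F G : ℂ → Amb c} {z : ℂ}

namespace IsSolution

lemma congr_data (h : IsSolution c V u φ ψ F) (hu : EqOn u' u V) (hφ : EqOn φ' φ V)
    (hψ : EqOn ψ' ψ V) : IsSolution c V u' φ' ψ' F :=
  ⟨h.toIsLift, fun z hz => by rw [hu hz]; exact h.frame z hz,
    fun z hz => by rw [hψ hz]; exact h.hopf z hz,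
    fun z hz => by rw [hφ hz, hu hz]; exact h.mean z hz⟩

/-- A solution can be recognised from explicit formulas for its first and second derivatives. T and
R stand for F_{zz} and F_{zz̄}; F_{z̄z̄} does not enter the conditions. -/
lemma of_derivatives (hV : IsOpen V) (hF : ContDiffOn ℝ ∞ F V) {P Q R T : ℂ → Amb c}
    (hd : ∀ w ∈ V, HasWir F (P w) (Q w) w) (hP : ∀ w ∈ V, HasWir P (T w) (R w) w)
    (hfr : ∀ w ∈ V, IsFrame c (Real.exp (u w)) (F w) (P w) (Q w))
    (hT : ∀ w ∈ V, herm c (T w) (Q w) = I * ψ w)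
    (hR : ∀ w ∈ V, herm c (R w) (Q w) = I * φ w * Real.exp (u w)) : IsSolution c V u φ ψ F := by
  have hP' : ∀ w ∈ V, HasWir (wz F) (T w) (R w) w := fun w hw =>
    (hP w hw).congr_of_eventuallyEq (by
      filter_upwards [hV.mem_nhds hw] with v hv using (hd v hv).wz)
  refine ⟨⟨hV, hF, fun z hz => (hfr z hz).mem⟩, fun z hz => ?_, fun z hz => ?_, fun z hz => ?_⟩
  · rw [(hd z hz).wz, (hd z hz).wzb]
    exact hfr z hz
  · rw [(hP' z hz).wz, (hd z hz).wzb, hT z hz]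
  · rw [(hP' z hz).wzb, (hd z hz).wzb, hR z hz]

lemma smul (h : IsSolution c V u φ ψ F) {l : ℂ} (hl : ‖l‖ = 1) :
    IsSolution c V u φ ψ (fun w => l • F w) := by
  have hll := mul_conj_eq_one hl
  have e : ∀ X Y : Amb c, herm c (l • X) (l • Y) = herm c X Y := fun X Y => by
    rw [herm_smul_left, herm_smul_right, ← mul_assoc, hll, one_mul]
  refine of_derivatives h.isOpen (h.smooth.const_smul l)
    (fun w hw => (h.hasWir hw).const_smul l) (fun w hw => (h.hasWir_wz hw).const_smul l)
    (fun w hw => ?_) (fun w hw => ?_) (fun w hw => ?_)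
  · have hf := h.frame w hw
    exact ⟨hf.pos, fun hc => by rw [e, hf.mem hc], by rw [e, hf.PP], by rw [e, hf.QQ],
      by rw [e, hf.PQ], fun hc => by rw [e, hf.PF hc], fun hc => by rw [e, hf.QF hc]⟩
  · rw [e, h.hopf w hw]
  · rw [e, h.mean w hw]

lemma congr_lift (h : IsSolution c V u φ ψ F) (hG : EqOn G F V) : IsSolution c V u φ ψ G :=
  of_derivatives h.isOpen (h.smooth.congr hG)
    (fun w hw => (h.hasWir hw).congr_of_eventuallyEq (hG.eventuallyEq_of_mem (h.isOpen.mem_nhds hw)))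
    (fun w hw => h.hasWir_wz hw) (fun w hw => by rw [hG hw]; exact h.frame w hw) h.hopf h.mean

/-- The translation disappears on differentiation and the linear part preserves the Hermitian form,
so all invariants are unchanged. The explicit derivatives are kept to compare frames in the
uniqueness proof. -/
lemma motion (h : IsSolution c V u φ ψ F) {e : ℝ} {F₁ P₁ Q₁ F₂ P₂ Q₂ : Amb c}
    (h₁ : IsFrame c e F₁ P₁ Q₁) (h₂ : IsFrame c e F₂ P₂ Q₂) :
    IsSolution c V u φ ψ (fun w => IsFrame.motion c e F₁ P₁ Q₁ F₂ P₂ Q₂ (F w)) ∧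
      ∀ z ∈ V, HasWir (fun w => IsFrame.motion c e F₁ P₁ Q₁ F₂ P₂ Q₂ (F w))
        (IsFrame.transition c e F₁ P₁ Q₁ F₂ P₂ Q₂ (wz F z))
        (IsFrame.transition c e F₁ P₁ Q₁ F₂ P₂ Q₂ (wzb F z)) z := by
  have hd : ∀ z ∈ V, HasWir (fun w => IsFrame.motion c e F₁ P₁ Q₁ F₂ P₂ Q₂ (F w))
        (IsFrame.transition c e F₁ P₁ Q₁ F₂ P₂ Q₂ (wz F z))
        (IsFrame.transition c e F₁ P₁ Q₁ F₂ P₂ Q₂ (wzb F z)) z := fun z hz => by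
    have h1 := (((h.hasWir hz).sub (HasWir.const F₁ z)).clm_comp
      (IsFrame.transitionCLM c e F₁ P₁ Q₁ F₂ P₂ Q₂)).add (HasWir.const F₂ z)
    simp only [sub_zero, add_zero] at h1
    exact h1
  refine ⟨of_derivatives h.isOpen (IsFrame.contDiff_motion.comp_contDiffOn h.smooth) hd
    (fun w hw => (h.hasWir_wz hw).clm_comp (IsFrame.transitionCLM c e F₁ P₁ Q₁ F₂ P₂ Q₂))
    (fun w hw => ?_) (fun w hw => ?_) (fun w hw => ?_), hd⟩
  · have hf := h.frame w hw
    refine ⟨hf.pos, h₁.motion_mem h₂ hf.mem, ?_, ?_, ?_, fun hc => ?_, fun hc => ?_⟩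
    · rw [h₁.herm_transition h₂, hf.PP]
    · rw [h₁.herm_transition h₂, hf.QQ]
    · rw [h₁.herm_transition h₂, hf.PQ]
    · rw [h₁.motion_eq hc, h₁.herm_transition h₂, hf.PF hc]
    · rw [h₁.motion_eq hc, h₁.herm_transition h₂, hf.QF hc]
  · exact (h₁.herm_transition h₂ _ _).trans (h.hopf w hw)
  · exact (h₁.herm_transition h₂ _ _).trans (h.mean w hw)

/-- Change of the complex coordinate. -/
lemma comp_holomorphic (h : IsSolution c V u φ ψ F) {W : Set ℂ} (hW : IsOpen W) {t : ℂ → ℂ}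
    (ht : DifferentiableOn ℂ t W) (hWV : MapsTo t W V)
    (hu : ∀ w ∈ W, Real.exp (u' w) = Real.exp (u (t w)) * ‖deriv t w‖ ^ 2)
    (hφ : ∀ w ∈ W, φ' w = φ (t w) * deriv t w)
    (hψ : ∀ w ∈ W, ψ' w = ψ (t w) * deriv t w ^ 3) :
    IsSolution c W u' φ' ψ' (fun w => F (t w)) := by
  have ht' : ∀ w ∈ W, HasDerivAt t (deriv t w) w := fun w hw =>
    (ht.differentiableAt (hW.mem_nhds hw)).hasDerivAt
  have ht'' : ∀ w ∈ W, HasDerivAt (deriv t) (deriv (deriv t) w) w := fun w hw =>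
    ((ht.deriv hW).differentiableAt (hW.mem_nhds hw)).hasDerivAt
  have hts : ContDiffOn ℝ ∞ t W := (ht.contDiffOn hW (n := ∞)).restrict_scalars ℝ
  have hnorm : ∀ w, deriv t w * conj (deriv t w) = ((‖deriv t w‖ ^ 2 : ℝ) : ℂ) := fun w => by
    rw [mul_conj, normSq_eq_norm_sq]
  refine of_derivatives hW (h.smooth.comp hts hWV)
    (fun w hw => (h.hasWir (hWV hw)).comp_holomorphic (ht' w hw))
    (fun w hw => (HasWir.of_hasDerivAt (ht'' w hw)).smul
      ((h.hasWir_wz (hWV hw)).comp_holomorphic (ht' w hw)))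
    (fun w hw => ?_) (fun w hw => ?_) (fun w hw => ?_)
  · have hf := h.frame (t w) (hWV hw)
    refine ⟨Real.exp_pos _, hf.mem, ?_, ?_, ?_, fun hc => ?_, fun hc => ?_⟩
    · rw [herm_smul_left, herm_smul_right, hf.PP, hu w hw, ofReal_mul, ← hnorm]
      ring
    · rw [herm_smul_left, herm_smul_right, hf.QQ, hu w hw, ofReal_mul, ← hnorm, conj_conj]
      ring
    · rw [herm_smul_left, herm_smul_right, hf.PQ]
      ring
    · rw [herm_smul_left, hf.PF hc, mul_zero]
    · rw [herm_smul_left, hf.QF hc, mul_zero]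
  -- The second derivative of F ∘ t contains t'' F_z, which is orthogonal to F_z̄; what remains is
  -- t'² F_{zz} against t̄' F_z̄, giving the factor t'³ of a cubic differential.
  · rw [herm_add_left, herm_smul_left, herm_smul_left, herm_smul_left, herm_smul_right,
      herm_smul_right, conj_conj, h.hopf _ (hWV hw), (h.frame _ (hWV hw)).PQ, hψ w hw]
    ring
  · rw [herm_add_left, herm_smul_left, herm_smul_left, herm_smul_left, herm_smul_right,
      herm_smul_right, conj_conj, h.mean _ (hWV hw), (h.frame _ (hWV hw)).PQ, hφ w hw, hu w hw,
      ofReal_mul, ← hnorm]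
    ring

/-- Solutions over the same map have the same data. -/
lemma data_unique {V₁ V₂ : Set ℂ} (h₁ : IsSolution c V₁ u φ ψ F) (h₂ : IsSolution c V₂ u' φ' ψ' G)
    (h : ∀ w ∈ V₁ ∩ V₂, ∃ l : ℂ, ‖l‖ = 1 ∧ (c = 0 → l = 1) ∧ G w = l • F w)
    (hz : z ∈ V₁ ∩ V₂) : u z = u' z ∧ φ z = φ' z ∧ ψ z = ψ' z := by
  obtain ⟨l, hl, -, hG⟩ := h₁.eventuallyEq_smul h₂.toIsLift h₁.isHorizontal h₂.isHorizontal h hz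
  have h₃ := h₁.smul hl
  have hd : (fun w => wz G w) =ᶠ[𝓝 z] fun w => wz (fun v => l • F v) w := by
    filter_upwards [hG.eventuallyEq_nhds] with w hw using wz_congr hw
  have e1 := wz_congr hG
  have e2 := wzb_congr hG
  have e3 := wz_congr hd
  have e4 := wzb_congr hd
  have f1 := (h₂.frame z hz.2).PP
  have f2 := h₂.hopf z hz.2
  have f3 := h₂.mean z hz.2
  have hu : u z = u' z := by
    rw [e1, (h₃.frame z hz.1).PP, ofReal_inj] at f1
    exact Real.exp_injective f1
  refine ⟨hu, ?_, ?_⟩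
  · rw [e2, e4, h₃.mean z hz.1, hu] at f3
    exact mul_left_cancel₀ I_ne_zero (mul_right_cancel₀ (exp_ne_zero _) f3)
  · rw [e2, e3, h₃.hopf z hz.1] at f2
    exact mul_left_cancel₀ I_ne_zero f2

end IsSolution

end Operations

/-! ### Coordinate changes and pullbacks of differentials -/

section Coordinates

open Complex Set Filter Topology

variable {S S' S'' : Type*} [TopologicalSpace S] [TopologicalSpace S'] [TopologicalSpace S'']

/-- The map `p` in local coordinates. -/
def coordMap (e : OpenPartialHomeomorph S ℂ) (p : S' → S) (e' : OpenPartialHomeomorph S' ℂ) :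
    ℂ → ℂ := fun w => e (p (e'.symm w))

/-- The domain of the coordinate expression of `p`. -/
def coordDomain (e : OpenPartialHomeomorph S ℂ) (p : S' → S) (e' : OpenPartialHomeomorph S' ℂ) :
    Set ℂ := e'.target ∩ e'.symm ⁻¹' (p ⁻¹' e.source)

variable {e : OpenPartialHomeomorph S ℂ} {e' : OpenPartialHomeomorph S' ℂ}
  {e'' : OpenPartialHomeomorph S'' ℂ} {p : S' → S} {q : S'' → S'} {z : ℂ}

lemma isOpen_coordDomain (hp : Continuous p) : IsOpen (coordDomain e p e') :=
  e'.symm.isOpen_inter_preimage (e.open_source.preimage hp)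

lemma mapsTo_coordMap : MapsTo (coordMap e p e') (coordDomain e p e') e.target :=
  fun _ hz => e.map_source hz.2

lemma coordMap_comp_apply (hz : z ∈ coordDomain e' q e'') :
    coordMap e p e' (coordMap e' q e'' z) = coordMap e (p ∘ q) e'' z := by
  simp only [coordMap, Function.comp_apply]
  rw [e'.left_inv hz.2]

lemma coordMap_mem (hz : z ∈ coordDomain e' q e'') (hz' : z ∈ coordDomain e (p ∘ q) e'') :
    coordMap e' q e'' z ∈ coordDomain e p e' := by
  refine ⟨mapsTo_coordMap hz, ?_⟩
  simp only [mem_preimage, coordMap]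
  rw [e'.left_inv hz.2]
  exact hz'.2

lemma deriv_coordMap_self {e : OpenPartialHomeomorph S ℂ} (hz : z ∈ e.target) :
    deriv (coordMap e id e) z = 1 := by
  have h : coordMap e id e =ᶠ[𝓝 z] id := by
    filter_upwards [e.open_target.mem_nhds hz] with w hw using e.right_inv hw
  rw [h.deriv_eq, deriv_id]

lemma coordMap_lift (h : ∀ y ∈ e'.source, p y ∈ e.source ∧ e' y = e (p y)) (hz : z ∈ e'.target) :
    z ∈ coordDomain e p e' ∧ coordMap e p e' z = z ∧ deriv (coordMap e p e') z = 1 := by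
  have h1 : ∀ w ∈ e'.target, coordMap e p e' w = w := fun w hw => by
    rw [coordMap, ← (h _ (e'.map_target hw)).2, e'.right_inv hw]
  have h2 : coordMap e p e' =ᶠ[𝓝 z] id := by
    filter_upwards [e'.open_target.mem_nhds hz] with w hw using h1 w hw
  exact ⟨⟨hz, (h _ (e'.map_target hz)).1⟩, h1 z hz, by rw [h2.deriv_eq, deriv_id]⟩

variable [ChartedSpace ℂ S] [ChartedSpace ℂ S'] [ChartedSpace ℂ S'']

lemma differentiableOn_coordMap (he : IsCoord e) (he' : IsCoord e')
    (hp : ContMDiff 𝓘(ℂ) 𝓘(ℂ) ω p) : DifferentiableOn ℂ (coordMap e p e') (coordDomain e p e') := by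
  have h1 : ContMDiffOn 𝓘(ℂ) 𝓘(ℂ) ω (coordMap e p e') (coordDomain e p e') :=
    (contMDiffOn_of_mem_maximalAtlas he).comp
      ((hp.contMDiffOn (s := univ)).comp
        ((contMDiffOn_symm_of_mem_maximalAtlas he').mono inter_subset_left) fun _ _ => trivial)
      fun _ hz => hz.2
  exact h1.contDiffOn.differentiableOn (by simp)

lemma deriv_coordMap_comp (he : IsCoord e) (he' : IsCoord e') (he'' : IsCoord e'')
    (hp : ContMDiff 𝓘(ℂ) 𝓘(ℂ) ω p) (hq : ContMDiff 𝓘(ℂ) 𝓘(ℂ) ω q)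
    (hz : z ∈ coordDomain e' q e'') (hz' : z ∈ coordDomain e (p ∘ q) e'') :
    deriv (coordMap e (p ∘ q) e'') z =
      deriv (coordMap e p e') (coordMap e' q e'' z) * deriv (coordMap e' q e'') z := by
  have h1 := ((differentiableOn_coordMap he he' hp).differentiableAt
    ((isOpen_coordDomain hp.continuous).mem_nhds (coordMap_mem hz hz'))).hasDerivAt
  have h2 := ((differentiableOn_coordMap he' he'' hq).differentiableAt
    ((isOpen_coordDomain hq.continuous).mem_nhds hz)).hasDerivAt
  have h3 : coordMap e (p ∘ q) e'' =ᶠ[𝓝 z] coordMap e p e' ∘ coordMap e' q e'' := by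
    filter_upwards [(isOpen_coordDomain (e := e') (e' := e'') hq.continuous).mem_nhds hz] with w hw
    exact (coordMap_comp_apply hw).symm
  exact ((h1.comp z h2).congr_of_eventuallyEq h3).deriv

/-- The transition map has the reverse transition as inverse, and by the chain rule the two
derivatives multiply to one. -/
lemma deriv_coordMap_id_ne_zero {e₁ e₂ : OpenPartialHomeomorph S ℂ} (h₁ : IsCoord e₁)
    (h₂ : IsCoord e₂) (hz : z ∈ coordDomain e₁ id e₂) : deriv (coordMap e₁ id e₂) z ≠ 0 := by
  have h := deriv_coordMap_comp (p := id) (q := id) h₂ h₁ h₂ contMDiff_id contMDiff_id hz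
    ⟨hz.1, e₂.map_target hz.1⟩
  intro h0
  rw [Function.comp_id, deriv_coordMap_self hz.1, h0, mul_zero] at h
  exact one_ne_zero h

/-- A local biholomorphism transports coordinates. -/
lemma exists_coord_lift [IsManifold 𝓘(ℂ) ω S'] (he : IsCoord e)
    (hp : IsLocalDiffeomorph 𝓘(ℂ) 𝓘(ℂ) ω p) {x : S'} (hx : p x ∈ e.source) :
    ∃ e' : OpenPartialHomeomorph S' ℂ, IsCoord e' ∧ x ∈ e'.source ∧ e'.target ⊆ e.target ∧
      ∀ y ∈ e'.source, p y ∈ e.source ∧ e' y = e (p y) := by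
  obtain ⟨Φ, hxΦ, hΦ⟩ := hp x
  have hsrc : ∀ y ∈ (Φ.toOpenPartialHomeomorph.trans e).source, y ∈ Φ.source ∧ p y ∈ e.source := by
    intro y hy
    rw [OpenPartialHomeomorph.trans_source] at hy
    refine ⟨hy.1, ?_⟩
    rw [hΦ hy.1]
    exact hy.2
  refine ⟨Φ.toOpenPartialHomeomorph.trans e, ?_, ?_, ?_, fun y hy => ⟨(hsrc y hy).2, ?_⟩⟩
  · refine (IsManifold.mem_maximalAtlas_iff_contMDiffOn _).2 ⟨?_, ?_⟩
    · refine (contMDiffOn_of_mem_maximalAtlas he).comp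
        (Φ.contMDiffOn_toFun.mono fun y hy => (hsrc y hy).1) fun y hy => ?_
      rw [OpenPartialHomeomorph.trans_source] at hy
      exact hy.2
    · refine Φ.contMDiffOn_invFun.comp
        ((contMDiffOn_symm_of_mem_maximalAtlas he).mono fun w hw => ?_) fun w hw => ?_
      · rw [OpenPartialHomeomorph.trans_target] at hw
        exact hw.1
      · rw [OpenPartialHomeomorph.trans_target] at hw
        exact hw.2
  · rw [OpenPartialHomeomorph.trans_source]
    exact ⟨hxΦ, by rw [hΦ hxΦ] at hx; exact hx⟩
  · rw [OpenPartialHomeomorph.trans_target]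
    exact inter_subset_left
  · rw [hΦ (hsrc y hy).1]
    rfl

/-- In a coordinate lifted through p the map p becomes the identity, so its expression in any other
coordinate is a transition map. -/
lemma deriv_coordMap_ne_zero [IsManifold 𝓘(ℂ) ω S'] (he : IsCoord e) (he' : IsCoord e')
    (hp : IsLocalDiffeomorph 𝓘(ℂ) 𝓘(ℂ) ω p) (hz : z ∈ coordDomain e p e') :
    deriv (coordMap e p e') z ≠ 0 := by
  obtain ⟨e₁, he₁, hx, -, h₁⟩ := exists_coord_lift he hp (x := e'.symm z) hz.2
  have hz₁ : z ∈ coordDomain e₁ id e' := ⟨hz.1, hx⟩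
  have h := deriv_coordMap_comp (p := p) (q := id) he he₁ he' hp.contMDiff contMDiff_id hz₁ hz
  rw [Function.comp_id, (coordMap_lift h₁ (mapsTo_coordMap hz₁)).2.2, one_mul] at h
  rw [h]
  exact deriv_coordMap_id_ne_zero he₁ he' hz₁

/-- The coefficients `b` are obtained from `a` by a coordinate change with derivative `d`. -/
def Transforms (a b : ℝ × ℂ × ℂ) (d : ℂ) : Prop :=
  Real.exp b.1 = Real.exp a.1 * ‖d‖ ^ 2 ∧ b.2.1 = a.2.1 * d ∧ b.2.2 = a.2.2 * d ^ 3

namespace Transforms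

variable {a b b' : ℝ × ℂ × ℂ} {d d' : ℂ}

lemma trans (h : Transforms a b d) (h' : Transforms b b' d') : Transforms a b' (d * d') :=
  ⟨by rw [h'.1, h.1, norm_mul]; ring, by rw [h'.2.1, h.2.1]; ring,
    by rw [h'.2.2, h.2.2]; ring⟩

lemma of_mul (h : Transforms a b d) (h' : Transforms a b' (d * d')) : Transforms b b' d' :=
  ⟨by rw [h'.1, h.1, norm_mul]; ring, by rw [h'.2.1, h.2.1]; ring,
    by rw [h'.2.2, h.2.2]; ring⟩

lemma eq_of_one (h : Transforms a b 1) : b = a := by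
  obtain ⟨h1, h2, h3⟩ := h
  simp only [norm_one, one_pow, mul_one] at h1 h2 h3
  exact Prod.ext (Real.exp_injective h1) (Prod.ext h2 h3)

end Transforms

/-- The coefficients at a point. -/
def Coefficients.val (D : Coefficients S) (e : OpenPartialHomeomorph S ℂ) (z : ℂ) : ℝ × ℂ × ℂ :=
  (D.u e z, D.phi e z, D.psi e z)

lemma isPullback_iff {D : Coefficients S} {D' : Coefficients S'} : IsPullback p D D' ↔
    ∀ (e : OpenPartialHomeomorph S ℂ) (e' : OpenPartialHomeomorph S' ℂ), IsCoord e → IsCoord e' →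
      ∀ z ∈ coordDomain e p e', Transforms (D.val e (coordMap e p e' z)) (D'.val e' z)
        (deriv (coordMap e p e') z) :=
  ⟨fun h e e' he he' z hz => h e e' he he' z hz.1 hz.2,
    fun h e e' he he' z hz hz' => h e e' he he' z ⟨hz, hz'⟩⟩

/-- Pullback of coefficients. -/
def Coefficients.pullback (p : S' → S) (D : Coefficients S) : Coefficients S' where
  u e' z := D.u (chartAt ℂ (p (e'.symm z))) (coordMap (chartAt ℂ (p (e'.symm z))) p e' z) +
    Real.log (‖deriv (coordMap (chartAt ℂ (p (e'.symm z))) p e') z‖ ^ 2)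
  phi e' z := D.phi (chartAt ℂ (p (e'.symm z))) (coordMap (chartAt ℂ (p (e'.symm z))) p e' z) *
    deriv (coordMap (chartAt ℂ (p (e'.symm z))) p e') z
  psi e' z := D.psi (chartAt ℂ (p (e'.symm z))) (coordMap (chartAt ℂ (p (e'.symm z))) p e' z) *
    deriv (coordMap (chartAt ℂ (p (e'.symm z))) p e') z ^ 3

variable [IsManifold 𝓘(ℂ) ω S]

lemma isCoord_chartAt (x : S) : IsCoord (chartAt ℂ x) := IsManifold.chart_mem_maximalAtlas x

/-- The definition uses one preferred chart downstairs at each point. The transformation law of D,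
combined with the chain rule, extends the formula to every chart. -/
lemma isPullback_pullback [IsManifold 𝓘(ℂ) ω S'] (hp : IsLocalDiffeomorph 𝓘(ℂ) 𝓘(ℂ) ω p)
    {D : Coefficients S} (hD : IsPullback id D D) : IsPullback p D (D.pullback p) := by
  rw [isPullback_iff] at hD ⊢
  intro e e' he he' z hz
  have he₀ := isCoord_chartAt (p (e'.symm z))
  have hz₀ : z ∈ coordDomain (chartAt ℂ (p (e'.symm z))) p e' := ⟨hz.1, mem_chart_source _ _⟩
  have h1 : Transforms (D.val (chartAt ℂ (p (e'.symm z)))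
      (coordMap (chartAt ℂ (p (e'.symm z))) p e' z)) ((D.pullback p).val e' z)
      (deriv (coordMap (chartAt ℂ (p (e'.symm z))) p e') z) := by
    refine ⟨?_, rfl, rfl⟩
    have h2 := norm_pos_iff.2 (deriv_coordMap_ne_zero he₀ he' hp hz₀)
    simp only [Coefficients.val, Coefficients.pullback]
    rw [Real.exp_add, Real.exp_log (by positivity)]
  have h3 := hD e _ he he₀ _ (coordMap_mem (p := id) hz₀ hz)
  rw [coordMap_comp_apply hz₀] at h3
  have h4 := deriv_coordMap_comp (p := id) he he₀ he' contMDiff_id hp.contMDiff hz₀ hz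
  rw [Function.id_comp] at h3 h4
  rw [h4]
  exact h3.trans h1

/-- Both coordinates upstairs are compared with the same chart downstairs; the chain rule splits off
the transition derivative. -/
lemma IsPullback.change_coord (hp : ContMDiff 𝓘(ℂ) 𝓘(ℂ) ω p) {D : Coefficients S}
    {D' : Coefficients S'} (h : IsPullback p D D') : IsPullback id D' D' := by
  rw [isPullback_iff] at h ⊢
  intro e₁ e₂ he₁ he₂ z hz
  have he₀ := isCoord_chartAt (p (e₂.symm z))
  have hz₀ : z ∈ coordDomain (chartAt ℂ (p (e₂.symm z))) p e₂ := ⟨hz.1, mem_chart_source _ _⟩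
  have h1 := h _ e₂ he₀ he₂ z hz₀
  have h2 := h _ e₁ he₀ he₁ _ (coordMap_mem (q := id) hz hz₀)
  have h3 := deriv_coordMap_comp (q := id) he₀ he₁ he₂ hp contMDiff_id hz hz₀
  rw [coordMap_comp_apply hz] at h2
  rw [Function.comp_id] at h2 h3
  rw [h3] at h1
  exact h2.of_mul h1

/-- Pullback of a metric and of differentials under a local biholomorphism. -/
def SurfaceData.pullback [IsManifold 𝓘(ℂ) ω S'] (hp : IsLocalDiffeomorph 𝓘(ℂ) 𝓘(ℂ) ω p)
    (D : SurfaceData S) : SurfaceData S' :=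
  have hpb := isPullback_pullback hp D.change_coord
  -- The preferred chart in the definition of the pullback varies with the point, so smoothness is
  -- not visible there. The transformation law allows one fixed chart on a whole neighbourhood.
  have hsm : ∀ e', IsCoord e' → ∀ z ∈ e'.target, ∃ (W : Set ℂ) (e : OpenPartialHomeomorph S ℂ),
      IsCoord e ∧ W ∈ 𝓝 z ∧ MapsTo (coordMap e p e') W e.target ∧
      ContDiffOn ℝ ∞ (coordMap e p e') W ∧ ContDiffOn ℝ ∞ (deriv (coordMap e p e')) W ∧
      ∀ w ∈ W, deriv (coordMap e p e') w ≠ 0 ∧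
        Transforms (D.val e (coordMap e p e' w)) ((D.toCoefficients.pullback p).val e' w)
          (deriv (coordMap e p e') w) := fun e' he' z hz => by
    have he := isCoord_chartAt (p (e'.symm z))
    have hO := isOpen_coordDomain (e := chartAt ℂ (p (e'.symm z))) (e' := e') hp.contMDiff.continuous
    have hd := differentiableOn_coordMap he he' hp.contMDiff
    exact ⟨_, _, he, hO.mem_nhds ⟨hz, mem_chart_source _ _⟩, mapsTo_coordMap,
      (hd.contDiffOn hO).restrict_scalars ℝ, ((hd.deriv hO).contDiffOn hO).restrict_scalars ℝ,
      fun w hw => ⟨deriv_coordMap_ne_zero he he' hp hw, isPullback_iff.1 hpb _ _ he he' w hw⟩⟩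
  { D.toCoefficients.pullback p with
    smooth_u := fun e' he' z hz => by
      obtain ⟨W, e, he, hW, hmaps, hs, hs', h⟩ := hsm e' he' z hz
      refine ContDiffAt.contDiffWithinAt (ContDiffAt.congr_of_eventuallyEq (f := fun w =>
        D.u e (coordMap e p e' w) + Real.log (‖deriv (coordMap e p e') w‖ ^ 2)) ?_ ?_)
      · refine ContDiffAt.add (((D.smooth_u e he).comp hs hmaps).contDiffAt hW)
          (ContDiffAt.log ((hs'.contDiffAt hW).norm_sq ℝ) ?_)
        have := norm_pos_iff.2 (h z (mem_of_mem_nhds hW)).1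
        positivity
      · filter_upwards [hW] with w hw
        have h2 := norm_pos_iff.2 (h w hw).1
        have h3 := (h w hw).2.1
        apply Real.exp_injective
        rw [Real.exp_add, Real.exp_log (by positivity)]
        exact h3
    smooth_phi := fun e' he' z hz => by
      obtain ⟨W, e, he, hW, hmaps, hs, hs', h⟩ := hsm e' he' z hz
      refine ContDiffAt.contDiffWithinAt (ContDiffAt.congr_of_eventuallyEq
        ((((D.smooth_phi e he).comp hs hmaps).mul hs').contDiffAt hW) ?_)
      filter_upwards [hW] with w hw using (h w hw).2.2.1
    smooth_psi := fun e' he' z hz => by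
      obtain ⟨W, e, he, hW, hmaps, hs, hs', h⟩ := hsm e' he' z hz
      refine ContDiffAt.contDiffWithinAt (ContDiffAt.congr_of_eventuallyEq
        ((((D.smooth_psi e he).comp hs hmaps).mul (hs'.pow 3)).contDiffAt hW) ?_)
      filter_upwards [hW] with w hw using (h w hw).2.2.2
    change_coord := hpb.change_coord hp.contMDiff }

end Coordinates

/-! ### Conformal Lagrangian immersions in terms of local solutions -/

section Immersions

open Complex Set Filter Topology

variable {c : SignType} {S : Type*} [TopologicalSpace S] {f g : S → SpaceForm c}
  {e e' : OpenPartialHomeomorph S ℂ} {V V₁ V₂ U : Set ℂ} {F G : ℂ → Amb c} {z : ℂ} {x : S}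

namespace IsLocalLift

lemma isLift (h : IsLocalLift c f e V F) : IsLift c V F :=
  ⟨h.isOpen, h.smooth, fun z hz => (h.lift z hz).1⟩

lemma mono (h : IsLocalLift c f e V F) (hU : IsOpen U) (hUV : U ⊆ V) : IsLocalLift c f e U F :=
  ⟨hU, hUV.trans h.subset, h.smooth.mono hUV, fun z hz => h.lift z (hUV hz)⟩

lemma factor (h₁ : IsLocalLift c f e V₁ F) (h₂ : IsLocalLift c f e V₂ G) (w : ℂ)
    (hw : w ∈ V₁ ∩ V₂) : ∃ l : ℂ, ‖l‖ = 1 ∧ (c = 0 → l = 1) ∧ G w = l • F w := by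
  obtain ⟨_, h1⟩ := h₁.lift w hw.1
  obtain ⟨_, h2⟩ := h₂.lift w hw.2
  exact proj_eq_iff.1 (h1.trans h2.symm)

lemma smul (h : IsLocalLift c f e V F) {l : ℂ → ℂ} (hl : ∀ w ∈ V, ‖l w‖ = 1 ∧ (c = 0 → l w = 1))
    (h' : IsLift c V fun w => l w • F w) : IsLocalLift c f e V fun w => l w • F w :=
  ⟨h.isOpen, h.subset, h'.smooth, fun w hw => by
    obtain ⟨hF, h1⟩ := h.lift w hw
    refine ⟨h'.mem w hw, ?_⟩
    rw [← h1]
    exact (proj_eq_iff.2 ⟨l w, (hl w hw).1, (hl w hw).2, rfl⟩).symm⟩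

lemma comp_coordMap [ChartedSpace ℂ S] (h : IsLocalLift c f e V F) (he : IsCoord e)
    (he' : IsCoord e') : IsLocalLift c f e' (coordDomain e id e' ∩ coordMap e id e' ⁻¹' V)
      fun w => F (coordMap e id e' w) := by
  have hO := isOpen_coordDomain (e := e) (e' := e') continuous_id
  have hd := differentiableOn_coordMap he he' contMDiff_id
  refine ⟨hd.continuousOn.isOpen_inter_preimage hO h.isOpen, fun w hw => hw.1.1, ?_, fun w hw => ?_⟩
  · exact h.smooth.comp (((hd.contDiffOn hO).restrict_scalars ℝ).mono inter_subset_left)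
      fun w hw => hw.2
  · obtain ⟨h1, h2⟩ := h.lift _ hw.2
    refine ⟨h1, h2.trans ?_⟩
    congr 1
    exact e.left_inv hw.1.2

end IsLocalLift

/-- In the coordinate `e`, the map `f` has near `x` a lift solving the equations with data `D`. -/
def IsSolvedBy (c : SignType) (f : S → SpaceForm c) (D : Coefficients S)
    (e : OpenPartialHomeomorph S ℂ) (x : S) : Prop :=
  x ∈ e.source ∧ ∃ V F, e x ∈ V ∧ IsLocalLift c f e V F ∧
    IsSolution c V (D.u e) (D.phi e) (D.psi e) F

namespace IsSolvedBy

variable {D : Coefficients S}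

lemma eventually (h : IsSolvedBy c f D e x) : ∀ᶠ y in 𝓝 x, IsSolvedBy c f D e y := by
  obtain ⟨hx, V, F, hV, hl, hs⟩ := h
  filter_upwards [(e.isOpen_inter_preimage hl.isOpen).mem_nhds ⟨hx, hV⟩] with y hy
  exact ⟨hy.1, V, F, hy.2, hl, hs⟩

lemma congr (h : IsSolvedBy c f D e x) (hg : f =ᶠ[𝓝 x] g) : IsSolvedBy c g D e x := by
  obtain ⟨hx, V, F, hV, hl, hs⟩ := h
  obtain ⟨O, hO, hOo, hxO⟩ := eventually_nhds_iff.1 hg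
  have hU : IsOpen (V ∩ (e.target ∩ e.symm ⁻¹' O)) :=
    hl.isOpen.inter (e.symm.isOpen_inter_preimage hOo)
  refine ⟨hx, V ∩ (e.target ∩ e.symm ⁻¹' O), F, ⟨hV, e.map_source hx, ?_⟩,
    ⟨hU, fun w hw => hw.2.1, hl.smooth.mono inter_subset_left, fun w hw => ?_⟩,
    hs.mono hU inter_subset_left⟩
  · rw [mem_preimage, e.left_inv hx]
    exact hxO
  · obtain ⟨h1, h2⟩ := hl.lift w hw.1
    exact ⟨h1, h2.trans (hO _ hw.2.2)⟩

lemma isometry (h : IsSolvedBy c f D e x) {r : ℝ} {F₁ P₁ Q₁ F₂ P₂ Q₂ : Amb c}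
    (h₁ : IsFrame c r F₁ P₁ Q₁) (h₂ : IsFrame c r F₂ P₂ Q₂) :
    IsSolvedBy c (h₁.isometry h₂ ∘ f) D e x := by
  obtain ⟨hx, V, F, hV, hl, hs⟩ := h
  have hm := (hs.motion h₁ h₂).1
  refine ⟨hx, V, _, hV, ⟨hl.isOpen, hl.subset, hm.smooth, fun w hw => ?_⟩, hm⟩
  obtain ⟨hF, hF'⟩ := hl.lift w hw
  refine ⟨hm.mem w hw, ?_⟩
  rw [Function.comp_apply, ← hF', h₁.isometry_proj h₂]

/-- Maps with the same data which agree somewhere near `x` agree at `x`. -/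
lemma exists_nhds_eqOn (hf : IsSolvedBy c f D e x) (hg : IsSolvedBy c g D e x) :
    ∃ N, IsOpen N ∧ x ∈ N ∧ ∀ y ∈ N, f =ᶠ[𝓝 y] g → EqOn f g N := by
  obtain ⟨hx, V₁, F, hV₁, hl₁, hs₁⟩ := hf
  obtain ⟨-, V₂, G, hV₂, hl₂, hs₂⟩ := hg
  obtain ⟨r, hr, hB⟩ := Metric.isOpen_iff.1 (hl₁.isOpen.inter hl₂.isOpen) (e x) ⟨hV₁, hV₂⟩
  refine ⟨e.source ∩ e ⁻¹' Metric.ball (e x) r, e.isOpen_inter_preimage Metric.isOpen_ball,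
    ⟨hx, Metric.mem_ball_self hr⟩, fun y hy hfg => ?_⟩
  obtain ⟨O, hO, hOo, hyO⟩ := eventually_nhds_iff.1 hfg
  -- Near y the maps agree, so F is there also a lift of g and differs from G by a constant phase.
  have hU : IsOpen (V₁ ∩ (e.target ∩ e.symm ⁻¹' O)) :=
    hl₁.isOpen.inter (e.symm.isOpen_inter_preimage hOo)
  have hyU : e y ∈ V₁ ∩ (e.target ∩ e.symm ⁻¹' O) := by
    refine ⟨(hB hy.2).1, e.map_source hy.1, ?_⟩
    rw [mem_preimage, e.left_inv hy.1]
    exact hyO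
  have hl₁' : IsLocalLift c g e _ F := ⟨hU, fun w hw => hw.2.1, hl₁.smooth.mono inter_subset_left,
    fun w hw => ⟨(hl₁.lift w hw.1).1, (hl₁.lift w hw.1).2.trans (hO _ hw.2.2)⟩⟩
  obtain ⟨l, hl, hl0, hFG⟩ := hl₁'.isLift.eventuallyEq_smul hl₂.isLift
    (hs₁.mono hU inter_subset_left).isHorizontal hs₂.isHorizontal (hl₁'.factor hl₂)
    ⟨hyU, (hB hy.2).2⟩
  -- Agreement of G and l F near the one point e y includes agreement of their frames, so they
  -- coincide on the whole convex ball, not only near y.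
  have h3 := hs₂.eqOn (hs₁.smul hl) (convex_ball (e x) r) (hB.trans inter_subset_right)
    (hB.trans inter_subset_left) hy.2 hFG.self_of_nhds (wz_congr hFG) (wzb_congr hFG)
  intro w hw
  obtain ⟨h4, h5⟩ := hl₁.lift (e w) (hB hw.2).1
  obtain ⟨h6, h7⟩ := hl₂.lift (e w) (hB hw.2).2
  rw [e.left_inv hw.1] at h5 h7
  rw [← h5, ← h7]
  exact proj_eq_iff.2 ⟨l, hl, hl0, h3 hw.2⟩

end IsSolvedBy

/-- Maps with the same data which agree near a point of a connected set agree there. -/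
theorem eqOn_of_isSolvedBy {D : Coefficients S} {K : Set S} (hK : IsPreconnected K)
    (hf : ∀ x ∈ K, ∃ e, IsSolvedBy c f D e x ∧ IsSolvedBy c g D e x) {y : S} (hy : y ∈ K)
    (hfg : f =ᶠ[𝓝 y] g) : EqOn f g K := by
  -- The set where the germs agree is open, and by the previous lemma it contains those of its limit
  -- points that lie in K; connectedness finishes.
  have h1 : K ⊆ {x | f =ᶠ[𝓝 x] g} := by
    refine hK.subset_of_closure_inter_subset ?_ ⟨y, hy, hfg⟩ ?_
    · exact isOpen_iff_mem_nhds.2 fun x hx => hx.eventuallyEq_nhds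
    · rintro x ⟨hx, hxK⟩
      obtain ⟨e, h2, h3⟩ := hf x hxK
      obtain ⟨N, hN, hxN, h4⟩ := h2.exists_nhds_eqOn h3
      obtain ⟨w, hwN, hw⟩ := mem_closure_iff.1 hx N hN hxN
      exact (h4 w hwN hw).eventuallyEq_of_mem (hN.mem_nhds hxN)
  exact fun x hx => (h1 hx).self_of_nhds

variable [ChartedSpace ℂ S]

lemma IsSolvedBy.change_coord {D : Coefficients S} (h : IsSolvedBy c f D e x)
    (hD : IsPullback id D D) (he : IsCoord e) (he' : IsCoord e') (hx' : x ∈ e'.source) :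
    IsSolvedBy c f D e' x := by
  obtain ⟨hx, V, F, hV, hl, hs⟩ := h
  have hl' := hl.comp_coordMap he he'
  have hd := differentiableOn_coordMap he he' (contMDiff_id (n := ω))
  have ht := fun w (hw : w ∈ coordDomain e id e') => isPullback_iff.1 hD e e' he he' w hw
  have hs' : IsSolution c (coordDomain e id e' ∩ coordMap e id e' ⁻¹' V) (D.u e') (D.phi e')
      (D.psi e') fun w => F (coordMap e id e' w) :=
    hs.comp_holomorphic hl'.isOpen (hd.mono inter_subset_left) (fun w hw => hw.2)
      (fun w hw => (ht w hw.1).1) (fun w hw => (ht w hw.1).2.1) (fun w hw => (ht w hw.1).2.2)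
  refine ⟨hx', coordDomain e id e' ∩ coordMap e id e' ⁻¹' V, _, ⟨⟨e'.map_source hx', ?_⟩, ?_⟩, hl', hs'⟩
  · rw [mem_preimage, e'.left_inv hx']
    exact hx
  · rw [mem_preimage, coordMap, e'.left_inv hx']
    exact hV

/-- A map with local solutions is a conformal Lagrangian immersion with the given data. -/
theorem isConformalLagrangianImmersion_of_isSolvedBy {D : SurfaceData S}
    (h : ∀ x, ∃ e, IsCoord e ∧ IsSolvedBy c f D.toCoefficients e x) :
    IsConformalLagrangianImmersion c f ∧ HasData c f D := by
  have key : ∀ e : OpenPartialHomeomorph S ℂ, IsCoord e → ∀ z ∈ e.target, ∃ V F, z ∈ V ∧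
      IsLocalLift c f e V F ∧ IsSolution c V (D.u e) (D.phi e) (D.psi e) F := by
    intro e he z hz
    obtain ⟨e', he', h'⟩ := h (e.symm z)
    obtain ⟨-, V, F, hV, hl, hs⟩ := h'.change_coord D.change_coord he' he (e.map_target hz)
    rw [e.right_inv hz] at hV
    exact ⟨V, F, hV, hl, hs⟩
  -- The conditions range over all lifts, while a solution is one particular lift; `pull_eq`
  -- transfers the metric and the Kähler form to any other.
  have hpull : ∀ e : OpenPartialHomeomorph S ℂ, IsCoord e → ∀ V F, IsLocalLift c f e V F →
      ∀ z ∈ V, ∀ X Y : ℂ, pullMetric c F z X Y = 2 * Real.exp (D.u e z) * (X * conj Y).re ∧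
        pullKaehler c F z X Y = 0 := by
    intro e he V F hF z hz X Y
    obtain ⟨V', F', hz', hl, hs⟩ := key e he z (hF.subset hz)
    have h1 := hl.isLift.pull_eq hF.isLift (hl.factor hF) ⟨hz', hz⟩ X Y
    rw [h1.1, h1.2]
    exact ⟨hs.pullMetric_eq hz' X Y, hs.pullKaehler_eq hz' X Y⟩
  -- For Φ and Ψ only horizontal lifts are tested, and such a lift is locally a constant phase times
  -- the given solution, hence itself a solution.
  have hhor : ∀ e : OpenPartialHomeomorph S ℂ, IsCoord e → ∀ V F, IsLocalLift c f e V F →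
      IsHorizontal c V F → ∀ z ∈ V, ∃ U, z ∈ U ∧
        IsSolution c U (D.u e) (D.phi e) (D.psi e) F := by
    intro e he V F hF hh z hz
    obtain ⟨V', F', hz', hl, hs⟩ := key e he z (hF.subset hz)
    obtain ⟨l, hl1, -, h1⟩ := hl.isLift.eventuallyEq_smul hF.isLift hs.isHorizontal hh
      (hl.factor hF) ⟨hz', hz⟩
    obtain ⟨O, hO, hOo, hzO⟩ := eventually_nhds_iff.1 h1
    exact ⟨V' ∩ O, ⟨hz', hzO⟩, ((hs.smul hl1).mono (hl.isOpen.inter hOo)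
      inter_subset_left).congr_lift fun w hw => hO w hw.2⟩
  refine ⟨⟨fun e he z hz => ?_, fun e he V F hF z hz => ?_, fun e he V F hF z hz X Y => ?_⟩,
    fun e he V F hF z hz X Y => (hpull e he V F hF z hz X Y).1, fun e he V F hF hh z hz => ?_,
    fun e he V F hF hh z hz => ?_⟩
  · obtain ⟨V, F, hV, hl, -⟩ := key e he z hz
    exact ⟨V, F, hV, hl⟩
  · exact ⟨2 * Real.exp (D.u e z), by positivity, fun X Y => (hpull e he V F hF z hz X Y).1⟩
  · exact (hpull e he V F hF z hz X Y).2
  · obtain ⟨U, hzU, hs⟩ := hhor e he V F hF hh z hz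
    exact hs.phi_eq hzU
  · obtain ⟨U, hzU, hs⟩ := hhor e he V F hF hh z hz
    exact hs.psi_eq hzU

/-- A conformal Lagrangian immersion has horizontal local lifts. -/
lemma IsConformalLagrangianImmersion.exists_horizontal_lift
    (hf : IsConformalLagrangianImmersion c f) (he : IsCoord e) (hz : z ∈ e.target) :
    ∃ V F, z ∈ V ∧ IsLocalLift c f e V F ∧ IsHorizontal c V F := by
  obtain ⟨V, F, hV, hl⟩ := hf.smooth e he z hz
  obtain ⟨U, l, hzU, hUV, hl1, hU, hh⟩ :=
    hl.isLift.exists_horizontal (hf.lagrangian e he V F hl) hV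
  exact ⟨U, _, hzU, (hl.mono hU.isOpen hUV).smul hl1 hU, hh⟩

lemma HasData.isSolvedBy (hf : IsConformalLagrangianImmersion c f) {D : SurfaceData S}
    (hD : HasData c f D) (he : IsCoord e) (hx : x ∈ e.source) :
    IsSolvedBy c f D.toCoefficients e x := by
  obtain ⟨V, F, hV, hl, hh⟩ := hf.exists_horizontal_lift he (e.map_source hx)
  exact ⟨hx, V, F, hV, hl, IsSolution.of_horizontal hl.isLift hh (hD.metric e he V F hl)
    (hf.lagrangian e he V F hl) (hD.meanCurvature e he V F hl hh) (hD.hopf e he V F hl hh)⟩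

lemma HasData.isCompatible (hf : IsConformalLagrangianImmersion c f) {D : SurfaceData S}
    (hD : HasData c f D) : D.IsCompatible c := by
  intro e he z hz
  obtain ⟨-, V, F, hV, hl, hs⟩ := hD.isSolvedBy hf he (e.map_target hz)
  rw [e.right_inv hz] at hV
  exact (isIntegrable_iff hs.isOpen hs.smooth_u hs.smooth_phi hV).1 (hs.isIntegrable hV)

/-- A conformal Lagrangian immersion has local solutions with some data. -/
lemma IsConformalLagrangianImmersion.exists_isSolution (hf : IsConformalLagrangianImmersion c f)
    (he : IsCoord e) (hz : z ∈ e.target) : ∃ V F u φ ψ, z ∈ V ∧ IsLocalLift c f e V F ∧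
      IsSolution c V u φ ψ F := by
  obtain ⟨V, F, hV, hl, hh⟩ := hf.exists_horizontal_lift he hz
  have h1 : ∀ w, ∃ u : ℝ, w ∈ V → ∀ X Y : ℂ,
      pullMetric c F w X Y = 2 * Real.exp u * (X * conj Y).re := by
    intro w
    by_cases hw : w ∈ V
    · obtain ⟨r, hr, h⟩ := hf.conformal e he V F hl w hw
      -- The conformal factor r equals 2 e^u.
      refine ⟨Real.log (r / 2), fun _ X Y => ?_⟩
      rw [Real.exp_log (by positivity), h X Y]
      ring
    · exact ⟨0, fun h => absurd h hw⟩
  choose u hu using h1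
  -- The functions φ and ψ are taken to be the defining expressions themselves, so their conditions
  -- hold by `rfl`.
  exact ⟨V, F, u, _, _, hV, hl, IsSolution.of_horizontal hl.isLift hh hu
    (hf.lagrangian e he V F hl) (fun _ _ => rfl) (fun _ _ => rfl)⟩

/-- The metric, mean curvature form and cubic Hopf differential of an immersion. -/
theorem IsConformalLagrangianImmersion.exists_data [IsManifold 𝓘(ℂ) ω S]
    (hf : IsConformalLagrangianImmersion c f) :
    ∃ D : SurfaceData S, HasData c f D := by
  have h1 : ∀ (e : OpenPartialHomeomorph S ℂ) (z : ℂ), ∃ a : ℝ × ℂ × ℂ, IsCoord e → z ∈ e.target →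
      ∀ V F u φ ψ, z ∈ V → IsLocalLift c f e V F → IsSolution c V u φ ψ F →
        a = (u z, φ z, ψ z) := by
    intro e z
    by_cases h : IsCoord e ∧ z ∈ e.target
    · obtain ⟨V, F, u, φ, ψ, hV, hl, hs⟩ := hf.exists_isSolution h.1 h.2
      refine ⟨(u z, φ z, ψ z), fun _ _ V' F' u' φ' ψ' hV' hl' hs' => ?_⟩
      obtain ⟨e1, e2, e3⟩ := hs.data_unique hs' (hl.factor hl') ⟨hV, hV'⟩
      rw [e1, e2, e3]
    · exact ⟨0, fun he hz => absurd ⟨he, hz⟩ h⟩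
  choose a ha using h1
  let D₀ : Coefficients S := ⟨fun e z => (a e z).1, fun e z => (a e z).2.1, fun e z => (a e z).2.2⟩
  have key : ∀ e : OpenPartialHomeomorph S ℂ, IsCoord e → ∀ z ∈ e.target, ∃ V F, z ∈ V ∧
      IsLocalLift c f e V F ∧ IsSolution c V (D₀.u e) (D₀.phi e) (D₀.psi e) F := by
    intro e he z hz
    obtain ⟨V, F, u, φ, ψ, hV, hl, hs⟩ := hf.exists_isSolution he hz
    have h2 := fun w (hw : w ∈ V) => ha e w he (hl.subset hw) V F u φ ψ hw hl hs
    refine ⟨V, F, hV, hl, hs.congr_data (fun w hw => ?_) (fun w hw => ?_) fun w hw => ?_⟩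
    · exact congrArg Prod.fst (h2 w hw)
    · exact congrArg (fun b => b.2.1) (h2 w hw)
    · exact congrArg (fun b => b.2.2) (h2 w hw)
  have hloc : ∀ e : OpenPartialHomeomorph S ℂ, IsCoord e →
      ContDiffOn ℝ ∞ (D₀.u e) e.target ∧ ContDiffOn ℝ ∞ (D₀.phi e) e.target ∧
        ContDiffOn ℝ ∞ (D₀.psi e) e.target := fun e he => by
    refine ⟨fun z hz => ?_, fun z hz => ?_, fun z hz => ?_⟩ <;>
    obtain ⟨V, F, hV, hl, hs⟩ := key e he z hz
    · exact (hs.smooth_u.contDiffAt (hs.isOpen.mem_nhds hV)).contDiffWithinAt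
    · exact (hs.smooth_phi.contDiffAt (hs.isOpen.mem_nhds hV)).contDiffWithinAt
    · exact (hs.smooth_psi.contDiffAt (hs.isOpen.mem_nhds hV)).contDiffWithinAt
  -- A solution composed with the transition map is a solution in the new coordinate with
  -- transformed data; uniqueness of the data identifies these with the coefficients there.
  have hch : IsPullback id D₀ D₀ := by
    rw [isPullback_iff]
    intro e e' he he' z hz
    obtain ⟨V, F, hV, hl, hs⟩ := key e he _ (mapsTo_coordMap hz)
    have hl' := hl.comp_coordMap he he'
    have hd := differentiableOn_coordMap he he' (contMDiff_id (n := ω))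
    have hs' := hs.comp_holomorphic hl'.isOpen
      (u' := fun w => D₀.u e (coordMap e id e' w) + Real.log (‖deriv (coordMap e id e') w‖ ^ 2))
      (φ' := fun w => D₀.phi e (coordMap e id e' w) * deriv (coordMap e id e') w)
      (ψ' := fun w => D₀.psi e (coordMap e id e' w) * deriv (coordMap e id e') w ^ 3)
      (hd.mono inter_subset_left) (fun w hw => hw.2) (fun w hw => by
        have := norm_pos_iff.2 (deriv_coordMap_id_ne_zero he he' hw.1)
        rw [Real.exp_add, Real.exp_log (by positivity)]) (fun _ _ => rfl) (fun _ _ => rfl)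
    have hz' : z ∈ coordDomain e id e' ∩ coordMap e id e' ⁻¹' V := ⟨hz, hV⟩
    have h2 := ha e' z he' hz.1 _ _ _ _ _ hz' hl' hs'
    have h3 : D₀.val e' z = a e' z := rfl
    rw [h3, h2]
    refine ⟨?_, rfl, rfl⟩
    have := norm_pos_iff.2 (deriv_coordMap_id_ne_zero he he' hz)
    simp only [Coefficients.val]
    rw [Real.exp_add, Real.exp_log (by positivity)]
  let D : SurfaceData S := { D₀ with
    smooth_u := fun e he => (hloc e he).1
    smooth_phi := fun e he => (hloc e he).2.1
    smooth_psi := fun e he => (hloc e he).2.2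
    change_coord := hch }
  refine ⟨D, (isConformalLagrangianImmersion_of_isSolvedBy fun x => ?_).2⟩
  obtain ⟨V, F, hV, hl, hs⟩ := key (chartAt ℂ x) (isCoord_chartAt x) _
    ((chartAt ℂ x).map_source (mem_chart_source ℂ x))
  exact ⟨_, isCoord_chartAt x, mem_chart_source ℂ x, V, F, hV, hl, hs⟩

end Immersions

/-! ### The fundamental theorem -/

section FundamentalTheorem

open Complex Set Filter Topology

variable {c : SignType}

lemma IsIntegrable.congr {u u' : ℂ → ℝ} {φ ψ φ' ψ' : ℂ → ℂ} {z : ℂ} (h : IsIntegrable c u φ ψ z)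
    (hu : u' =ᶠ[𝓝 z] u) (hφ : φ' =ᶠ[𝓝 z] φ) (hψ : ψ' =ᶠ[𝓝 z] ψ) : IsIntegrable c u' φ' ψ' z := by
  have hd : duz u' =ᶠ[𝓝 z] duz u := by
    filter_upwards [hu.eventuallyEq_nhds] with w hw
    exact wz_congr (hw.fun_comp fun r : ℝ => (r : ℂ))
  refine ⟨?_, ?_, ?_⟩
  · rw [wzb_congr hφ, h.closed.symm]
  · rw [wzb_congr hd, hφ.self_of_nhds, hψ.self_of_nhds, hu.self_of_nhds]
    exact h.gauss
  · rw [wzb_congr hψ, wz_congr hφ, hd.self_of_nhds, hφ.self_of_nhds, hu.self_of_nhds]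
    exact h.codazzi

variable {S : Type*} [TopologicalSpace S] [ChartedSpace ℂ S]

/-- Existence on a simply connected surface. -/
theorem exists_isSolvedBy [SimplyConnectedSpace S] (D : SurfaceData S)
    (hD : ∀ x : S, ∃ e, IsCoord e ∧ x ∈ e.source ∧
      ∀ z ∈ e.target, IsIntegrable c (D.u e) (D.phi e) (D.psi e) z) :
    ∃ f : S → SpaceForm c, ∀ x, ∃ e, IsCoord e ∧ IsSolvedBy c f D.toCoefficients e x := by
  have := ChartedSpace.locallyPathConnectedSpace ℂ S
  have hball : ∀ x : S, ∃ e, IsCoord e ∧ x ∈ e.source ∧ ∃ r > 0, Metric.ball (e x) r ⊆ e.target ∧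
      ∀ y ∈ Metric.ball (e x) r, ∀ F₀ P₀ Q₀ : Amb c, IsFrame c (Real.exp (D.u e y)) F₀ P₀ Q₀ →
        ∃ F, IsSolution c (Metric.ball (e x) r) (D.u e) (D.phi e) (D.psi e) F ∧
          F y = F₀ ∧ wz F y = P₀ ∧ wzb F y = Q₀ := by
    intro x
    obtain ⟨e, he, hx, hint⟩ := hD x
    exact ⟨e, he, hx, exists_isSolution e.open_target (D.smooth_u e he) (D.smooth_phi e he)
      (D.smooth_psi e he) hint (e.map_source hx)⟩
  -- A local solution defines a map of surfaces only over its ball; f fills in the points where F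
  -- does not land in the total space.
  have hproj : ∀ {e : OpenPartialHomeomorph S ℂ} {B : Set ℂ} {F : ℂ → Amb c} (f : S → SpaceForm c),
      B ⊆ e.target → IsSolution c B (D.u e) (D.phi e) (D.psi e) F →
      ∃ g : S → SpaceForm c, IsLocalLift c g e B F := by
    intro e B F f hB hs
    classical
    refine ⟨fun w => if h : F (e w) ∈ total c then proj c ⟨F (e w), h⟩ else f w, hs.isOpen, hB,
      hs.smooth, fun z hz => ⟨hs.mem z hz, ?_⟩⟩
    have h1 : e (e.symm z) = z := e.right_inv (hB hz)
    simp only [h1, dif_pos (hs.mem z hz)]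
  refine exists_forall_of_germ_continuation
    (fun x (f : S → SpaceForm c) => ∃ e, IsCoord e ∧ IsSolvedBy c f D.toCoefficients e x)
    (fun x f g hfg ⟨e, he, h⟩ => ⟨e, he, h.congr hfg⟩)
    (fun x f ⟨e, he, h⟩ => h.eventually.mono fun y hy => ⟨e, he, hy⟩) (fun x => ?_) ?_
  · obtain ⟨e, he, hx, r, hr, hB, hex⟩ := hball x
    refine ⟨e.source ∩ e ⁻¹' Metric.ball (e x) r, e.isOpen_inter_preimage Metric.isOpen_ball,
      ⟨hx, Metric.mem_ball_self hr⟩, ?_, ?_⟩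
    · rintro y ⟨hy, hyB⟩ f ⟨e₁, he₁, h₁⟩
      obtain ⟨-, V, F, hV, hl, hs⟩ := h₁.change_coord D.change_coord he₁ he hy
      -- The continuation solves the equations on the entire ball with the frame of the given germ
      -- at y as initial value, so it agrees with that germ near y.
      obtain ⟨F', hs', h2, h3, h4⟩ := hex _ hyB _ _ _ (hs.frame _ hV)
      obtain ⟨g, hg⟩ := hproj f hB hs'
      refine ⟨g, fun w hw => ⟨e, he, hw.1, _, F', hw.2, hg, hs'⟩, ?_⟩
      obtain ⟨ρ, hρ, hρB⟩ := Metric.isOpen_iff.1 (hs.isOpen.inter hs'.isOpen) _ ⟨hV, hyB⟩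
      have h5 := hs.eqOn hs' (convex_ball _ ρ) (hρB.trans inter_subset_left)
        (hρB.trans inter_subset_right) (Metric.mem_ball_self hρ) h2.symm h3.symm h4.symm
      filter_upwards [(e.isOpen_inter_preimage (Metric.isOpen_ball (x := e y) (ε := ρ))).mem_nhds
        ⟨hy, Metric.mem_ball_self hρ⟩] with w hw
      obtain ⟨h6, h7⟩ := hl.lift _ (hρB hw.2).1
      obtain ⟨h8, h9⟩ := hg.lift _ (hρB hw.2).2
      rw [e.left_inv hw.1] at h7 h9
      rw [← h7, ← h9]
      congr 2
      exact h5 hw.2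
    · intro f g hf hg y hy hfg
      have hconn : IsPreconnected (e.source ∩ e ⁻¹' Metric.ball (e x) r) := by
        rw [← e.symm_image_eq_source_inter_preimage hB]
        exact (convex_ball _ _).isPreconnected.image _ (e.continuousOn_symm.mono hB)
      refine eqOn_of_isSolvedBy (D := D.toCoefficients) hconn (fun w hw => ⟨e, ?_, ?_⟩) hy hfg
      · obtain ⟨e₁, he₁, h₁⟩ := hf w hw
        exact h₁.change_coord D.change_coord he₁ he hw.1
      · obtain ⟨e₁, he₁, h₁⟩ := hg w hw
        exact h₁.change_coord D.change_coord he₁ he hw.1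
  · obtain ⟨x⟩ : Nonempty S := inferInstance
    obtain ⟨e, he, hx, r, hr, hB, hex⟩ := hball x
    obtain ⟨F₀, P₀, Q₀, hfr⟩ := IsFrame.exists_frame c (Real.exp_pos (D.u e (e x)))
    obtain ⟨F, hs, -⟩ := hex _ (Metric.mem_ball_self hr) _ _ _ hfr
    obtain ⟨g, hg⟩ := hproj (fun _ => proj c ⟨F₀, hfr.mem⟩) hB hs
    exact ⟨x, g, e, he, hx, _, F, Metric.mem_ball_self hr, hg, hs⟩

/-- Uniqueness up to isometries. -/
theorem exists_isometry_of_hasData [PreconnectedSpace S] [Nonempty S] [IsManifold 𝓘(ℂ) ω S]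
    {D : SurfaceData S} {f₁ f₂ : S → SpaceForm c}
    (hf₁ : IsConformalLagrangianImmersion c f₁) (h₁ : HasData c f₁ D)
    (hf₂ : IsConformalLagrangianImmersion c f₂) (h₂ : HasData c f₂ D) :
    ∃ T : SpaceForm c → SpaceForm c, IsIsometry c T ∧ f₂ = T ∘ f₁ := by
  obtain ⟨x⟩ : Nonempty S := inferInstance
  have hx := mem_chart_source ℂ x
  obtain ⟨-, V₁, F₁, hV₁, hl₁, hs₁⟩ := h₁.isSolvedBy hf₁ (isCoord_chartAt x) hx
  obtain ⟨-, V₂, F₂, hV₂, hl₂, hs₂⟩ := h₂.isSolvedBy hf₂ (isCoord_chartAt x) hx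
  set e := chartAt ℂ x
  have hfr₁ := hs₁.frame _ hV₁
  have hfr₂ := hs₂.frame _ hV₂
  -- Equal data give frames of the same square norm at the image of x, so there is a motion carrying
  -- the first to the second.
  refine ⟨hfr₁.isometry hfr₂, hfr₁.isIsometry hfr₂, ?_⟩
  obtain ⟨hs, hd⟩ := hs₁.motion hfr₁ hfr₂
  have hdx := hd _ hV₁
  rw [hfr₁.transition_P, hfr₁.transition_Q] at hdx
  obtain ⟨r, hr, hB⟩ := Metric.isOpen_iff.1 (hl₁.isOpen.inter hl₂.isOpen) _ ⟨hV₁, hV₂⟩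
  -- The moved first lift has the same frame as the second lift at one point and the same data, so
  -- the two coincide on the ball.
  have h3 := hs₂.eqOn hs (convex_ball _ r) (hB.trans inter_subset_right)
    (hB.trans inter_subset_left) (Metric.mem_ball_self hr) IsFrame.motion_self.symm
    hdx.wz.symm hdx.wzb.symm
  have h4 : f₂ =ᶠ[𝓝 x] hfr₁.isometry hfr₂ ∘ f₁ := by
    filter_upwards [(e.isOpen_inter_preimage (Metric.isOpen_ball (x := e x) (ε := r))).mem_nhds
      ⟨hx, Metric.mem_ball_self hr⟩] with w hw
    obtain ⟨h5, h6⟩ := hl₁.lift _ (hB hw.2).1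
    obtain ⟨h7, h8⟩ := hl₂.lift _ (hB hw.2).2
    rw [e.left_inv hw.1] at h6 h8
    rw [← h8, Function.comp_apply, ← h6, hfr₁.isometry_proj hfr₂]
    congr 2
    exact h3 hw.2
  refine funext fun w => eqOn_of_isSolvedBy (D := D.toCoefficients) isPreconnected_univ
    (fun y _ => ⟨chartAt ℂ y, ?_, ?_⟩)
    (mem_univ x) h4 (mem_univ w)
  · exact h₂.isSolvedBy hf₂ (isCoord_chartAt y) (mem_chart_source ℂ y)
  · exact (h₁.isSolvedBy hf₁ (isCoord_chartAt y) (mem_chart_source ℂ y)).isometry hfr₁ hfr₂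

variable {S' : Type*} [TopologicalSpace S'] [ChartedSpace ℂ S']

/-- The pullback of compatible data is integrable in suitable coordinates. -/
lemma SurfaceData.IsCompatible.exists_coord_pullback [IsManifold 𝓘(ℂ) ω S] [IsManifold 𝓘(ℂ) ω S']
    {D : SurfaceData S} (hD : D.IsCompatible c) {p : S' → S}
    (hp : IsLocalDiffeomorph 𝓘(ℂ) 𝓘(ℂ) ω p) (x : S') : ∃ e, IsCoord e ∧ x ∈ e.source ∧
      ∀ z ∈ e.target, IsIntegrable c ((D.pullback hp).u e) ((D.pullback hp).phi e)
        ((D.pullback hp).psi e) z := by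
  have he := isCoord_chartAt (p x)
  -- In a coordinate lifted through p the pulled back coefficients are literally those of D, so the
  -- equations need no transformation.
  obtain ⟨e', he', hx, hsub, h⟩ := exists_coord_lift he hp (mem_chart_source ℂ (p x))
  refine ⟨e', he', hx, fun z hz => ?_⟩
  have h1 : ∀ w ∈ e'.target,
      (D.pullback hp).val e' w = D.val (chartAt ℂ (p x)) w := fun w hw => by
    obtain ⟨h2, h3, h4⟩ := coordMap_lift h hw
    have h5 := isPullback_iff.1 (isPullback_pullback hp D.change_coord) _ _ he he' w h2
    rw [h3, h4] at h5
    exact h5.eq_of_one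
  refine IsIntegrable.congr ((isIntegrable_iff (chartAt ℂ (p x)).open_target (D.smooth_u _ he)
    (D.smooth_phi _ he) (hsub hz)).2 (hD _ he z (hsub hz))) ?_ ?_ ?_ <;>
  filter_upwards [e'.open_target.mem_nhds hz] with w hw
  · exact congrArg Prod.fst (h1 w hw)
  · exact congrArg (fun b => b.2.1) (h1 w hw)
  · exact congrArg (fun b => b.2.2) (h1 w hw)

end FundamentalTheorem

end LagrangianBonnet

end

/-- The existence of D in the first half expresses that Φ and Ψ are globally defined: the local
coefficients are independent of the lift and transform as differentials. In the second half D'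
carries the pulled back data, and uniqueness is asserted for immersions sharing these data. -/
theorem mainTheorem2 (c : SignType) {S : Type*} [TopologicalSpace S] [T2Space S]
    [ConnectedSpace S] [ChartedSpace ℂ S] [IsManifold 𝓘(ℂ) ω S] :
    (∀ f : S → LagrangianBonnet.SpaceForm c,
      LagrangianBonnet.IsConformalLagrangianImmersion c f →
        (∃ D : LagrangianBonnet.SurfaceData S, LagrangianBonnet.HasData c f D) ∧
        ∀ D : LagrangianBonnet.SurfaceData S, LagrangianBonnet.HasData c f D → D.IsCompatible c) ∧
    (∀ D : LagrangianBonnet.SurfaceData S, D.IsCompatible c →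
      ∀ (S' : Type*) [TopologicalSpace S'] [ChartedSpace ℂ S'] [IsManifold 𝓘(ℂ) ω S']
        (p : S' → S), LagrangianBonnet.IsUniversalCover p →
        ∃ D' : LagrangianBonnet.SurfaceData S',
          LagrangianBonnet.IsPullback p D.toCoefficients D'.toCoefficients ∧
          (∃ f : S' → LagrangianBonnet.SpaceForm c,
            LagrangianBonnet.IsConformalLagrangianImmersion c f ∧
            LagrangianBonnet.HasData c f D') ∧
          ∀ f₁ f₂ : S' → LagrangianBonnet.SpaceForm c,
            LagrangianBonnet.IsConformalLagrangianImmersion c f₁ →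
            LagrangianBonnet.HasData c f₁ D' →
            LagrangianBonnet.IsConformalLagrangianImmersion c f₂ →
            LagrangianBonnet.HasData c f₂ D' →
              ∃ T : LagrangianBonnet.SpaceForm c → LagrangianBonnet.SpaceForm c,
                LagrangianBonnet.IsIsometry c T ∧ f₂ = T ∘ f₁) := by
  open LagrangianBonnet in
  refine ⟨fun f hf => ⟨hf.exists_data, fun D hD => hD.isCompatible hf⟩, ?_⟩
  intro D hD S' _ _ _ p hp
  have := hp.simplyConnected
  obtain ⟨f, hf⟩ := exists_isSolvedBy (D.pullback hp.localBiholomorphism)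
    (hD.exists_coord_pullback hp.localBiholomorphism)
  exact ⟨D.pullback hp.localBiholomorphism,
    isPullback_pullback hp.localBiholomorphism D.change_coord,
    ⟨f, isConformalLagrangianImmersion_of_isSolvedBy hf⟩,
    fun f₁ f₂ hf₁ h₁ hf₂ h₂ => exists_isometry_of_hasData hf₁ h₁ hf₂ h₂⟩
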